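/- Let $2\le k\le n$ and let $\sigma$ be a permutation of $\{1,\dots,n\}$ that is increasing on $\{1,\dots,k\}$ and on $\{k+1,\dots,n\}$ (write $\sigma\in S^k_n$). For $\sigma\in S^k_n$ let $S^{l,\sigma}_n=\{\gamma\in S^l_n:\{\sigma(i):i>k\}\subseteq\{\gamma(i):i>l\}\}$. On $\mathbb R^{2n}$ put $\rho_i^2=x_i^2+y_i^2$ and consider, for $\nu_0\in\mathbb R$, the vector field $$\sum_{i=1}^n\omega_i\Big(x_i\tfrac{\partial}{\partial y_i}-y_i\tfrac{\partial}{\partial x_i}\Big)+\Big(\nu_0+\sum_{j}a_{\mathbf e_j}\rho_j^2+\sum_{j\le l}a_{\mathbf e_j+\mathbf e_l}\rho_j^2\rho_l^2\Big)\sum_{i=1}^n\Big(x_i\tfrac{\partial}{\partial x_i}+y_i\tfrac{\partial}{\partial y_i}\Big),$$ where all $\omega_i\neq0$ and $\omega_i/\omega_j\notin\mathbb Q$ for $i<j$. Assume that $\operatorname{sign}(a_{\mathbf e_{\sigma(i)}}a_{\mathbf e_{\sigma(j)}})=-1$ for at least one pair $1\le i<j\le k$, and that all $a_{\mathbf e_{\sigma(i)}+\mathbf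 e_{\sigma(j)}}$, $1\le i\le j\le k$, are nonzero and of the same sign. Put $b=a_{2\mathbf e_{\sigma(k)}}$. Let $\mathcal M_{k,\sigma}$ be the set of points with $\rho_{\sigma(i)}\ne0$ for $i\le k$ and $\rho_{\sigma(i)}=0$ for $i>k$, and $\overline{\mathcal M_{k,\sigma}}$ its closure, the closed cell. Let $\mathbb S^{l-1,\gamma}_{>0}$ be the set of unit vectors $C\in\mathbb R^n$ with $c_{\gamma(i)}>0$ for $i\le l$ and $c_{\gamma(i)}=0$ for $i>l$. For $q(C)=\sum_{i\le k}a_{\mathbf e_{\sigma(i)}}c_{\sigma(i)}^2$ let $\Gamma^{l,\gamma}_{a_1}=\{C\in\mathbb S^{l-1,\gamma}_{>0}:q(C)=0\}$ and $\Gamma^{l,\gamma,+}_{a_1}=\{C\in\mathbb S^{l-1,\gamma}_{>0}:a_{2\mathbf e_{\sigma(1)}}q(C)>0\}$. Put $K=\overline{\Gamma^{k,\sigma,+}_{a_1}}$. The leaf of $C$ is $\{\rho=rC: r>0\}$; the region over $K$ is the union of the leaves with $C\in K$. A flow-invariant hypertorus of the leaf of $C$ is an invariant Clifford torus $\{\rho=R\}$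 contained in it. Let $\mathcal T_{\nu_0}$ be the union of the flow-invariant hypertori of the leaves with $C\in K$. A toral CW complex associated with a finite regular CW complex $K$ is a Hausdorff space partitioned into open toral cells, one over each open cell $e$ of $K$, each homeomorphic to the product of $e$ with a torus of dimension $\dim e+1$ or $\dim e+2$, whose closure is the image, under an attaching homeomorphism that covers the characteristic map of $e$, of the quotient of (torus)$\times$(closed ball) that collapses over each smaller cell $e'$ those circle factors which are not factors over $e'$; boundaries of toral cells lie in toral cells of lower dimension. Then: (0) $\nu_0=0$ is a primary cell-bifurcation value: arbitrarily close to $0$ there are parameters whose phase portrait on $\overline{\mathcal M_{k,\sigma}}$ is not topologically equivalent to that for $\nu_0=0$, and the same holds for the local phase portraits at the origin. (1) For each $C\in K$, the leaf of $C$ has a flow-invariant hypertorus if and only if $\nu_0b<0$, and it is then unique. There are a natural number $l<k$, $\gamma_+\in S^{l,\sigma}_n$ and $\gamma_-\in S^{k-l,\sigma}_n$, with $a_{\mathbf e_{\gamma_+(i)}}b\ge0$ for $i\le l$ and $a_{\mathbf e_{\gamma_-(i)}}b<0$ for $i\le k-l$, such that $K$ is a finite regular CW complex whose open cells are the nonempty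 sets among $\mathbb S^{j-1,\bar\gamma}_{>0}$ ($1\le j\le l$, $\bar\gamma\in S^{j,\gamma_+}_n$; dimension $j-1$) and $\Gamma^{j,\bar\gamma,+}_{a_1}$, $\Gamma^{j,\bar\gamma}_{a_1}$ ($1\le j\le k$, $\bar\gamma\in S^{j,\sigma}_n\setminus(S^{j,\gamma_+}_n\cup S^{j,\gamma_-}_n)$; dimensions $j-1$ and $j-2$), and such that, whenever $\nu_0b<0$, $\mathcal T_{\nu_0}\subseteq\overline{\mathcal M_{k,\sigma}}$ is flow-invariant, compact, connected, and a toral CW complex associated with $K$, with toral cells homeomorphic to $\mathbb T_j\times\mathbb S^{j-1,\bar\gamma}_{>0}$, $\mathbb T_j\times\Gamma^{j,\bar\gamma,+}_{a_1}$, $\mathbb T_j\times\Gamma^{j,\bar\gamma}_{a_1}$ respectively, the fibre over $C$ lying in the leaf of $C$. For $\nu_0\to0$ with $\nu_0b<0$, $\mathcal T_{\nu_0}$ shrinks to the origin; for $|\nu_0|\to\infty$ with $\nu_0b<0$, the distance of $\mathcal T_{\nu_0}$ from the origin tends to infinity. When $\nu_0b<0$: if $b<0$, then $\mathcal T_{\nu_0}$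 is asymptotically stable for the dynamics on the region over $K$, and is Lyapunov stable in $\overline{\mathcal M_{k,\sigma}}$; if $b>0$, it is unstable (not Lyapunov stable), already in the region over $K$. (2) If $\nu_0b\ge0$, no subset of the region over $K$ that is homeomorphic to a torus of dimension at least $1$ is flow-invariant. -/

import Mathlib

open Set Filter Topology

noncomputable section

namespace ToralBif

/-! ### Dynamics of a (possibly incomplete) vector field -/

section Dynamics

variable {E : Type*} [NormedAddCommGroup E] [NormedSpace ℝ E]

/-- `u` is a solution of `u' = v u` on the set `J` of times. -/
def IsSol (v : E → E) (u : ℝ → E) (J : Set ℝ) : Prop :=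
  IsIntegralCurveOn u (fun _ => v) J

/-- `T` is invariant under the local flow of `v`, in forward and in backward time. -/
def FlowInvariant (v : E → E) (T : Set E) : Prop :=
  ∀ (J : Set ℝ) (u : ℝ → E), J.OrdConnected → (0 : ℝ) ∈ J → IsSol v u J → u 0 ∈ T →
    ∀ t ∈ J, u t ∈ T

/-- Lyapunov stability of the set `T` for the dynamics of `v` restricted to the invariant set `Ω`. -/
def LyapunovStableOn (v : E → E) (Ω T : Set E) : Prop :=
  ∀ U : Set E, IsOpen U → T ⊆ U → ∃ V : Set E, IsOpen V ∧ T ⊆ V ∧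
    ∀ (b : ℝ) (u : ℝ → E), IsSol v u (Icc 0 b) → u 0 ∈ V ∩ Ω → ∀ t ∈ Icc 0 b, u t ∈ U

/-- Asymptotic stability of the set `T` for the dynamics of `v` restricted to the invariant
set `Ω`: Lyapunov stability, and all solutions that start in `Ω` near `T` exist for all positive
times and approach `T`. -/
def AsymptoticallyStableOn (v : E → E) (Ω T : Set E) : Prop :=
  LyapunovStableOn v Ω T ∧ ∃ V : Set E, IsOpen V ∧ T ⊆ V ∧ ∀ x ∈ V ∩ Ω,
    (∃ u : ℝ → E, IsSol v u (Ici 0) ∧ u 0 = x) ∧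
    ∀ u : ℝ → E, IsSol v u (Ici 0) → u 0 = x →
      Tendsto (fun t => Metric.infDist (u t) T) atTop (𝓝 0)

/-- `h` carries trajectories of `v` in `A` to trajectories of `w` in `B`, up to an increasing
change of time. -/
def CarriesTrajectories (v w : E → E) {A B : Set E} (h : A → B) : Prop :=
  ∀ (b : ℝ) (u : ℝ → E) (hu : ∀ t ∈ Icc 0 b, u t ∈ A), 0 ≤ b → IsSol v u (Icc 0 b) →
    ∃ (b' : ℝ) (u' : ℝ → E) (τ : ℝ → ℝ), 0 ≤ b' ∧ IsSol w u' (Icc 0 b') ∧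
      StrictMonoOn τ (Icc 0 b) ∧ τ '' Icc 0 b = Icc 0 b' ∧
      ∀ (t : ℝ) (ht : t ∈ Icc 0 b), u' (τ t) = h ⟨u t, hu t ht⟩

/-- Topological equivalence of `v` and `w` on the invariant set `Ω`. -/
def TopEquivOn (v w : E → E) (Ω : Set E) : Prop :=
  ∃ h : Ω ≃ₜ Ω, CarriesTrajectories v w h ∧ CarriesTrajectories w v h.symm

/-- Local topological equivalence, at the equilibrium `0`, of `v` and `w` on the invariant
set `Ω`. -/
def TopEquivAtOriginOn (v w : E → E) (Ω : Set E) : Prop :=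
  ∃ U V : Set E, IsOpen U ∧ IsOpen V ∧ (0 : E) ∈ U ∧ (0 : E) ∈ V ∧
    ∃ h : ↥(U ∩ Ω) ≃ₜ ↥(V ∩ Ω), (∀ x : ↥(U ∩ Ω), (x : E) = 0 → (h x : E) = 0) ∧
      CarriesTrajectories v w h ∧ CarriesTrajectories w v h.symm

/-- `ν₀` is a bifurcation value of the family `v ν` on `Ω`: arbitrarily close to `ν₀` there are
parameters whose phase portrait on `Ω` is not topologically equivalent to that of `ν₀`. -/
def IsBifurcationValueOn (v : ℝ → E → E) (Ω : Set E) (ν₀ : ℝ) : Prop :=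
  ∀ N ∈ 𝓝 ν₀, ∃ ν ∈ N, ¬ TopEquivOn (v ν) (v ν₀) Ω

/-- A bifurcation value is primary if the bifurcation takes place at the equilibrium `0`: already
the local phase portrait at `0` changes. -/
def IsPrimaryBifurcationValueOn (v : ℝ → E → E) (Ω : Set E) (ν₀ : ℝ) : Prop :=
  IsBifurcationValueOn v Ω ν₀ ∧ ∀ N ∈ 𝓝 ν₀, ∃ ν ∈ N, ¬ TopEquivAtOriginOn (v ν) (v ν₀) Ω

end Dynamics

/-! ### Toral CW complexes -/

section Toral

open Topology.CWComplex

variable {Y : Type*} [TopologicalSpace Y]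

/-- A CW complex is regular if every characteristic map is injective on the closed ball (hence, in
a Hausdorff space, a homeomorphism from the closed ball onto the closed cell). -/
def IsRegularCW (K : Set Y) [Topology.CWComplex K] : Prop :=
  ∀ (m : ℕ) (e : cell K m), InjOn (map (C := K) m e) (Metric.closedBall 0 1)

/-- The torus whose circle factors are labelled by `L`. -/
abbrev Torus {Λ : Type*} (L : Finset Λ) : Type _ := L → Circle

variable {Λ : Type*}

/-- The relation on `𝕋 × closed m-ball` which, over a ball point that the characteristic map of
`e` sends to the open cell `e'`, collapses the circles that are not circles of `e'`. -/
def collapseSetoid (K : Set Y) [Topology.CWComplex K]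
    (label : (m : ℕ) → cell K m → Finset Λ) (m : ℕ) (e : cell K m) :
    Setoid (Torus (label m e) × Metric.closedBall (0 : Fin m → ℝ) 1) where
  r p q := p.2 = q.2 ∧ ∀ (m' : ℕ) (e' : cell K m'),
    map (C := K) m e (p.2 : Fin m → ℝ) ∈ openCell (C := K) m' e' →
      ∀ i : label m e, (i : Λ) ∈ label m' e' → p.1 i = q.1 i
  iseqv :=
    { refl := fun _ => ⟨rfl, fun _ _ _ _ _ => rfl⟩
      symm := fun h => ⟨h.1.symm, fun m' e' he i hi => (h.2 m' e' (by rw [h.1]; exact he) i hi).symm⟩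
      trans := fun h h' => ⟨h.1.trans h'.1, fun m' e' he i hi =>
        (h.2 m' e' he i hi).trans (h'.2 m' e' (by rw [← h.1]; exact he) i hi)⟩ }

/-- The closed toral ball of the cell `e`, with the quotient topology. -/
abbrev ClosedToralBall (K : Set Y) [Topology.CWComplex K]
    (label : (m : ℕ) → cell K m → Finset Λ) (m : ℕ) (e : cell K m) : Type _ :=
  Quotient (collapseSetoid K label m e)

/-- A toral CW complex structure on the Hausdorff space `X`, associated with the finite regular CW
complex `K`. Over each open cell `e` of `K` lies an open toral cell, which is the product of `e`
with a torus of dimension `dim e + 1` or `dim e + 2`; its closure is a closed toral ball; the circles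
of a cell in the closure of `e` are among those of `e`, and the others collapse there. -/
structure ToralCWComplex (X : Type*) [TopologicalSpace X] [T2Space X] (Λ : Type*)
    (K : Set Y) [Topology.CWComplex K] where
  finite : Topology.CWComplex.Finite K
  regular : IsRegularCW K
  /-- the circle factors of the toral cell over a cell -/
  label : (m : ℕ) → cell K m → Finset Λ
  card_label : ∀ m e, (label m e).card = m + 1 ∨ (label m e).card = m + 2
  label_subset : ∀ (m : ℕ) (e : cell K m) (m' : ℕ) (e' : cell K m'),
    (openCell (C := K) m' e' ∩ closedCell (C := K) m e).Nonempty → label m' e' ⊆ label m e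
  /-- the open toral cells, which partition `X` -/
  toralCell : (m : ℕ) → cell K m → Set X
  pairwiseDisjoint : (univ : Set (Σ m, cell K m)).PairwiseDisjoint fun p => toralCell p.1 p.2
  iUnion_toralCell : ⋃ (m : ℕ) (e : cell K m), toralCell m e = univ
  /-- the trivialization of a toral cell -/
  g : (m : ℕ) → (e : cell K m) → toralCell m e ≃ₜ Torus (label m e) × openCell (C := K) m e
  /-- the attaching homeomorphism of a toral cell -/
  Φ : (m : ℕ) → (e : cell K m) → ClosedToralBall K label m e ≃ₜ closure (toralCell m e)
  /-- the attaching homeomorphism covers the characteristic map of the cell, and over each cell in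
  the closure it is the projection to the circles that do not collapse -/
  Φ_compat : ∀ (m : ℕ) (e : cell K m) (s : Torus (label m e))
    (y : Metric.closedBall (0 : Fin m → ℝ) 1) (m' : ℕ) (e' : cell K m'),
    map (C := K) m e (y : Fin m → ℝ) ∈ openCell (C := K) m' e' →
      ∃ hx : (Φ m e (Quotient.mk _ (s, y)) : X) ∈ toralCell m' e',
        ((g m' e' ⟨_, hx⟩).2 : Y) = map (C := K) m e (y : Fin m → ℝ) ∧
        ∀ (i : Λ) (hi : i ∈ label m e) (hi' : i ∈ label m' e'),
          (g m' e' ⟨_, hx⟩).1 ⟨i, hi'⟩ = s ⟨i, hi⟩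
  /-- the boundary of a toral cell lies in toral cells of lower dimension -/
  Φ_boundary : ∀ (m : ℕ) (e : cell K m) (s : Torus (label m e))
    (y : Metric.closedBall (0 : Fin m → ℝ) 1), (y : Fin m → ℝ) ∈ Metric.sphere 0 1 →
      ∃ (m' : ℕ) (e' : cell K m'), m' + (label m' e').card < m + (label m e).card ∧
        (Φ m e (Quotient.mk _ (s, y)) : X) ∈ toralCell m' e'

end Toral

/-! ### Cells, leaves and the quadric decomposition of the parameter sphere

The phase space `ℝ²ⁿ` is written as `Fin n → ℂ`, with `z i = x i + y i * I`. Indices run through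
`Fin n`, so that the first `k` indices are those with value `< k`. -/

section Cells

variable {n : ℕ}

/-- The permutations that are increasing on the first `k` indices and on the remaining ones. -/
def shuffles (n k : ℕ) : Set (Equiv.Perm (Fin n)) :=
  {σ | (∀ i j : Fin n, i < j → (j : ℕ) < k → σ i < σ j) ∧
    ∀ i j : Fin n, k ≤ (i : ℕ) → i < j → σ i < σ j}

/-- The `γ` in `shuffles n l` such that `{σ i | i ≥ k} ⊆ {γ i | i ≥ l}`. -/
def subShuffles (k : ℕ) (σ : Equiv.Perm (Fin n)) (l : ℕ) : Set (Equiv.Perm (Fin n)) :=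
  {γ | γ ∈ shuffles n l ∧ σ '' {i | k ≤ (i : ℕ)} ⊆ γ '' {i | l ≤ (i : ℕ)}}

/-- The set of the values of `σ` at the first `k` indices. -/
def firstValues (k : ℕ) (σ : Equiv.Perm (Fin n)) : Finset (Fin n) :=
  (Finset.univ.filter fun i : Fin n => (i : ℕ) < k).map σ.toEmbedding

/-- The open cell of points whose nonzero coordinates are those with index `σ i`, `i < k`. -/
def openCellM (k : ℕ) (σ : Equiv.Perm (Fin n)) : Set (Fin n → ℂ) :=
  {z | ∀ i : Fin n, z (σ i) ≠ 0 ↔ (i : ℕ) < k}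

/-- The unit vectors whose entries are positive at the indices `σ i`, `i < k`, and zero at the
others. -/
def posSphere (k : ℕ) (σ : Equiv.Perm (Fin n)) : Set (Fin n → ℝ) :=
  {C | ∑ i, C i ^ 2 = 1 ∧
    ∀ i : Fin n, ((i : ℕ) < k → 0 < C (σ i)) ∧ (k ≤ (i : ℕ) → C (σ i) = 0)}

/-- The Clifford torus with radius vector `R`. -/
def cliffordTorus (R : Fin n → ℝ) : Set (Fin n → ℂ) :=
  {z | ∀ i, ‖z i‖ = R i}

/-- The leaf with parameter `C`: the points whose radius vector is a positive multiple of `C`. -/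
def leaf (C : Fin n → ℝ) : Set (Fin n → ℂ) :=
  {z | ∃ r : ℝ, 0 < r ∧ ∀ i, ‖z i‖ = r * C i}

/-- The form `∑_{i < k} a_{e_{σ i}} C_{σ i}²`. -/
def quadForm (a₁ : Fin n → ℝ) (k : ℕ) (σ : Equiv.Perm (Fin n)) (C : Fin n → ℝ) : ℝ :=
  ∑ i ∈ Finset.univ.filter (fun i : Fin n => (i : ℕ) < k), a₁ (σ i) * C (σ i) ^ 2

/-- The part of the open cell of `γ` (of dimension `l - 1`) on the quadric of `σ`. -/
def GammaZero (a₁ : Fin n → ℝ) (k : ℕ) (σ : Equiv.Perm (Fin n)) (l : ℕ)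
    (γ : Equiv.Perm (Fin n)) : Set (Fin n → ℝ) :=
  {C ∈ posSphere l γ | quadForm a₁ k σ C = 0}

/-- The part of the open cell of `γ` (of dimension `l - 1`) where the form of `σ` has the sign
of `b`. -/
def GammaPlus (a₁ : Fin n → ℝ) (b : ℝ) (k : ℕ) (σ : Equiv.Perm (Fin n)) (l : ℕ)
    (γ : Equiv.Perm (Fin n)) : Set (Fin n → ℝ) :=
  {C ∈ posSphere l γ | SignType.sign (b * quadForm a₁ k σ C) = 1}

/-- `c` is a member, with cell dimension `m` and with circles labelled by `L`, of the family
consisting of the `posSphere j γ` for `γ` below `γp`, and of the `GammaPlus … j γ` and the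
`GammaZero … j γ` for the `γ` below `σ` that are neither below `γp` nor below `γm`. -/
def IsGammaCell (a₁ : Fin n → ℝ) (b : ℝ) (k : ℕ) (σ : Equiv.Perm (Fin n)) (l : ℕ)
    (γp γm : Equiv.Perm (Fin n)) (m : ℕ) (L : Finset (Fin n)) (c : Set (Fin n → ℝ)) : Prop :=
  (∃ j γ, 1 ≤ j ∧ j ≤ l ∧ γ ∈ subShuffles l γp j ∧
    L = firstValues j γ ∧ m + 1 = j ∧ c = posSphere j γ) ∨
  ∃ j γ, 1 ≤ j ∧ j ≤ k ∧
    γ ∈ subShuffles k σ j \ (subShuffles l γp j ∪ subShuffles (k - l) γm j) ∧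
    L = firstValues j γ ∧
    ((m + 1 = j ∧ c = GammaPlus a₁ b k σ j γ) ∨ (m + 2 = j ∧ c = GammaZero a₁ k σ j γ))

/-- The common radial rate
`ν + ∑_j a_{e_j} (x_j² + y_j²) + ∑_{j ≤ l} a_{e_j + e_l} (x_j² + y_j²) (x_l² + y_l²)`. -/
def radialRate (a₁ : Fin n → ℝ) (a₂ : Sym2 (Fin n) → ℝ) (ν : ℝ) (z : Fin n → ℂ) : ℝ :=
  ν + ∑ j, a₁ j * ‖z j‖ ^ 2 + ∑ j, ∑ l ∈ Finset.Ici j, a₂ s(j, l) * (‖z j‖ ^ 2 * ‖z l‖ ^ 2)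

/-- The vector field: rotation with frequencies `ω` (the field `-y ∂/∂x + x ∂/∂y` is multiplication
by `I`) plus the radial rate times the Euler field. -/
def vectorField (ω a₁ : Fin n → ℝ) (a₂ : Sym2 (Fin n) → ℝ) (ν : ℝ) (z : Fin n → ℂ) : Fin n → ℂ :=
  fun i => (ω i : ℂ) * (Complex.I * z i) + (radialRate a₁ a₂ ν z : ℂ) * z i

/-- `H` is a flow-invariant Clifford hypertorus in the leaf with parameter `C`. -/
def IsInvariantHypertorus (v : (Fin n → ℂ) → Fin n → ℂ) (C : Fin n → ℝ)
    (H : Set (Fin n → ℂ)) : Prop :=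
  (∃ R : Fin n → ℝ, H = cliffordTorus R) ∧ H.Nonempty ∧ H ⊆ leaf C ∧ FlowInvariant v H

/-- The union of the leaves with parameter in `K`. -/
def leafRegion (K : Set (Fin n → ℝ)) : Set (Fin n → ℂ) := ⋃ C ∈ K, leaf C

/-- The union of the flow-invariant Clifford hypertori in the leaves with parameter in `K`. -/
def toralUnion (v : (Fin n → ℂ) → Fin n → ℂ) (K : Set (Fin n → ℝ)) : Set (Fin n → ℂ) :=
  {z | ∃ C ∈ K, ∃ H, IsInvariantHypertorus v C H ∧ z ∈ H}

end Cells

end ToralBif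

end

/-!
The rotations commute with the radial part of the vector field, and the radial part multiplies all
coordinates of a point by the same factor. Hence every solution is `u t i = E t * exp (i ω i t) * z i`
with a growth factor `E` that solves a scalar autonomous equation (`IsSol.exists_growth`),
`E' = E * (ν + q E² + Q E⁴)`, where `q` and `Q` are the values of the quadratic and of the quartic part
of the radial rate at the initial point `z`. On the closed cell `Q` has the sign of `b`, and on the
leaves over `K` also `b * q ≥ 0`. So `ν + q y + Q y²` has a positive root over `K` if and only if
`ν * b < 0`, and the root `eqScale` is then unique and continuous. An invariant torus of a leaf, and
more generally a compact invariant set over `K`, must contain a point at which the radial rate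
vanishes, namely one at which the radii are extremal (`radialRate_eq_zero_of_flowInvariant`). This
settles existence and uniqueness of the hypertori (`isInvariantHypertorus_iff`) and their absence for
`ν * b ≥ 0` (`not_flowInvariant_of_isCompact`).

In the coordinates `C i ^ 2` the region `K` becomes the intersection of a face of the standard simplex
with a half-space, a convex polytope, whose relatively open faces are cut out by the set of the nonzero
coordinates and by the sign of a linear form. Radial parametrizations of the faces make it a finite
regular CW complex (`roundCW`), and the faces are matched with the cells given by shuffles in
`exists_faceIndex_iff`. The union of the hypertori is the graph-like set `toralSet` over `K`: a point
is determined by its parameter `C` and by the phases of its nonzero coordinates, which gives the toral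
CW structure `toralCW`; the circles over a face are indexed by the coordinates that do not vanish on it.

The distance of the growth factor from its equilibrium solves a linear equation (`IsGrowth.sub_eq`),
whose coefficient is negative for `ν > 0 > Q`: the growth factor then approaches the equilibrium
monotonically and exponentially fast, which yields the stability for `b < 0`. Reversal of time turns the
case `b > 0` into that one, so that trajectories leave the hypertori. As for the bifurcation, the origin
attracts its neighbourhood for `ν < 0`, but for `ν = 0` a trajectory leaves it along an axis on which
the quadratic part is positive (`not_topEquivAtOriginOn`), and a global equivalence fixes the origin
because this is the only equilibrium.
-/

noncomputable section

namespace ToralBif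


/-! ### The faces of a half-simplex -/

section HalfSimplex

variable {n : ℕ}

/-- The linear form with coefficients `α`. -/
def linForm (α : Fin n → ℝ) : (Fin n → ℝ) →ₗ[ℝ] ℝ := ∑ i, α i • LinearMap.proj i

theorem linForm_apply (α x : Fin n → ℝ) : linForm α x = ∑ i, α i * x i := by
  simp [linForm]

theorem continuous_linForm (α : Fin n → ℝ) : Continuous (linForm α) :=
  LinearMap.continuous_of_finiteDimensional _

/-- The open faces of the half-simplex `{x | 0 ≤ x, ∑ x = 1, 0 ≤ linForm α x}`: the support of the
points is `J`, and `δ` tells whether the form vanishes or is positive on them. -/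
def openFace (α : Fin n → ℝ) (J : Finset (Fin n)) (δ : Bool) : Set (Fin n → ℝ) :=
  {x | linForm 1 x = 1 ∧ (∀ i ∈ J, 0 < x i) ∧ (∀ i ∉ J, x i = 0) ∧
    (δ = true → linForm α x = 0) ∧ (δ = false → 0 < linForm α x)}

/-- The closed faces of the half-simplex; see `openFace`. -/
def closedFace (α : Fin n → ℝ) (J : Finset (Fin n)) (δ : Bool) : Set (Fin n → ℝ) :=
  {x | linForm 1 x = 1 ∧ (∀ i ∈ J, 0 ≤ x i) ∧ (∀ i ∉ J, x i = 0) ∧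
    (δ = true → linForm α x = 0) ∧ (δ = false → 0 ≤ linForm α x)}

/-- The vectors supported in `J`. -/
def suppSubmodule (J : Finset (Fin n)) : Submodule ℝ (Fin n → ℝ) :=
  ⨅ i ∈ ((Jᶜ : Finset (Fin n)) : Set (Fin n)), LinearMap.ker (LinearMap.proj i)

theorem mem_suppSubmodule {J : Finset (Fin n)} {v : Fin n → ℝ} :
    v ∈ suppSubmodule J ↔ ∀ i ∉ J, v i = 0 := by
  simp [suppSubmodule, Submodule.mem_iInf]

/-- The direction of the affine span of a nonempty open face. -/
def faceDir (α : Fin n → ℝ) (J : Finset (Fin n)) (δ : Bool) : Submodule ℝ (Fin n → ℝ) :=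
  suppSubmodule J ⊓ LinearMap.ker (linForm 1) ⊓
    (if δ = true then LinearMap.ker (linForm α) else ⊤)

variable {α : Fin n → ℝ} {J J' : Finset (Fin n)} {δ δ' : Bool} {x x₀ v : Fin n → ℝ}

theorem mem_faceDir : v ∈ faceDir α J δ ↔
    (∀ i ∉ J, v i = 0) ∧ linForm 1 v = 0 ∧ (δ = true → linForm α v = 0) := by
  cases δ <;> simp [faceDir, mem_suppSubmodule, and_assoc]

theorem openFace_subset_closedFace : openFace α J δ ⊆ closedFace α J δ :=
  fun _ h => ⟨h.1, fun i hi => (h.2.1 i hi).le, h.2.2.1, h.2.2.2.1, fun hd => (h.2.2.2.2 hd).le⟩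

theorem isClosed_closedFace : IsClosed (closedFace α J δ) := by
  have h1 := continuous_linForm (1 : Fin n → ℝ)
  have h2 := continuous_linForm α
  refine (isClosed_eq h1 continuous_const).inter ?_
  have a1 : IsClosed {x : Fin n → ℝ | ∀ i ∈ J, 0 ≤ x i} := by
    simp only [ofPred_forall]
    exact isClosed_iInter fun i => isClosed_iInter fun _ =>
      isClosed_le continuous_const (continuous_apply i)
  have a2 : IsClosed {x : Fin n → ℝ | ∀ i ∉ J, x i = 0} := by
    simp only [ofPred_forall]
    exact isClosed_iInter fun i => isClosed_iInter fun _ =>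
      isClosed_eq (continuous_apply i) continuous_const
  have a3 : IsClosed {x : Fin n → ℝ | (δ = true → linForm α x = 0) ∧
      (δ = false → 0 ≤ linForm α x)} := by
    cases δ
    · simpa using isClosed_le continuous_const h2
    · simpa using isClosed_eq h2 continuous_const
  exact a1.inter (a2.inter a3)

theorem closedFace_subset_Icc : closedFace α J δ ⊆ Icc 0 1 := by
  intro x hx
  have h0 : ∀ i, 0 ≤ x i := fun i => by
    by_cases hi : i ∈ J
    · exact hx.2.1 i hi
    · exact (hx.2.2.1 i hi).ge
  refine ⟨h0, fun i => ?_⟩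
  have h1 := hx.1
  simp only [linForm_apply, Pi.one_apply, one_mul] at h1
  rw [Pi.one_apply, ← h1]
  exact Finset.single_le_sum (fun j _ => h0 j) (Finset.mem_univ i)

theorem isCompact_closedFace : IsCompact (closedFace α J δ) :=
  isCompact_Icc.of_isClosed_subset isClosed_closedFace closedFace_subset_Icc

/-- Half-open segments that end at a point of the open face lie in it. -/
theorem segment_mem_openFace (h₀ : x₀ ∈ openFace α J δ) (hx : x ∈ closedFace α J δ) {t : ℝ}
    (ht : 0 < t) (ht' : t ≤ 1) : (1 - t) • x + t • x₀ ∈ openFace α J δ := by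
  have h1 : 0 ≤ 1 - t := by linarith
  refine ⟨?_, fun i hi => ?_, fun i hi => ?_, fun hd => ?_, fun hd => ?_⟩
  · rw [map_add, map_smul, map_smul, h₀.1, hx.1]; simp
  · have := mul_pos ht (h₀.2.1 i hi)
    have := mul_nonneg h1 (hx.2.1 i hi)
    simp only [Pi.add_apply, Pi.smul_apply, smul_eq_mul]; linarith
  · simp [h₀.2.2.1 i hi, hx.2.2.1 i hi]
  · simp [h₀.2.2.2.1 hd, hx.2.2.2.1 hd]
  · have := mul_pos ht (h₀.2.2.2.2 hd)
    have := mul_nonneg h1 (hx.2.2.2.2 hd)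
    simp only [map_add, map_smul, smul_eq_mul]; linarith

theorem convex_openFace : Convex ℝ (openFace α J δ) := by
  intro x hx y hy a b ha hb hab
  rcases hb.eq_or_lt with rfl | hb
  · obtain rfl : a = 1 := by linarith
    simpa using hx
  · have := segment_mem_openFace hy (openFace_subset_closedFace hx) hb (by linarith)
    rwa [show 1 - b = a by linarith] at this

theorem closure_openFace (hne : (openFace α J δ).Nonempty) :
    closure (openFace α J δ) = closedFace α J δ := by
  refine (closure_minimal openFace_subset_closedFace isClosed_closedFace).antisymm fun x hx => ?_
  obtain ⟨x₀, h₀⟩ := hne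
  have hc : Tendsto (fun t : ℝ => (1 - t) • x + t • x₀) (𝓝[>] 0) (𝓝 x) := by
    have : Continuous (fun t : ℝ => (1 - t) • x + t • x₀) := by fun_prop
    have h := this.tendsto 0
    simp only [sub_zero, one_smul, zero_smul, add_zero] at h
    exact h.mono_left nhdsWithin_le_nhds
  refine mem_closure_of_tendsto hc ?_
  filter_upwards [Ioc_mem_nhdsGT (zero_lt_one' ℝ)] with t ht
  exact segment_mem_openFace h₀ hx ht.1 ht.2

/-- A nonempty open face is bounded, convex and open in its affine span, so the span can be
parametrized in such a way that the open unit ball becomes the open face and the closed unit ball the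
closed face. -/
theorem exists_face_param {m : ℕ} (hne : (openFace α J δ).Nonempty)
    (hm : Module.finrank ℝ (faceDir α J δ) = m) :
    ∃ (φ : (Fin m → ℝ) → (Fin n → ℝ)) (ψ : (Fin n → ℝ) → (Fin m → ℝ)), Continuous φ ∧
      Continuous ψ ∧ (∀ y, ψ (φ y) = y) ∧ φ '' Metric.ball 0 1 = openFace α J δ ∧
      φ '' Metric.closedBall 0 1 = closedFace α J δ := by
  have hne' := hne
  obtain ⟨x₀, h₀⟩ := hne
  let e : (Fin m → ℝ) ≃ₗ[ℝ] faceDir α J δ := LinearEquiv.ofFinrankEq _ _ (by simp [hm])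
  let L : (Fin m → ℝ) →ₗ[ℝ] (Fin n → ℝ) := (faceDir α J δ).subtype ∘ₗ e.toLinearMap
  have hLinj : LinearMap.ker L = ⊥ := by
    rw [LinearMap.ker_eq_bot]
    exact (Subtype.val_injective).comp e.injective
  obtain ⟨G, hG⟩ := L.exists_leftInverse_of_injective hLinj
  have hGL : ∀ y, G (L y) = y := fun y => LinearMap.congr_fun hG y
  have hLc : Continuous L := LinearMap.continuous_of_finiteDimensional _
  have hGc : Continuous G := LinearMap.continuous_of_finiteDimensional _
  let A : (Fin m → ℝ) → (Fin n → ℝ) := fun y => x₀ + L y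
  have hAc : Continuous A := continuous_const.add hLc
  have hLmem : ∀ y, L y ∈ faceDir α J δ := fun y => (e y).2
  have hrange : ∀ x ∈ closedFace α J δ, A (G (x - x₀)) = x := by
    intro x hx
    have hmem : x - x₀ ∈ faceDir α J δ := by
      rw [mem_faceDir]
      refine ⟨fun i hi => ?_, ?_, fun hd => ?_⟩
      · simp [hx.2.2.1 i hi, h₀.2.2.1 i hi]
      · rw [map_sub, hx.1, h₀.1, sub_self]
      · rw [map_sub, hx.2.2.2.1 hd, h₀.2.2.2.1 hd, sub_self]
    have : x - x₀ = L (e.symm ⟨x - x₀, hmem⟩) := by simp [L]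
    simp only [A]
    rw [this, hGL, ← this]; abel
  -- the face in linear coordinates of its affine span
  let S : Set (Fin m → ℝ) := A ⁻¹' openFace α J δ
  have hAS : A '' S = openFace α J δ := by
    refine (image_preimage_subset _ _).antisymm fun x hx => ⟨G (x - x₀), ?_, ?_⟩
    · change A _ ∈ openFace α J δ
      rwa [hrange x (openFace_subset_closedFace hx)]
    · exact hrange x (openFace_subset_closedFace hx)
  have hSopen : IsOpen S := by
    have hS : S = {y | (∀ i ∈ J, 0 < A y i) ∧ (δ = false → 0 < linForm α (A y))} := by
      ext y
      have hy := mem_faceDir.1 (hLmem y)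
      refine ⟨fun h => ⟨h.2.1, h.2.2.2.2⟩, fun h => ⟨?_, h.1, fun i hi => ?_, fun hd => ?_, h.2⟩⟩
      · simp only [A, map_add, h₀.1, hy.2.1, add_zero]
      · simp [A, h₀.2.2.1 i hi, hy.1 i hi]
      · simp only [A, map_add, h₀.2.2.2.1 hd, hy.2.2 hd, add_zero]
    rw [hS]
    have a1 : IsOpen {y : Fin m → ℝ | ∀ i ∈ J, 0 < A y i} := by
      have : {y : Fin m → ℝ | ∀ i ∈ J, 0 < A y i} = ⋂ i ∈ J, {y | 0 < A y i} := by
        ext; simp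
      rw [this]
      exact isOpen_biInter_finset fun i _ =>
        isOpen_lt continuous_const ((continuous_apply i).comp hAc)
    have a2 : IsOpen {y : Fin m → ℝ | δ = false → 0 < linForm α (A y)} := by
      cases δ
      · simpa using isOpen_lt continuous_const ((continuous_linForm α).comp hAc)
      · simp
    exact a1.inter a2
  have hSconv : Convex ℝ S := by
    intro y hy z hz a b ha hb hab
    have := convex_openFace (α := α) hy hz ha hb hab
    change A _ ∈ openFace α J δ
    convert this using 1
    simp only [A, map_add, map_smul, smul_add]
    rw [add_add_add_comm, ← add_smul, hab, one_smul]
  have hScl : closure S = A ⁻¹' closedFace α J δ := by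
    refine (closure_minimal (preimage_mono openFace_subset_closedFace)
      (isClosed_closedFace.preimage hAc)).antisymm fun y hy => ?_
    have hy' : A y ∈ closure (openFace α J δ) := by rwa [closure_openFace hne']
    have h2 := map_mem_closure (f := fun x => G (x - x₀)) (t := S) (by fun_prop) hy'
      (fun x hx => by
        change A _ ∈ openFace α J δ
        rwa [hrange x (openFace_subset_closedFace hx)])
    simpa [A, hGL] using h2
  have hSb : Bornology.IsBounded S := by
    have h1 : S ⊆ (fun x => G (x - x₀)) '' closedFace α J δ := fun y hy =>
      ⟨A y, openFace_subset_closedFace hy, by simp [A, hGL]⟩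
    exact ((isCompact_closedFace.image (by fun_prop)).isBounded).subset h1
  have hSne : (interior S).Nonempty := by
    rw [hSopen.interior_eq]
    exact ⟨0, by simpa [S, A] using h₀⟩
  obtain ⟨h, hh1, hh2, -⟩ :=
    exists_homeomorph_image_interior_closure_frontier_eq_unitBall hSconv hSne hSb
  rw [hSopen.interior_eq] at hh1
  refine ⟨fun y => A (h.symm y), fun x => h (G (x - x₀)), hAc.comp h.symm.continuous,
    by fun_prop, fun y => by simp [A, hGL], ?_, ?_⟩
  · rw [← hh1, ← hAS, image_image]; simp
  · rw [← hh2, hScl, image_image]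
    simp only [Homeomorph.symm_apply_apply]
    refine (image_preimage_subset _ _).antisymm fun x hx => ⟨G (x - x₀), ?_, hrange x hx⟩
    change A _ ∈ closedFace α J δ
    rwa [hrange x hx]

/-- The support of a vector. -/
def vecSupp (x : Fin n → ℝ) : Finset (Fin n) := Finset.univ.filter fun i => x i ≠ 0

theorem mem_vecSupp {i : Fin n} : i ∈ vecSupp x ↔ x i ≠ 0 := by simp [vecSupp]

open Classical in
/-- Every point of the half-simplex lies in the open face given by its support and by the sign of the
form. -/
theorem mem_openFace_vecSupp (h1 : linForm 1 x = 1) (h0 : ∀ i, 0 ≤ x i) (hl : 0 ≤ linForm α x) :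
    x ∈ openFace α (vecSupp x) (decide (linForm α x = 0)) := by
  refine ⟨h1, fun i hi => (h0 i).lt_of_ne' (mem_vecSupp.1 hi), fun i hi => ?_, fun hd => ?_,
    fun hd => ?_⟩
  · simpa [mem_vecSupp] using hi
  · simpa using hd
  · exact hl.lt_of_ne' (by simpa using hd)

theorem vecSupp_of_mem_openFace (h : x ∈ openFace α J δ) : vecSupp x = J := by
  ext i
  rw [mem_vecSupp]
  by_cases hi : i ∈ J
  · simp [hi, (h.2.1 i hi).ne']
  · simp [hi, h.2.2.1 i hi]

theorem openFace_unique (h : x ∈ openFace α J δ) (h' : x ∈ openFace α J' δ') :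
    J = J' ∧ δ = δ' := by
  refine ⟨(vecSupp_of_mem_openFace h).symm.trans (vecSupp_of_mem_openFace h'), ?_⟩
  cases δ <;> cases δ'
  · rfl
  · exact absurd (h'.2.2.2.1 rfl) (h.2.2.2.2 rfl).ne'
  · exact absurd (h.2.2.2.1 rfl) (h'.2.2.2.2 rfl).ne'
  · rfl

theorem subset_of_mem_openFace_of_mem_closedFace (h : x ∈ openFace α J' δ')
    (hx : x ∈ closedFace α J δ) : J' ⊆ J := fun i hi => by
  by_contra hiJ
  exact (h.2.1 i hi).ne' (hx.2.2.1 i hiJ)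

/-- A face in the boundary of a face has smaller dimension. -/
theorem faceDir_lt (hne : (openFace α J δ).Nonempty) (hx : x ∈ closedFace α J δ)
    (hx' : x ∉ openFace α J δ) (h : x ∈ openFace α J' δ') : faceDir α J' δ' < faceDir α J δ := by
  obtain ⟨x₀, h₀⟩ := hne
  have hJ := subset_of_mem_openFace_of_mem_closedFace h hx
  have hd : δ = true → δ' = true := fun hd => by
    cases δ'
    · exact absurd (hx.2.2.2.1 hd) (h.2.2.2.2 rfl).ne'
    · rfl
  have hmem : x₀ - x ∈ faceDir α J δ := by
    rw [mem_faceDir]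
    refine ⟨fun i hi => ?_, ?_, fun hd => ?_⟩
    · simp [hx.2.2.1 i hi, h₀.2.2.1 i hi]
    · rw [map_sub, hx.1, h₀.1, sub_self]
    · rw [map_sub, hx.2.2.2.1 hd, h₀.2.2.2.1 hd, sub_self]
  refine lt_of_le_of_ne (fun v hv => ?_) fun heq => ?_
  · rw [mem_faceDir] at hv ⊢
    exact ⟨fun i hi => hv.1 i fun hi' => hi (hJ hi'), hv.2.1, fun h => hv.2.2 (hd h)⟩
  · rw [← heq, mem_faceDir] at hmem
    have hJJ : J' = J := by
      refine hJ.antisymm fun i hi => ?_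
      by_contra hi'
      have := hmem.1 i hi'
      rw [Pi.sub_apply, h.2.2.1 i hi', sub_zero] at this
      exact (h₀.2.1 i hi).ne' this
    subst hJJ
    cases δ <;> cases δ'
    · exact hx' h
    · have := hmem.2.2 rfl
      rw [map_sub, h.2.2.2.1 rfl, sub_zero] at this
      exact (h₀.2.2.2.2 rfl).ne' this
    · exact absurd (hd rfl) (by simp)
    · exact hx' h

theorem finrank_suppSubmodule (J : Finset (Fin n)) :
    Module.finrank ℝ (suppSubmodule J) = J.card := by
  have e := LinearMap.iInfKerProjEquiv ℝ (fun _ : Fin n => ℝ) (I := (J : Set (Fin n)))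
    (J := ((Jᶜ : Finset (Fin n)) : Set (Fin n)))
    (by simp [disjoint_compl_right]) (by simp)
  rw [suppSubmodule, LinearEquiv.finrank_eq e]
  simp

theorem finrank_inf_ker {E : Type*} [AddCommGroup E] [Module ℝ E] [FiniteDimensional ℝ E]
    (S : Submodule ℝ E) (f : E →ₗ[ℝ] ℝ) (hf : ∃ v ∈ S, f v ≠ 0) :
    Module.finrank ℝ (S ⊓ LinearMap.ker f : Submodule ℝ E) + 1 = Module.finrank ℝ S := by
  obtain ⟨v, hv, hfv⟩ := hf
  have h1 : f.comp S.subtype ≠ 0 := fun h => hfv (by simpa using LinearMap.congr_fun h ⟨v, hv⟩)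
  have h2 := Module.Dual.finrank_ker_add_one_of_ne_zero (f := f.comp S.subtype) h1
  have h3 : (S ⊓ LinearMap.ker f : Submodule ℝ E) =
      (LinearMap.ker (f.comp S.subtype)).map S.subtype := by
    ext x
    simp only [Submodule.mem_inf, LinearMap.mem_ker, Submodule.mem_map]
    exact ⟨fun h => ⟨⟨x, h.1⟩, h.2, rfl⟩, by rintro ⟨y, hy, rfl⟩; exact ⟨y.2, hy⟩⟩
  rw [h3, Submodule.finrank_map_subtype_eq]
  exact h2

theorem linForm_single (α : Fin n → ℝ) (i : Fin n) (c : ℝ) :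
    linForm α (Pi.single i c) = α i * c := by
  rw [linForm_apply, Finset.sum_eq_single i]
  · simp
  · intro j _ hj; simp [hj]
  · simp

theorem single_mem_suppSubmodule {i : Fin n} (hi : i ∈ J) (c : ℝ) :
    Pi.single i c ∈ suppSubmodule J := by
  rw [mem_suppSubmodule]
  intro j hj
  rw [Pi.single_eq_of_ne]
  rintro rfl
  exact hj hi

theorem nonempty_of_openFace (h : (openFace α J δ).Nonempty) : J.Nonempty := by
  obtain ⟨x, hx⟩ := h
  by_contra hJ
  rw [Finset.not_nonempty_iff_eq_empty] at hJ
  subst hJ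
  have : x = 0 := funext fun i => hx.2.2.1 i (by simp)
  have h1 := hx.1
  rw [this, map_zero] at h1
  exact zero_ne_one h1

theorem finrank_suppSubmodule_inf_ker (hJ : J.Nonempty) :
    Module.finrank ℝ (suppSubmodule J ⊓ LinearMap.ker (linForm 1) : Submodule ℝ (Fin n → ℝ)) + 1 =
      J.card := by
  obtain ⟨i, hi⟩ := hJ
  rw [finrank_inf_ker, finrank_suppSubmodule]
  exact ⟨Pi.single i 1, single_mem_suppSubmodule hi 1, by simp [linForm_single]⟩

theorem finrank_faceDir_false (h : (openFace α J false).Nonempty) :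
    Module.finrank ℝ (faceDir α J false) + 1 = J.card := by
  rw [← finrank_suppSubmodule_inf_ker (nonempty_of_openFace h)]
  have : faceDir α J false = suppSubmodule J ⊓ LinearMap.ker (linForm 1) := by
    ext v
    simp [mem_faceDir, mem_suppSubmodule]
  rw [this]

theorem finrank_faceDir_true_of_eq_zero (h : (openFace α J true).Nonempty) (h0 : ∀ i ∈ J, α i = 0) :
    Module.finrank ℝ (faceDir α J true) + 1 = J.card := by
  rw [← finrank_suppSubmodule_inf_ker (nonempty_of_openFace h)]
  have : faceDir α J true = suppSubmodule J ⊓ LinearMap.ker (linForm 1) := by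
    ext v
    simp only [mem_faceDir, Submodule.mem_inf, mem_suppSubmodule, LinearMap.mem_ker,
      forall_const]
    refine ⟨fun h => ⟨h.1, h.2.1⟩, fun h => ⟨h.1, h.2, ?_⟩⟩
    rw [linForm_apply]
    refine Finset.sum_eq_zero fun i _ => ?_
    by_cases hi : i ∈ J
    · rw [h0 i hi, zero_mul]
    · rw [h.1 i hi, mul_zero]
  rw [this]

theorem linForm_eq_sum (h : ∀ i ∉ J, x i = 0) : linForm α x = ∑ i ∈ J, α i * x i := by
  rw [linForm_apply]
  symm
  refine Finset.sum_subset (Finset.subset_univ _) fun i _ hi => by rw [h i hi, mul_zero]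

/-- If the form is not zero on the support of the face, then its zero set in the face has
codimension one. -/
theorem finrank_faceDir_true (h : (openFace α J true).Nonempty) (h0 : ∃ i ∈ J, α i ≠ 0) :
    Module.finrank ℝ (faceDir α J true) + 2 = J.card := by
  have hJ := nonempty_of_openFace h
  obtain ⟨x, hx⟩ := h
  obtain ⟨i, hi, hai⟩ := h0
  -- the form vanishes at a point with positive entries, so its coefficients are not all equal
  have hne : ∃ j ∈ J, α j ≠ α i := by
    by_contra! hcon
    have h1 := hx.2.2.2.1 rfl
    rw [linForm_eq_sum hx.2.2.1, Finset.sum_congr rfl fun j hj => by rw [hcon j hj],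
      ← Finset.mul_sum] at h1
    have h2 : 0 < ∑ j ∈ J, x j := Finset.sum_pos hx.2.1 hJ
    exact (mul_ne_zero hai h2.ne') h1
  obtain ⟨j, hj, hji⟩ := hne
  have h1 := finrank_inf_ker (suppSubmodule J ⊓ LinearMap.ker (linForm 1)) (linForm α) <| by
    refine ⟨Pi.single j 1 - Pi.single i 1, ⟨?_, ?_⟩, ?_⟩
    · exact Submodule.sub_mem _ (single_mem_suppSubmodule hj 1) (single_mem_suppSubmodule hi 1)
    · simp [linForm_single]
    · rw [map_sub, linForm_single, linForm_single, mul_one, mul_one]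
      exact sub_ne_zero.2 hji
  rw [← finrank_suppSubmodule_inf_ker hJ, ← h1]
  rfl

end HalfSimplex


/-! ### The regular CW complex over a half-simplex of the sphere -/

section Round

variable {n : ℕ}

/-- The vector of the squares of the entries. -/
def sqVec (C : Fin n → ℝ) : Fin n → ℝ := fun i => C i ^ 2

/-- The vector of the square roots of the entries. -/
def sqrtVec (x : Fin n → ℝ) : Fin n → ℝ := fun i => √(x i)

theorem continuous_sqVec : Continuous (sqVec (n := n)) := by
  unfold sqVec; fun_prop

theorem continuous_sqrtVec : Continuous (sqrtVec (n := n)) :=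
  continuous_pi fun i => Real.continuous_sqrt.comp (continuous_apply i)

theorem sqVec_sqrtVec {x : Fin n → ℝ} (h : ∀ i, 0 ≤ x i) : sqVec (sqrtVec x) = x :=
  funext fun i => Real.sq_sqrt (h i)

theorem sqrtVec_sqVec {C : Fin n → ℝ} (h : ∀ i, 0 ≤ C i) : sqrtVec (sqVec C) = C :=
  funext fun i => Real.sqrt_sq (h i)

variable (α : Fin n → ℝ) (J P : Finset (Fin n)) (δ : Bool)

/-- The nonnegative unit vectors whose squares form an open face of the half-simplex. -/
def roundOpenFace : Set (Fin n → ℝ) := {C | (∀ i, 0 ≤ C i) ∧ sqVec C ∈ openFace α J δ}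

/-- The nonnegative unit vectors whose squares form a closed face of the half-simplex. -/
def roundClosedFace : Set (Fin n → ℝ) := {C | (∀ i, 0 ≤ C i) ∧ sqVec C ∈ closedFace α J δ}

/-- The nonnegative unit vectors supported in `P` on which the quadratic form with coefficients `α`
is nonnegative. -/
def roundRegion : Set (Fin n → ℝ) :=
  {C | (∀ i, 0 ≤ C i) ∧ linForm 1 (sqVec C) = 1 ∧ (∀ i ∉ P, C i = 0) ∧ 0 ≤ linForm α (sqVec C)}

/-- The nonempty faces of dimension `m`. Over a support on which `α` vanishes, only the face with the
flag `true` is nonempty, so that every face has exactly one index. -/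
abbrev FaceIndex (m : ℕ) : Type :=
  {p : Finset (Fin n) × Bool // p.1 ⊆ P ∧ (openFace α p.1 p.2).Nonempty ∧
    Module.finrank ℝ (faceDir α p.1 p.2) = m}

variable {α J P δ} {m : ℕ} {C : Fin n → ℝ}

theorem nonneg_of_mem_closedFace {x : Fin n → ℝ} (h : x ∈ closedFace α J δ) (i : Fin n) : 0 ≤ x i :=
  (closedFace_subset_Icc h).1 i

theorem sqrtVec_image_openFace : sqrtVec '' openFace α J δ = roundOpenFace α J δ := by
  ext C
  constructor
  · rintro ⟨x, hx, rfl⟩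
    refine ⟨fun i => Real.sqrt_nonneg _, ?_⟩
    rwa [sqVec_sqrtVec (nonneg_of_mem_closedFace (openFace_subset_closedFace hx))]
  · rintro ⟨h0, h⟩
    exact ⟨_, h, sqrtVec_sqVec h0⟩

theorem sqrtVec_image_closedFace : sqrtVec '' closedFace α J δ = roundClosedFace α J δ := by
  ext C
  constructor
  · rintro ⟨x, hx, rfl⟩
    refine ⟨fun i => Real.sqrt_nonneg _, ?_⟩
    rwa [sqVec_sqrtVec (nonneg_of_mem_closedFace hx)]
  · rintro ⟨h0, h⟩
    exact ⟨_, h, sqrtVec_sqVec h0⟩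

/-- A parametrization of the affine span of the face by `ℝᵐ`, which carries the closed unit ball to
the closed face. -/
def faceParam (p : FaceIndex α P m) : (Fin m → ℝ) → (Fin n → ℝ) :=
  (exists_face_param p.2.2.1 p.2.2.2).choose

/-- A continuous left inverse of `faceParam`. -/
def faceParamInv (p : FaceIndex α P m) : (Fin n → ℝ) → (Fin m → ℝ) :=
  (exists_face_param p.2.2.1 p.2.2.2).choose_spec.choose

theorem faceParam_spec (p : FaceIndex α P m) : Continuous (faceParam p) ∧
    Continuous (faceParamInv p) ∧ (∀ y, faceParamInv p (faceParam p y) = y) ∧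
    faceParam p '' Metric.ball 0 1 = openFace α p.1.1 p.1.2 ∧
    faceParam p '' Metric.closedBall 0 1 = closedFace α p.1.1 p.1.2 :=
  (exists_face_param p.2.2.1 p.2.2.2).choose_spec.choose_spec

theorem faceParam_mem (p : FaceIndex α P m) {y : Fin m → ℝ} (hy : y ∈ Metric.closedBall 0 1) :
    faceParam p y ∈ closedFace α p.1.1 p.1.2 := by
  rw [← (faceParam_spec p).2.2.2.2]
  exact mem_image_of_mem _ hy

theorem faceParam_nonneg (p : FaceIndex α P m) {y : Fin m → ℝ} (hy : y ∈ Metric.closedBall 0 1)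
    (i : Fin n) : 0 ≤ faceParam p y i :=
  nonneg_of_mem_closedFace (faceParam_mem p hy) i

theorem charMap_left_inv (p : FaceIndex α P m) {y : Fin m → ℝ} (hy : y ∈ Metric.closedBall 0 1) :
    faceParamInv p (sqVec (sqrtVec (faceParam p y))) = y := by
  rw [sqVec_sqrtVec (faceParam_nonneg p hy), (faceParam_spec p).2.2.1]

theorem charMap_image_ball (p : FaceIndex α P m) :
    (fun y => sqrtVec (faceParam p y)) '' Metric.ball 0 1 = roundOpenFace α p.1.1 p.1.2 := by
  rw [← sqrtVec_image_openFace, ← (faceParam_spec p).2.2.2.1, image_image]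

theorem charMap_image_closedBall (p : FaceIndex α P m) :
    (fun y => sqrtVec (faceParam p y)) '' Metric.closedBall 0 1 =
      roundClosedFace α p.1.1 p.1.2 := by
  rw [← sqrtVec_image_closedFace, ← (faceParam_spec p).2.2.2.2, image_image]

/-- The characteristic map of a face. -/
def charMap (p : FaceIndex α P m) : PartialEquiv (Fin m → ℝ) (Fin n → ℝ) where
  toFun y := sqrtVec (faceParam p y)
  invFun C := faceParamInv p (sqVec C)
  source := Metric.ball 0 1
  target := roundOpenFace α p.1.1 p.1.2
  map_source' y hy := by
    rw [← charMap_image_ball]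
    exact mem_image_of_mem _ hy
  map_target' C hC := by
    rw [← charMap_image_ball] at hC
    obtain ⟨y, hy, rfl⟩ := hC
    dsimp only
    rwa [charMap_left_inv p (Metric.ball_subset_closedBall hy)]
  left_inv' y hy := charMap_left_inv p (Metric.ball_subset_closedBall hy)
  right_inv' C hC := by
    rw [← charMap_image_ball] at hC
    obtain ⟨y, hy, rfl⟩ := hC
    dsimp only
    rw [charMap_left_inv p (Metric.ball_subset_closedBall hy)]

theorem continuous_charMap (p : FaceIndex α P m) : Continuous (charMap p) :=
  continuous_sqrtVec.comp (faceParam_spec p).1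

theorem injOn_charMap (p : FaceIndex α P m) : InjOn (charMap p) (Metric.closedBall 0 1) := by
  intro y hy y' hy' h
  rw [← charMap_left_inv p hy, ← charMap_left_inv p hy']
  exact congrArg (fun C => faceParamInv p (sqVec C)) h

/-- The region is covered by the open faces supported in `P`. -/
theorem exists_roundOpenFace (hC : C ∈ roundRegion α P) :
    ∃ (J : Finset (Fin n)) (δ : Bool), J ⊆ P ∧ C ∈ roundOpenFace α J δ := by
  refine ⟨_, _, ?_, hC.1, mem_openFace_vecSupp hC.2.1 (fun i => sq_nonneg _) hC.2.2.2⟩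
  intro i hi
  by_contra hP
  rw [mem_vecSupp] at hi
  exact hi (by simp [sqVec, hC.2.2.1 i hP])

theorem linForm_nonneg_of_mem_closedFace {x : Fin n → ℝ} (h : x ∈ closedFace α J δ) :
    0 ≤ linForm α x := by
  cases δ
  · exact h.2.2.2.2 rfl
  · exact (h.2.2.2.1 rfl).ge

theorem roundClosedFace_subset (hJ : J ⊆ P) : roundClosedFace α J δ ⊆ roundRegion α P :=
  fun _ hC => ⟨hC.1, hC.2.1, fun i hi => by
    simpa [sqVec] using hC.2.2.2.1 i fun h => hi (hJ h), linForm_nonneg_of_mem_closedFace hC.2⟩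

theorem roundOpenFace_subset_roundClosedFace : roundOpenFace α J δ ⊆ roundClosedFace α J δ :=
  fun _ h => ⟨h.1, openFace_subset_closedFace h.2⟩

theorem roundOpenFace_unique {J' : Finset (Fin n)} {δ' : Bool} (h : C ∈ roundOpenFace α J δ)
    (h' : C ∈ roundOpenFace α J' δ') : J = J' ∧ δ = δ' :=
  openFace_unique h.2 h'.2

/-- The index of a nonempty face. -/
def FaceIndex.mk (hJ : J ⊆ P) (h : C ∈ roundOpenFace α J δ) :
    FaceIndex α P (Module.finrank ℝ (faceDir α J δ)) :=
  ⟨(J, δ), hJ, ⟨_, h.2⟩, rfl⟩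

theorem charMap_sphere_notMem (p : FaceIndex α P m) {y : Fin m → ℝ} (hy : y ∈ Metric.sphere 0 1) :
    charMap p y ∉ roundOpenFace α p.1.1 p.1.2 := by
  rw [← charMap_image_ball]
  rintro ⟨y', hy', h⟩
  have := injOn_charMap p (Metric.ball_subset_closedBall hy') (Metric.sphere_subset_closedBall hy) h
  subst this
  rw [mem_sphere_zero_iff_norm] at hy
  rw [mem_ball_zero_iff, hy] at hy'
  exact lt_irrefl _ hy'

theorem charMap_mem_roundClosedFace (p : FaceIndex α P m) {y : Fin m → ℝ}
    (hy : y ∈ Metric.closedBall 0 1) : charMap p y ∈ roundClosedFace α p.1.1 p.1.2 := by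
  rw [← charMap_image_closedBall]
  exact mem_image_of_mem _ hy

theorem charMap_mem_roundRegion (p : FaceIndex α P m) {y : Fin m → ℝ}
    (hy : y ∈ Metric.closedBall 0 1) : charMap p y ∈ roundRegion α P :=
  roundClosedFace_subset p.2.1 (charMap_mem_roundClosedFace p hy)

theorem finrank_lt_of_mem_sphere (p : FaceIndex α P m) {y : Fin m → ℝ}
    (hy : y ∈ Metric.sphere 0 1) (h : charMap p y ∈ roundOpenFace α J δ) :
    Module.finrank ℝ (faceDir α J δ) < m := by
  rw [← p.2.2.2]
  refine Submodule.finrank_lt_finrank_of_lt (faceDir_lt p.2.2.1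
    (charMap_mem_roundClosedFace p (Metric.sphere_subset_closedBall hy)).2 (fun h' => ?_) h.2)
  exact charMap_sphere_notMem p hy ⟨fun i => Real.sqrt_nonneg _, h'⟩

variable (α P) in
/-- The region is a finite CW complex, whose open cells are the nonempty `roundOpenFace`s. -/
@[reducible]
def roundCW : Topology.CWComplex (roundRegion α P) :=
  Topology.CWComplex.mkFinite (roundRegion α P) (FaceIndex α P) (fun _ p => charMap p)
    -- the dimensions of the faces are at most `n`
    (by
      filter_upwards [eventually_gt_atTop n] with m hm
      refine ⟨fun p => ?_⟩
      have := Submodule.finrank_le (faceDir α p.1.1 p.1.2)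
      rw [p.2.2.2, Module.finrank_fin_fun] at this
      omega)
    (fun m => inferInstance)
    (fun _ _ => rfl)
    (fun _ p => (continuous_charMap p).continuousOn)
    (fun _ p => ((faceParam_spec p).2.1.comp continuous_sqVec).continuousOn)
    -- the open faces are disjoint
    (by
      rintro ⟨m, p⟩ - ⟨m', p'⟩ - hne
      simp only [Function.onFun, Set.disjoint_left]
      rintro C hC hC'
      have h1 : C ∈ roundOpenFace α p.1.1 p.1.2 := by rw [← charMap_image_ball]; exact hC
      have h2 : C ∈ roundOpenFace α p'.1.1 p'.1.2 := by rw [← charMap_image_ball]; exact hC'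
      obtain ⟨h3, h4⟩ := roundOpenFace_unique h1 h2
      have h5 : p.1 = p'.1 := Prod.ext h3 h4
      have h6 : m = m' := by rw [← p.2.2.2, ← p'.2.2.2, h5]
      subst h6
      exact hne (by rw [Subtype.ext h5]))
    -- the boundary of a face lies in faces of lower dimension
    (by
      intro m p y hy
      obtain ⟨J, δ, hJ, h⟩ :=
        exists_roundOpenFace (charMap_mem_roundRegion p (Metric.sphere_subset_closedBall hy))
      simp only [mem_iUnion]
      refine ⟨_, finrank_lt_of_mem_sphere p hy h, FaceIndex.mk hJ h, ?_⟩
      change _ ∈ (fun y => sqrtVec (faceParam (FaceIndex.mk hJ h) y)) '' _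
      rw [charMap_image_closedBall]
      exact roundOpenFace_subset_roundClosedFace h)
    -- the closed faces cover the region
    (by
      ext C
      simp only [mem_iUnion]
      constructor
      · rintro ⟨m, p, y, hy, rfl⟩
        exact charMap_mem_roundRegion p hy
      · intro hC
        obtain ⟨J, δ, hJ, h⟩ := exists_roundOpenFace hC
        refine ⟨_, FaceIndex.mk hJ h, ?_⟩
        change _ ∈ (fun y => sqrtVec (faceParam (FaceIndex.mk hJ h) y)) '' _
        rw [charMap_image_closedBall]
        exact roundOpenFace_subset_roundClosedFace h)

attribute [local instance] roundCW

theorem roundCW_finite : Topology.CWComplex.Finite (roundRegion α P) :=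
  Topology.CWComplex.finite_mkFinite ..

theorem roundCW_openCell (p : FaceIndex α P m) :
    Topology.CWComplex.openCell (C := roundRegion α P) m p = roundOpenFace α p.1.1 p.1.2 :=
  charMap_image_ball p

theorem roundCW_closedCell (p : FaceIndex α P m) :
    Topology.CWComplex.closedCell (C := roundRegion α P) m p = roundClosedFace α p.1.1 p.1.2 :=
  charMap_image_closedBall p

theorem roundCW_regular : IsRegularCW (roundRegion α P) := fun _ p => injOn_charMap p

end Round


/-! ### The toral CW complex over the region -/

section ToralOver

variable {n : ℕ}

/-- The Euclidean norm of the radius vector. -/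
def euclNorm (z : Fin n → ℂ) : ℝ := √(∑ i, ‖z i‖ ^ 2)

/-- The unit vector on the ray of the radius vector. -/
def dirVec (z : Fin n → ℂ) : Fin n → ℝ := fun i => ‖z i‖ / euclNorm z

theorem div_norm_mem_unitSphere {w : ℂ} (h : w ≠ 0) : w / ‖w‖ ∈ Submonoid.unitSphere ℂ := by
  simp [Submonoid.unitSphere, h]

/-- The point `w / ‖w‖` of the circle. -/
def unitPhase {w : ℂ} (h : w ≠ 0) : Circle := ⟨w / ‖w‖, div_norm_mem_unitSphere h⟩

/-- The argument of a complex number, as a point of the circle; the argument of `0` is set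
to be `1`. -/
def phase (w : ℂ) : Circle :=
  if h : w ≠ 0 then unitPhase h else 1

theorem coe_phase {w : ℂ} (h : w ≠ 0) : (phase w : ℂ) = w / ‖w‖ := by
  rw [phase, dif_pos h]
  rfl

theorem continuousOn_phase : ContinuousOn phase {w | w ≠ 0} := by
  have h : @IsInducing Circle ℂ _ _ (fun z => (z : ℂ)) := ⟨rfl⟩
  rw [h.continuousOn_iff]
  have h1 : ContinuousOn (fun w : ℂ => w / ‖w‖) {w | w ≠ 0} :=
    continuousOn_id.div (Complex.continuous_ofReal.comp continuous_norm).continuousOn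
      fun w hw => by simpa using hw
  exact h1.congr fun w hw => coe_phase hw

theorem phase_ofReal_mul {r : ℝ} (hr : 0 < r) (θ : Circle) : phase (r * θ) = θ := by
  have h : (r * θ : ℂ) ≠ 0 := mul_ne_zero (by exact_mod_cast hr.ne') θ.coe_ne_zero
  refine Circle.ext ?_
  rw [coe_phase h, norm_mul, Circle.norm_coe, mul_one, Complex.norm_real, Real.norm_of_nonneg hr.le]
  field_simp [show (r : ℂ) ≠ 0 by exact_mod_cast hr.ne']

theorem ofReal_norm_mul_phase (w : ℂ) : ((‖w‖ : ℝ) : ℂ) * phase w = w := by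
  by_cases h : w = 0
  · simp [h]
  · rw [coe_phase h]
    have : (‖w‖ : ℂ) ≠ 0 := by simpa using h
    field_simp

theorem continuous_euclNorm : Continuous (euclNorm (n := n)) := by
  unfold euclNorm; fun_prop

theorem sum_sq_eq_one {α C : Fin n → ℝ} {P : Finset (Fin n)} (hC : C ∈ roundRegion α P) :
    ∑ i, C i ^ 2 = 1 := by
  have := hC.2.1
  simpa [linForm_apply, sqVec] using this

theorem euclNorm_of_eq {z : Fin n → ℂ} {C : Fin n → ℝ} {r : ℝ} (hr : 0 < r)
    (hC : ∑ i, C i ^ 2 = 1) (h : ∀ i, ‖z i‖ = r * C i) : euclNorm z = r := by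
  rw [euclNorm]
  simp only [h, mul_pow]
  rw [← Finset.mul_sum, hC, mul_one, Real.sqrt_sq hr.le]

theorem dirVec_of_eq {z : Fin n → ℂ} {C : Fin n → ℝ} {r : ℝ} (hr : 0 < r)
    (hC : ∑ i, C i ^ 2 = 1) (h : ∀ i, ‖z i‖ = r * C i) : dirVec z = C := by
  funext i
  rw [dirVec, euclNorm_of_eq hr hC h, h i, mul_div_cancel_left₀ _ hr.ne']

/-- The union of the tori with radius vectors `R C • C`, `C ∈ K`. -/
def toralSet (R : (Fin n → ℝ) → ℝ) (K : Set (Fin n → ℝ)) : Set (Fin n → ℂ) :=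
  {z | ∃ C ∈ K, ∀ i, ‖z i‖ = R C * C i}

/-- The point of the torus with radius vector `R C • C` that has the arguments `θ`. -/
def torusPoint (R : (Fin n → ℝ) → ℝ) (C : Fin n → ℝ) (θ : Fin n → Circle) : Fin n → ℂ :=
  fun i => ((R C * C i : ℝ) : ℂ) * θ i

/-- Extension of a point of a partial torus by `1`. -/
def extTorus {L : Finset (Fin n)} (s : Torus L) : Fin n → Circle :=
  fun i => if h : i ∈ L then s ⟨i, h⟩ else 1

theorem extTorus_apply {L : Finset (Fin n)} (s : Torus L) {i : Fin n} (h : i ∈ L) :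
    extTorus s i = s ⟨i, h⟩ := dif_pos h

theorem continuous_extTorus {L : Finset (Fin n)} : Continuous (extTorus (L := L)) := by
  refine continuous_pi fun i => ?_
  by_cases h : i ∈ L
  · simpa [extTorus, h] using continuous_apply (⟨i, h⟩ : L)
  · simpa [extTorus, h] using continuous_const

variable {α : Fin n → ℝ} {P : Finset (Fin n)} {R : (Fin n → ℝ) → ℝ} {C C' : Fin n → ℝ}
  {m : ℕ}

theorem torusPoint_norm (hRp : ∀ C ∈ roundRegion α P, 0 < R C) (hC : C ∈ roundRegion α P)
    (θ : Fin n → Circle) (i : Fin n) : ‖torusPoint R C θ i‖ = R C * C i := by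
  rw [torusPoint, norm_mul, Circle.norm_coe, mul_one, Complex.norm_real,
    Real.norm_of_nonneg (mul_nonneg (hRp C hC).le (hC.1 i))]

theorem dirVec_torusPoint (hRp : ∀ C ∈ roundRegion α P, 0 < R C) (hC : C ∈ roundRegion α P)
    (θ : Fin n → Circle) : dirVec (torusPoint R C θ) = C :=
  dirVec_of_eq (hRp C hC) (sum_sq_eq_one hC) (torusPoint_norm hRp hC θ)

theorem torusPoint_mem (hRp : ∀ C ∈ roundRegion α P, 0 < R C) (hC : C ∈ roundRegion α P)
    (θ : Fin n → Circle) : torusPoint R C θ ∈ toralSet R (roundRegion α P) :=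
  ⟨C, hC, torusPoint_norm hRp hC θ⟩

theorem phase_torusPoint (hRp : ∀ C ∈ roundRegion α P, 0 < R C) (hC : C ∈ roundRegion α P)
    (θ : Fin n → Circle) {i : Fin n} (hi : 0 < C i) : phase (torusPoint R C θ i) = θ i :=
  phase_ofReal_mul (mul_pos (hRp C hC) hi) _

theorem dirVec_mem {z : Fin n → ℂ} (hRp : ∀ C ∈ roundRegion α P, 0 < R C)
    (hz : z ∈ toralSet R (roundRegion α P)) :
    dirVec z ∈ roundRegion α P ∧ euclNorm z = R (dirVec z) ∧
      ∀ i, ‖z i‖ = R (dirVec z) * dirVec z i := by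
  obtain ⟨C, hC, h⟩ := hz
  rw [dirVec_of_eq (hRp C hC) (sum_sq_eq_one hC) h, euclNorm_of_eq (hRp C hC) (sum_sq_eq_one hC) h]
  exact ⟨hC, rfl, h⟩

theorem torusPoint_congr {θ θ' : Fin n → Circle} (h : ∀ i, C i ≠ 0 → θ i = θ' i) :
    torusPoint R C θ = torusPoint R C θ' := by
  funext i
  by_cases hi : C i = 0
  · simp [torusPoint, hi]
  · rw [torusPoint, torusPoint, h i hi]

theorem torusPoint_dirVec {z : Fin n → ℂ} (hRp : ∀ C ∈ roundRegion α P, 0 < R C)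
    (hz : z ∈ toralSet R (roundRegion α P)) {θ : Fin n → Circle}
    (hθ : ∀ i, z i ≠ 0 → θ i = phase (z i)) : torusPoint R (dirVec z) θ = z := by
  obtain ⟨h1, -, h3⟩ := dirVec_mem hRp hz
  funext i
  rw [torusPoint, ← h3 i]
  by_cases hi : z i = 0
  · simp [hi]
  · rw [hθ i hi, ofReal_norm_mul_phase]

theorem continuousOn_torusPoint (hRc : ContinuousOn R (roundRegion α P)) :
    ContinuousOn (fun p : (Fin n → ℝ) × (Fin n → Circle) => torusPoint R p.1 p.2)
      (roundRegion α P ×ˢ univ) := by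
  refine continuousOn_pi.2 fun i => ContinuousOn.mul ?_ ?_
  · refine Complex.continuous_ofReal.comp_continuousOn ?_
    refine ContinuousOn.mul (hRc.comp continuousOn_fst fun p hp => hp.1) ?_
    fun_prop
  · have h : Continuous ((↑) : Circle → ℂ) := continuous_subtype_val
    exact (h.comp ((continuous_apply i).comp continuous_snd)).continuousOn

theorem continuous_dirVec (hRp : ∀ C ∈ roundRegion α P, 0 < R C) :
    Continuous fun x : toralSet R (roundRegion α P) => dirVec (x : Fin n → ℂ) := by
  refine continuous_pi fun i => Continuous.div ?_ ?_ fun x => ?_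
  · exact ((continuous_apply i).comp continuous_subtype_val).norm
  · exact continuous_euclNorm.comp continuous_subtype_val
  · obtain ⟨h1, h2, -⟩ := dirVec_mem hRp x.2
    rw [h2]
    exact (hRp _ h1).ne'

/-- The part of the union of the tori that lies over an open face. -/
def toralCellOver (R : (Fin n → ℝ) → ℝ) (α : Fin n → ℝ) (P J : Finset (Fin n)) (δ : Bool) :
    Set (toralSet R (roundRegion α P)) :=
  {x | dirVec (x : Fin n → ℂ) ∈ roundOpenFace α J δ}

theorem mem_iff_ne_zero_of_mem_roundOpenFace {J : Finset (Fin n)} {δ : Bool} (h : C ∈ roundOpenFace α J δ)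
    {i : Fin n} : i ∈ J ↔ C i ≠ 0 := by
  by_cases hi : i ∈ J
  · have := h.2.2.1 i hi
    simp only [hi, true_iff]
    rintro h0
    simp [sqVec, h0] at this
  · have := h.2.2.2.1 i hi
    simp only [sqVec, ne_eq, OfNat.ofNat_ne_zero, not_false_eq_true, pow_eq_zero_iff] at this
    simp [hi, this]

theorem mem_iff_of_toralCellOver {J : Finset (Fin n)} {δ : Bool}
    (hRp : ∀ C ∈ roundRegion α P, 0 < R C) {x : toralSet R (roundRegion α P)}
    (h : x ∈ toralCellOver R α P J δ) {i : Fin n} : i ∈ J ↔ (x : Fin n → ℂ) i ≠ 0 := by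
  obtain ⟨h1, -, h3⟩ := dirVec_mem hRp x.2
  rw [mem_iff_ne_zero_of_mem_roundOpenFace h, ← norm_ne_zero_iff (a := (x : Fin n → ℂ) i), h3 i, mul_ne_zero_iff]
  exact ⟨fun h => ⟨(hRp _ h1).ne', h⟩, fun h => h.2⟩

attribute [local instance] roundCW

theorem roundOpenFace_subset_roundRegion (p : FaceIndex α P m) :
    roundOpenFace α p.1.1 p.1.2 ⊆ roundRegion α P :=
  roundOpenFace_subset_roundClosedFace.trans (roundClosedFace_subset p.2.1)

/-- The toral cell over an open face is a product: a point is given by the phases of its nonzero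
coordinates and by its parameter. -/
def toralTrivialization (hRc : ContinuousOn R (roundRegion α P))
    (hRp : ∀ C ∈ roundRegion α P, 0 < R C) (p : FaceIndex α P m) :
    toralCellOver R α P p.1.1 p.1.2 ≃ₜ Torus p.1.1 × roundOpenFace α p.1.1 p.1.2 where
  toFun x := (fun i => phase (x.1.1 i), ⟨dirVec x.1.1, x.2⟩)
  invFun q := ⟨⟨torusPoint R q.2 (extTorus q.1),
    torusPoint_mem hRp (roundOpenFace_subset_roundRegion p q.2.2) _⟩, by
      change dirVec _ ∈ roundOpenFace α p.1.1 p.1.2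
      rw [dirVec_torusPoint hRp (roundOpenFace_subset_roundRegion p q.2.2)]
      exact q.2.2⟩
  left_inv x := by
    refine Subtype.ext (Subtype.ext (torusPoint_dirVec hRp x.1.2 fun i hi => ?_))
    rw [extTorus_apply _ ((mem_iff_of_toralCellOver hRp x.2).2 hi)]
  right_inv q := by
    have hq := roundOpenFace_subset_roundRegion p q.2.2
    refine Prod.ext (funext fun i => ?_) (Subtype.ext ?_)
    · change phase (torusPoint R q.2 (extTorus q.1) i) = _
      rw [phase_torusPoint hRp hq, extTorus_apply _ i.2]
      exact (q.2.2.1 i).lt_of_ne' ((mem_iff_ne_zero_of_mem_roundOpenFace q.2.2).1 i.2)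
    · exact dirVec_torusPoint hRp hq _
  continuous_toFun := by
    refine Continuous.prodMk (continuous_pi fun i => ?_) ?_
    · refine continuousOn_phase.comp_continuous
        ((continuous_apply _).comp (continuous_subtype_val.comp continuous_subtype_val)) fun x => ?_
      exact (mem_iff_of_toralCellOver hRp x.2).1 i.2
    · exact ((continuous_dirVec hRp).comp continuous_subtype_val).subtype_mk _
  continuous_invFun := by
    refine Continuous.subtype_mk (Continuous.subtype_mk ?_ _) _
    exact (continuousOn_torusPoint hRc).comp_continuous
      ((continuous_subtype_val.comp continuous_snd).prodMk (continuous_extTorus.comp continuous_fst))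
      fun q => ⟨roundOpenFace_subset_roundRegion p q.2.2, trivial⟩

/-- The circles of a cell are the coordinates that do not vanish on it. -/
def faceLabel (m : ℕ) (p : Topology.CWComplex.cell (roundRegion α P) m) : Finset (Fin n) :=
  (show FaceIndex α P m from p).1.1

/-- The attaching map of a toral cell, before passing to the quotient. -/
def attachMap (hRp : ∀ C ∈ roundRegion α P, 0 < R C) (p : FaceIndex α P m)
    (q : Torus p.1.1 × Metric.closedBall (0 : Fin m → ℝ) 1) : toralSet R (roundRegion α P) :=
  ⟨torusPoint R (charMap p q.2) (extTorus q.1),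
    torusPoint_mem hRp (charMap_mem_roundRegion p q.2.2) _⟩

theorem continuous_attachMap (hRc : ContinuousOn R (roundRegion α P))
    (hRp : ∀ C ∈ roundRegion α P, 0 < R C) (p : FaceIndex α P m) :
    Continuous (attachMap hRp p) := by
  refine Continuous.subtype_mk ?_ _
  exact (continuousOn_torusPoint hRc).comp_continuous
    (((continuous_charMap p).comp (continuous_subtype_val.comp continuous_snd)).prodMk
      (continuous_extTorus.comp continuous_fst))
    fun q => ⟨charMap_mem_roundRegion p q.2.2, trivial⟩

theorem dirVec_attachMap (hRp : ∀ C ∈ roundRegion α P, 0 < R C) (p : FaceIndex α P m)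
    (q : Torus p.1.1 × Metric.closedBall (0 : Fin m → ℝ) 1) :
    dirVec (attachMap hRp p q : Fin n → ℂ) = charMap p q.2 :=
  dirVec_torusPoint hRp (charMap_mem_roundRegion p q.2.2) _

theorem support_subset (p : FaceIndex α P m) {y : Fin m → ℝ} (hy : y ∈ Metric.closedBall 0 1)
    {i : Fin n} (hi : charMap p y i ≠ 0) : i ∈ p.1.1 := by
  by_contra h
  have := (charMap_mem_roundClosedFace p hy).2.2.2.1 i h
  exact hi (by simpa [sqVec] using this)

/-- Two points have the same image under the attaching map exactly if they are identified in the
closed toral ball. -/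
theorem attachMap_eq_iff (hRp : ∀ C ∈ roundRegion α P, 0 < R C) (p : FaceIndex α P m)
    (q q' : Torus p.1.1 × Metric.closedBall (0 : Fin m → ℝ) 1) :
    attachMap hRp p q = attachMap hRp p q' ↔
      collapseSetoid (roundRegion α P) faceLabel m p q q' := by
  constructor
  · intro h
    have hy : q.2 = q'.2 := by
      refine Subtype.ext (injOn_charMap p q.2.2 q'.2.2 ?_)
      rw [← dirVec_attachMap hRp p q, h, dirVec_attachMap]
    refine ⟨hy, fun m' e' he i hi => ?_⟩
    have he' : charMap p q.2 ∈ roundOpenFace α (faceLabel m' e')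
        (show FaceIndex α P m' from e').1.2 := by
      rw [roundCW_openCell] at he; exact he
    have hpos : 0 < charMap p q.2 i :=
      (he'.1 i).lt_of_ne' ((mem_iff_ne_zero_of_mem_roundOpenFace he').1 hi)
    have h1 := congrArg (fun x : toralSet R (roundRegion α P) => phase (x.1 i)) h
    have hC := charMap_mem_roundRegion p q.2.2
    simp only [attachMap, ← hy] at h1
    rw [phase_torusPoint hRp hC _ hpos, phase_torusPoint hRp hC _ hpos,
      extTorus_apply (L := p.1.1) _ i.2, extTorus_apply (L := p.1.1) _ i.2] at h1
    exact h1
  · rintro ⟨hy, h⟩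
    refine Subtype.ext ?_
    simp only [attachMap, ← hy]
    refine torusPoint_congr fun i hi => ?_
    have hiJ := support_subset p q.2.2 hi
    rw [extTorus_apply _ hiJ, extTorus_apply _ hiJ]
    obtain ⟨J, δ, hJ, hC⟩ := exists_roundOpenFace (charMap_mem_roundRegion p q.2.2)
    refine h _ (FaceIndex.mk hJ hC) ?_ ⟨i, hiJ⟩ ((mem_iff_ne_zero_of_mem_roundOpenFace hC).2 hi)
    rw [roundCW_openCell]
    exact hC

theorem range_attachMap (hRc : ContinuousOn R (roundRegion α P))
    (hRp : ∀ C ∈ roundRegion α P, 0 < R C) (p : FaceIndex α P m) :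
    range (attachMap hRp p) = closure (toralCellOver R α P p.1.1 p.1.2) := by
  have hc := continuous_attachMap hRc hRp p
  refine Subset.antisymm ?_ ?_
  · -- the open ball is dense in the closed ball
    rintro _ ⟨⟨s, y⟩, rfl⟩
    have hm : (y : Fin m → ℝ) ∈ closure (Metric.ball (0 : Fin m → ℝ) 1) := by
      rw [closure_ball _ one_ne_zero]; exact y.2
    have hy : y ∈ closure {y' : Metric.closedBall (0 : Fin m → ℝ) 1 |
        (y' : Fin m → ℝ) ∈ Metric.ball 0 1} := by
      rw [closure_subtype]
      convert hm
      ext w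
      simp only [mem_image, mem_ofPred_eq, Subtype.exists, exists_and_left, exists_prop]
      exact ⟨by rintro ⟨a, ha, -, rfl⟩; exact ha,
        fun h => ⟨w, h, Metric.ball_subset_closedBall h, rfl⟩⟩
    refine map_mem_closure (f := fun y' => attachMap hRp p (s, y')) (by fun_prop) hy ?_
    intro y' hy'
    change dirVec _ ∈ roundOpenFace α p.1.1 p.1.2
    rw [dirVec_attachMap, ← charMap_image_ball]
    exact mem_image_of_mem _ hy'
  · refine closure_minimal (fun x hx => ?_) (isCompact_range hc).isClosed
    have hx' : dirVec (x : Fin n → ℂ) ∈ roundOpenFace α p.1.1 p.1.2 := hx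
    rw [← charMap_image_ball] at hx'
    obtain ⟨y, hy, hyx⟩ := hx'
    refine ⟨(fun i => phase (x.1 i), ⟨y, Metric.ball_subset_closedBall hy⟩), Subtype.ext ?_⟩
    change torusPoint R (sqrtVec (faceParam p y)) _ = _
    dsimp only at hyx
    rw [hyx]
    refine torusPoint_dirVec hRp x.2 fun i hi => ?_
    rw [extTorus_apply _ ((mem_iff_of_toralCellOver hRp hx).2 hi)]

/-- The attaching map of a toral cell, as a map to the closure of the toral cell. -/
def attachLift (hRc : ContinuousOn R (roundRegion α P))
    (hRp : ∀ C ∈ roundRegion α P, 0 < R C) (p : FaceIndex α P m)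
    (x : ClosedToralBall (roundRegion α P) faceLabel m p) :
    closure (toralCellOver R α P p.1.1 p.1.2) :=
  Quotient.lift (fun q => ⟨attachMap hRp p q, by
      rw [← range_attachMap hRc hRp p]; exact mem_range_self q⟩)
    (fun q q' h => Subtype.ext ((attachMap_eq_iff hRp p q q').2 h)) x

theorem bijective_attachLift (hRc : ContinuousOn R (roundRegion α P))
    (hRp : ∀ C ∈ roundRegion α P, 0 < R C) (p : FaceIndex α P m) :
    Function.Bijective (attachLift hRc hRp p) := by
  constructor
  · intro x x' h
    obtain ⟨q, rfl⟩ := Quotient.exists_rep x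
    obtain ⟨q', rfl⟩ := Quotient.exists_rep x'
    exact Quotient.sound ((attachMap_eq_iff hRp p q q').1 (congrArg Subtype.val h))
  · rintro ⟨x, hx⟩
    have hx' := hx
    rw [← range_attachMap hRc hRp p] at hx'
    obtain ⟨q, rfl⟩ := hx'
    exact ⟨Quotient.mk _ q, rfl⟩

theorem continuous_attachLift (hRc : ContinuousOn R (roundRegion α P))
    (hRp : ∀ C ∈ roundRegion α P, 0 < R C) (p : FaceIndex α P m) :
    Continuous (attachLift hRc hRp p) :=
  continuous_quot_lift _ ((continuous_attachMap hRc hRp p).subtype_mk _)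

/-- The attaching homeomorphism of a toral cell. -/
def attachHomeo (hRc : ContinuousOn R (roundRegion α P))
    (hRp : ∀ C ∈ roundRegion α P, 0 < R C) (p : FaceIndex α P m) :
    ClosedToralBall (roundRegion α P) faceLabel m p ≃ₜ
      closure (toralCellOver R α P p.1.1 p.1.2) :=
  Continuous.homeoOfEquivCompactToT2
    (f := Equiv.ofBijective _ (bijective_attachLift hRc hRp p)) (continuous_attachLift hRc hRp p)

theorem card_faceLabel (p : FaceIndex α P m) : p.1.1.card = m + 1 ∨ p.1.1.card = m + 2 := by
  obtain ⟨⟨J, δ⟩, hJ, hne, hm⟩ := p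
  dsimp only at hne hm ⊢
  cases δ
  · have := finrank_faceDir_false hne; omega
  · by_cases h0 : ∀ i ∈ J, α i = 0
    · have := finrank_faceDir_true_of_eq_zero hne h0; omega
    · push Not at h0
      have := finrank_faceDir_true hne h0; omega

/-- The union of the tori is a toral CW complex over the region. -/
def toralCW (hRc : ContinuousOn R (roundRegion α P)) (hRp : ∀ C ∈ roundRegion α P, 0 < R C) :
    ToralCWComplex (toralSet R (roundRegion α P)) (Fin n) (roundRegion α P) where
  finite := roundCW_finite
  regular := roundCW_regular
  label := faceLabel
  card_label m p := card_faceLabel p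
  label_subset m p m' p' := by
    rintro ⟨C, hC', hC⟩
    rw [roundCW_openCell] at hC'
    rw [roundCW_closedCell] at hC
    exact subset_of_mem_openFace_of_mem_closedFace hC'.2 hC.2
  toralCell m p := toralCellOver R α P (faceLabel m p) (show FaceIndex α P m from p).1.2
  pairwiseDisjoint := by
    rintro ⟨m, p⟩ - ⟨m', p'⟩ - hne
    simp only [Function.onFun, Set.disjoint_left]
    intro x hx hx'
    obtain ⟨h3, h4⟩ := roundOpenFace_unique hx hx'
    have h5 : (show FaceIndex α P m from p).1 = (show FaceIndex α P m' from p').1 :=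
      Prod.ext h3 h4
    have h6 : m = m' := by
      rw [← (show FaceIndex α P m from p).2.2.2, ← (show FaceIndex α P m' from p').2.2.2, h5]
    subst h6
    exact hne (congrArg (Sigma.mk m) (Subtype.ext h5))
  iUnion_toralCell := by
    refine eq_univ_of_forall fun x => ?_
    obtain ⟨J, δ, hJ, h⟩ := exists_roundOpenFace (dirVec_mem hRp x.2).1
    simp only [mem_iUnion]
    exact ⟨_, FaceIndex.mk hJ h, h⟩
  g m p := (toralTrivialization hRc hRp p).trans
    ((Homeomorph.refl _).prodCongr (Homeomorph.setCongr (roundCW_openCell p).symm))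
  Φ m p := attachHomeo hRc hRp p
  Φ_compat := by
    intro m p s y m' p' h
    rw [roundCW_openCell] at h
    have h' : (attachMap hRp p (s, y) : toralSet R (roundRegion α P)) ∈
        toralCellOver R α P (faceLabel m' p') (show FaceIndex α P m' from p').1.2 := by
      change dirVec (attachMap hRp p (s, y) : Fin n → ℂ) ∈
        roundOpenFace α (faceLabel m' p') (show FaceIndex α P m' from p').1.2
      rw [dirVec_attachMap]
      exact h
    refine ⟨h', dirVec_attachMap hRp p (s, y), fun i hi hi' => ?_⟩
    change phase (torusPoint R (charMap p y) (extTorus s) i) = _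
    rw [phase_torusPoint hRp (charMap_mem_roundRegion p y.2), extTorus_apply _ hi]
    exact (h.1 i).lt_of_ne' ((mem_iff_ne_zero_of_mem_roundOpenFace h).1 hi')
  Φ_boundary := by
    intro m p s y hy
    obtain ⟨J, δ, hJ, h⟩ := exists_roundOpenFace (charMap_mem_roundRegion p y.2)
    refine ⟨_, FaceIndex.mk hJ h, ?_, ?_⟩
    · have h1 := finrank_lt_of_mem_sphere p hy h
      have h2 : J ⊆ p.1.1 := subset_of_mem_openFace_of_mem_closedFace h.2
        (charMap_mem_roundClosedFace p y.2).2
      exact add_lt_add_of_lt_of_le h1 (Finset.card_le_card h2)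
    · change dirVec (attachMap hRp p (s, y) : Fin n → ℂ) ∈ roundOpenFace α J δ
      rw [dirVec_attachMap]
      exact h

theorem toralCW_mem_leaf (hRc : ContinuousOn R (roundRegion α P))
    (hRp : ∀ C ∈ roundRegion α P, 0 < R C) (p : Topology.CWComplex.cell (roundRegion α P) m)
    (x : (toralCW hRc hRp).toralCell m p) :
    ((x : toralSet R (roundRegion α P)) : Fin n → ℂ) ∈
      leaf (((toralCW hRc hRp).g m p x).2 : Fin n → ℝ) := by
  obtain ⟨h1, h2, h3⟩ := dirVec_mem hRp x.1.2
  exact ⟨_, hRp _ h1, h3⟩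

end ToralOver


/-! ### Shuffles and the faces of the region -/

section Shuffles

variable {n : ℕ}

theorem mem_firstValues {j : ℕ} {γ : Equiv.Perm (Fin n)} {i : Fin n} :
    i ∈ firstValues j γ ↔ (γ.symm i : ℕ) < j := by
  simp only [firstValues, Finset.mem_map_equiv, Finset.mem_filter, Finset.mem_univ, true_and]

theorem apply_mem_firstValues {j : ℕ} {γ : Equiv.Perm (Fin n)} {i : Fin n} :
    γ i ∈ firstValues j γ ↔ (i : ℕ) < j := by
  rw [mem_firstValues, Equiv.symm_apply_apply]

theorem card_firstValues {j : ℕ} (γ : Equiv.Perm (Fin n)) (hj : j ≤ n) :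
    (firstValues j γ).card = j := by
  rw [firstValues, Finset.card_map, Fin.card_filter_val_lt]
  omega

theorem mem_subShuffles {k l : ℕ} {σ γ : Equiv.Perm (Fin n)} :
    γ ∈ subShuffles k σ l ↔ γ ∈ shuffles n l ∧ firstValues l γ ⊆ firstValues k σ := by
  refine and_congr_right fun _ => ⟨fun h i hi => ?_, fun h => ?_⟩
  · rw [mem_firstValues] at hi ⊢
    by_contra hk
    obtain ⟨i', hi', h'⟩ := h ⟨σ.symm i, not_lt.1 hk, σ.apply_symm_apply i⟩
    rw [← h', Equiv.symm_apply_apply] at hi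
    exact absurd hi (not_lt.2 hi')
  · rintro _ ⟨i, hi, rfl⟩
    refine ⟨γ.symm (σ i), ?_, γ.apply_symm_apply _⟩
    change l ≤ _
    by_contra hl
    have := h (mem_firstValues.2 (not_le.1 hl))
    rw [apply_mem_firstValues] at this
    exact absurd this (not_lt.2 hi)

/-- Every set of indices is the set of first values of a shuffle. -/
theorem exists_shuffle (J : Finset (Fin n)) :
    ∃ γ ∈ shuffles n J.card, firstValues J.card γ = J := by
  have hc : (Jᶜ).card = n - J.card := by simp [Finset.card_compl]
  have hle : J.card ≤ n := by simpa using J.card_le_univ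
  have hn : J.card + (n - J.card) = n := by omega
  let γ : Equiv.Perm (Fin n) :=
    ((finCongr hn).symm.trans finSumFinEquiv.symm).trans (finSumEquivOfFinset rfl hc)
  have h1 : ∀ (i : Fin n) (hi : (i : ℕ) < J.card), γ i = J.orderEmbOfFin rfl ⟨i, hi⟩ := by
    intro i hi
    rw [← finSumEquivOfFinset_inl rfl hc]
    simp only [γ, Equiv.trans_apply, finCongr_symm, finCongr_apply]
    congr 1
    rw [Equiv.symm_apply_eq, finSumFinEquiv_apply_left]
    rfl
  have h2 : ∀ (i : Fin n) (hi : J.card ≤ (i : ℕ)),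
      γ i = (Jᶜ).orderEmbOfFin hc ⟨i - J.card, by omega⟩ := by
    intro i hi
    rw [← finSumEquivOfFinset_inr rfl hc]
    simp only [γ, Equiv.trans_apply, finCongr_symm, finCongr_apply]
    congr 1
    rw [Equiv.symm_apply_eq, finSumFinEquiv_apply_right]
    ext
    simp
    omega
  refine ⟨γ, ⟨fun i j hij hj => ?_, fun i j hi hij => ?_⟩, ?_⟩
  · rw [h1 i (lt_trans hij hj), h1 j hj, OrderEmbedding.lt_iff_lt]
    exact hij
  · rw [h2 i hi, h2 j (hi.trans (Fin.le_def.1 hij.le)), OrderEmbedding.lt_iff_lt]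
    rw [Fin.lt_def] at hij ⊢
    simp only
    omega
  · refine Finset.eq_of_subset_of_card_le (fun i hi => ?_) (card_firstValues γ hle).ge
    rw [mem_firstValues] at hi
    have := h1 _ hi
    rw [Equiv.apply_symm_apply] at this
    rw [this]
    exact Finset.orderEmbOfFin_mem ..

variable {a₁ : Fin n → ℝ} {b : ℝ} {k j l m : ℕ} {σ γ : Equiv.Perm (Fin n)} {C : Fin n → ℝ}
  {c : Set (Fin n → ℝ)} {L : Finset (Fin n)}

theorem mem_posSphere : C ∈ posSphere j γ ↔
    ∑ i, C i ^ 2 = 1 ∧ (∀ i ∈ firstValues j γ, 0 < C i) ∧ ∀ i ∉ firstValues j γ, C i = 0 := by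
  refine and_congr_right fun _ => ⟨fun h => ⟨fun i hi => ?_, fun i hi => ?_⟩, fun h i => ?_⟩
  · simpa using (h (γ.symm i)).1 (mem_firstValues.1 hi)
  · simpa using (h (γ.symm i)).2 (not_lt.1 fun hl => hi (mem_firstValues.2 hl))
  · exact ⟨fun hi => h.1 _ (apply_mem_firstValues.2 hi),
      fun hi => h.2 _ fun hm => absurd (apply_mem_firstValues.1 hm) (not_lt.2 hi)⟩

/-- On the closed cell of `σ` the form of `σ` is a linear form in the squares of the entries. -/
theorem mul_quadForm (h : ∀ i ∉ firstValues k σ, C i = 0) :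
    b * quadForm a₁ k σ C = linForm (fun i => b * a₁ i) (sqVec C) := by
  rw [linForm_eq_sum (J := firstValues k σ) (fun i hi => by simp [sqVec, h i hi]), firstValues,
    Finset.sum_map, quadForm, Finset.mul_sum]
  exact Finset.sum_congr rfl fun i _ => by simp [sqVec, mul_assoc]

/-- A face is given by the sign of the form on the points with the given support. -/
theorem mem_roundOpenFace_iff {α : Fin n → ℝ} {δ : Bool} :
    C ∈ roundOpenFace α (firstValues j γ) δ ↔ C ∈ posSphere j γ ∧
      (δ = true → linForm α (sqVec C) = 0) ∧ (δ = false → 0 < linForm α (sqVec C)) := by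
  rw [mem_posSphere]
  constructor
  · intro h
    refine ⟨⟨?_, fun i hi => ?_, fun i hi => ?_⟩, h.2.2.2.2⟩
    · simpa [linForm_apply, sqVec] using h.2.1
    · exact (h.1 i).lt_of_ne' ((mem_iff_ne_zero_of_mem_roundOpenFace h).1 hi)
    · by_contra h0
      exact hi ((mem_iff_ne_zero_of_mem_roundOpenFace h).2 h0)
  · rintro ⟨⟨h1, h2, h3⟩, h4⟩
    refine ⟨fun i => ?_, ?_, fun i hi => ?_, fun i hi => ?_, h4⟩
    · by_cases hi : i ∈ firstValues j γ
      · exact (h2 i hi).le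
      · exact (h3 i hi).ge
    · simpa [linForm_apply, sqVec] using h1
    · exact pow_pos (h2 i hi) 2
    · simp [sqVec, h3 i hi]

theorem GammaPlus_eq (h : firstValues j γ ⊆ firstValues k σ) :
    GammaPlus a₁ b k σ j γ = roundOpenFace (fun i => b * a₁ i) (firstValues j γ) false := by
  ext C
  rw [mem_roundOpenFace_iff]
  refine and_congr_right fun hC => ?_
  rw [mul_quadForm fun i hi => (mem_posSphere.1 hC).2.2 i fun h' => hi (h h'), sign_eq_one_iff]
  simp

theorem GammaZero_eq (hb : b ≠ 0) (h : firstValues j γ ⊆ firstValues k σ) :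
    GammaZero a₁ k σ j γ = roundOpenFace (fun i => b * a₁ i) (firstValues j γ) true := by
  ext C
  rw [mem_roundOpenFace_iff]
  refine and_congr_right fun hC => ?_
  rw [← mul_quadForm (b := b) fun i hi => (mem_posSphere.1 hC).2.2 i fun h' => hi (h h')]
  simp [hb]

open Classical in
/-- Over indices with nonnegative coefficients the form vanishes everywhere or is positive everywhere,
so the whole open cell is a face. -/
theorem posSphere_eq {α : Fin n → ℝ} (h : ∀ i ∈ firstValues j γ, 0 ≤ α i) :
    posSphere j γ =
      roundOpenFace α (firstValues j γ) (decide (∀ i ∈ firstValues j γ, α i = 0)) := by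
  ext C
  rw [mem_roundOpenFace_iff]
  refine ⟨fun hC => ⟨hC, ?_⟩, fun hC => hC.1⟩
  have hC' := mem_posSphere.1 hC
  rw [linForm_eq_sum (J := firstValues j γ) fun i hi => by simp [sqVec, hC'.2.2 i hi]]
  refine ⟨fun hd => ?_, fun hd => ?_⟩
  · rw [decide_eq_true_iff] at hd
    exact Finset.sum_eq_zero fun i hi => by rw [hd i hi, zero_mul]
  · rw [decide_eq_false_iff_not] at hd
    push Not at hd
    obtain ⟨i, hi, h0⟩ := hd
    exact Finset.sum_pos' (fun i hi => mul_nonneg (h i hi) (sq_nonneg _))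
      ⟨i, hi, mul_pos ((h i hi).lt_of_ne' h0) (pow_pos (hC'.2.1 i hi) 2)⟩

theorem IsGammaCell.subset_posSphere {γp γm : Equiv.Perm (Fin n)}
    (h : IsGammaCell a₁ b k σ l γp γm m L c) :
    ∃ j γ, L = firstValues j γ ∧ c ⊆ posSphere j γ := by
  rcases h with ⟨j, γ, -, -, -, hL, -, rfl⟩ | ⟨j, γ, -, -, -, hL, ⟨-, rfl⟩ | ⟨-, rfl⟩⟩
  · exact ⟨j, γ, hL, Subset.rfl⟩
  · exact ⟨j, γ, hL, fun _ h => h.1⟩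
  · exact ⟨j, γ, hL, fun _ h => h.1⟩

/-- The label of a cell is determined by the cell, as the common support of its points. -/
theorem label_eq_of_isGammaCell {α : Fin n → ℝ} {P : Finset (Fin n)} {γp γm : Equiv.Perm (Fin n)}
    (e : FaceIndex α P m)
    (h : IsGammaCell a₁ b k σ l γp γm m L (roundOpenFace α e.1.1 e.1.2)) : e.1.1 = L := by
  obtain ⟨x, hx⟩ := e.2.2.1
  have hC : sqrtVec x ∈ roundOpenFace α e.1.1 e.1.2 := by
    rw [← sqrtVec_image_openFace]
    exact mem_image_of_mem _ hx
  obtain ⟨j, γ, rfl, hsub⟩ := h.subset_posSphere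
  have h' := mem_posSphere.1 (hsub hC)
  ext i
  rw [mem_iff_ne_zero_of_mem_roundOpenFace hC]
  refine ⟨fun hi => ?_, fun hi => (h'.2.1 i hi).ne'⟩
  by_contra hi'
  exact hi (h'.2.2 i hi')

/-- The nonempty members of the family of cells are the nonempty faces of the region. Over a set of
indices with nonnegative coefficients there is one face, the whole open cell; over a set of indices with
negative coefficients there is none; over the other sets both the form may vanish and be positive, and
its zero set has codimension one. -/
theorem exists_faceIndex_iff (hb : b ≠ 0) (hkn : k ≤ n) {γp γm : Equiv.Perm (Fin n)}
    (hl : l ≤ k)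
    (hγp : firstValues l γp = (firstValues k σ).filter fun i => 0 ≤ b * a₁ i)
    (hγm : firstValues (k - l) γm = (firstValues k σ).filter fun i => b * a₁ i < 0) :
    (∃ e : FaceIndex (fun i => b * a₁ i) (firstValues k σ) m,
      roundOpenFace (fun i => b * a₁ i) e.1.1 e.1.2 = c) ↔
    c.Nonempty ∧ ∃ L, IsGammaCell a₁ b k σ l γp γm m L c := by
  set α : Fin n → ℝ := fun i => b * a₁ i with hα
  have hl' : (firstValues l γp).card = l := card_firstValues γp (hl.trans hkn)
  have hk' : (firstValues k σ).card = k := card_firstValues σ hkn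
  have ne_iff : ∀ {J δ}, (roundOpenFace α J δ).Nonempty ↔ (openFace α J δ).Nonempty := by
    intro J δ
    rw [← sqrtVec_image_openFace, image_nonempty]
  constructor
  · rintro ⟨⟨⟨J, δ⟩, hJ, hne, hm⟩, rfl⟩
    dsimp only at hJ hne hm ⊢
    refine ⟨ne_iff.2 hne, J, ?_⟩
    obtain ⟨γ, hγ, hγJ⟩ := exists_shuffle J
    have hJpos := (nonempty_of_openFace hne).card_pos
    by_cases hp : J ⊆ firstValues l γp
    · have h0 : ∀ i ∈ J, 0 ≤ α i := fun i hi => by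
        have := hp hi
        rw [hγp, Finset.mem_filter] at this
        exact this.2
      have hδ : δ = true → ∀ i ∈ J, α i = 0 := by
        rintro rfl i hi
        obtain ⟨x, hx⟩ := hne
        have h1 := hx.2.2.2.1 rfl
        rw [linForm_eq_sum hx.2.2.1,
          Finset.sum_eq_zero_iff_of_nonneg fun i hi => mul_nonneg (h0 i hi) (hx.2.1 i hi).le] at h1
        exact (mul_eq_zero.1 (h1 i hi)).resolve_right (hx.2.1 i hi).ne'
      refine Or.inl ⟨J.card, γ, hJpos, hl' ▸ Finset.card_le_card hp,
        mem_subShuffles.2 ⟨hγ, by rwa [hγJ]⟩, hγJ.symm, ?_, ?_⟩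
      · cases δ
        · have := finrank_faceDir_false hne; omega
        · have := finrank_faceDir_true_of_eq_zero hne (hδ rfl); omega
      · rw [posSphere_eq (α := α) (by rwa [hγJ]), hγJ]
        congr 1
        cases δ
        · obtain ⟨x, hx⟩ := hne
          symm
          rw [decide_eq_false_iff_not]
          intro h
          have h1 := hx.2.2.2.2 rfl
          rw [linForm_eq_sum hx.2.2.1,
            Finset.sum_eq_zero fun i hi => by rw [h i hi, zero_mul]] at h1
          exact lt_irrefl _ h1
        · symm
          rw [decide_eq_true_iff]
          exact hδ rfl
    · have hm' : ¬ J ⊆ firstValues (k - l) γm := by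
        intro h
        obtain ⟨x, hx⟩ := hne
        have h1 := linForm_nonneg_of_mem_closedFace (openFace_subset_closedFace hx)
        rw [linForm_eq_sum hx.2.2.1] at h1
        refine absurd h1 (not_le.2 (Finset.sum_neg (fun i hi => ?_) (Finset.card_pos.1 hJpos)))
        have := h hi
        rw [hγm, Finset.mem_filter] at this
        exact mul_neg_of_neg_of_pos this.2 (hx.2.1 i hi)
      have h0 : ∃ i ∈ J, α i ≠ 0 := by
        obtain ⟨i, hi, hi'⟩ := Finset.not_subset.1 hp
        rw [hγp, Finset.mem_filter] at hi'
        exact ⟨i, hi, fun h => hi' ⟨hJ hi, h.ge⟩⟩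
      refine Or.inr ⟨J.card, γ, hJpos, hk' ▸ Finset.card_le_card hJ,
        ⟨mem_subShuffles.2 ⟨hγ, by rwa [hγJ]⟩, ?_⟩, hγJ.symm, ?_⟩
      · rintro (h | h)
        · exact hp (hγJ ▸ (mem_subShuffles.1 h).2)
        · exact hm' (hγJ ▸ (mem_subShuffles.1 h).2)
      · cases δ
        · refine Or.inl ⟨?_, ?_⟩
          · have := finrank_faceDir_false hne; omega
          · rw [GammaPlus_eq (by rwa [hγJ]), hγJ]
        · refine Or.inr ⟨?_, ?_⟩
          · have := finrank_faceDir_true hne h0; omega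
          · rw [GammaZero_eq hb (by rwa [hγJ]), hγJ]
  · rintro ⟨hne, L, ⟨j, γ, hj, hjl, hγ, -, hm, rfl⟩ | ⟨j, γ, hj, hjk, ⟨hγ, hγ'⟩, -, h⟩⟩
    · rw [mem_subShuffles] at hγ
      have hcard := card_firstValues γ (hjl.trans (hl.trans hkn))
      have h0 : ∀ i ∈ firstValues j γ, 0 ≤ α i ∧ i ∈ firstValues k σ := fun i hi => by
        have := hγ.2 hi
        rw [hγp, Finset.mem_filter] at this
        exact ⟨this.2, this.1⟩
      obtain ⟨d, hps, hd⟩ : ∃ d : Bool, posSphere j γ = roundOpenFace α (firstValues j γ) d ∧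
          (d = true ↔ ∀ i ∈ firstValues j γ, α i = 0) :=
        ⟨_, posSphere_eq (α := α) fun i hi => (h0 i hi).1, decide_eq_true_iff⟩
      rw [hps, ne_iff] at hne
      refine ⟨⟨(firstValues j γ, d), fun i hi => (h0 i hi).2, hne, ?_⟩, hps.symm⟩
      dsimp only
      cases d
      · have := finrank_faceDir_false hne
        omega
      · have := finrank_faceDir_true_of_eq_zero hne (hd.1 rfl)
        omega
    · have hsub := (mem_subShuffles.1 hγ).2
      have hcard := card_firstValues γ (hjk.trans hkn)
      rcases h with ⟨hm, rfl⟩ | ⟨hm, rfl⟩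
      · rw [GammaPlus_eq hsub] at hne ⊢
        rw [ne_iff] at hne
        refine ⟨⟨(firstValues j γ, false), hsub, hne, ?_⟩, rfl⟩
        have := finrank_faceDir_false hne
        dsimp only; omega
      · rw [GammaZero_eq hb hsub] at hne ⊢
        rw [ne_iff] at hne
        refine ⟨⟨(firstValues j γ, true), hsub, hne, ?_⟩, rfl⟩
        have h0 : ∃ i ∈ firstValues j γ, α i ≠ 0 := by
          have hp : ¬ firstValues j γ ⊆ firstValues l γp := fun h =>
            hγ' (Or.inl (mem_subShuffles.2 ⟨(mem_subShuffles.1 hγ).1, h⟩))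
          obtain ⟨i, hi, hi'⟩ := Finset.not_subset.1 hp
          rw [hγp, Finset.mem_filter] at hi'
          exact ⟨i, hi, fun h => hi' ⟨hsub hi, h.ge⟩⟩
        have := finrank_faceDir_true hne h0
        dsimp only; omega

/-! ### The region as a closure; compactness and connectedness -/

variable {α : Fin n → ℝ} {P : Finset (Fin n)} {R : (Fin n → ℝ) → ℝ}

theorem roundRegion_eq : roundRegion α P = roundClosedFace α P false := by
  refine Subset.antisymm (fun C hC => ?_) (roundClosedFace_subset Subset.rfl)
  exact ⟨hC.1, hC.2.1, fun i _ => sq_nonneg _, fun i hi => by simp [sqVec, hC.2.2.1 i hi],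
    by simp, fun _ => hC.2.2.2⟩

theorem openFace_false_nonempty {p : Fin n} (hp : p ∈ P) (hα : 0 < α p) :
    (openFace α P false).Nonempty := by
  have hcard : (0 : ℝ) < P.card := by exact_mod_cast Finset.card_pos.2 ⟨p, hp⟩
  let u : Fin n → ℝ := fun i => if i ∈ P then (P.card : ℝ)⁻¹ else 0
  let f : ℝ → Fin n → ℝ := fun t => (1 - t) • Pi.single p 1 + t • u
  -- near a vertex at which the form is positive it stays positive
  have hf : ∀ᶠ t in 𝓝[>] (0 : ℝ), 0 < linForm α (f t) := by
    have hc : Continuous fun t => linForm α (f t) :=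
      (continuous_linForm α).comp (by fun_prop)
    have h0 : 0 < linForm α (f 0) := by simpa [f, linForm_single] using hα
    exact nhdsWithin_le_nhds ((hc.tendsto 0).eventually (lt_mem_nhds h0))
  obtain ⟨t, ht, ht0, ht1⟩ := (hf.and (Ioo_mem_nhdsGT (zero_lt_one' ℝ))).exists
  have hu : linForm 1 u = 1 := by
    simp [linForm_apply, u, hcard.ne']
  refine ⟨f t, ?_, fun i hi => ?_, fun i hi => ?_, by simp, fun _ => ht⟩
  · simp [f, linForm_single, hu]
  · have h1 : 0 < t * (P.card : ℝ)⁻¹ := by positivity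
    have h2 : 0 ≤ (1 - t) * (Pi.single p 1 : Fin n → ℝ) i := by
      refine mul_nonneg (by linarith) ?_
      by_cases h : i = p
      · subst h; simp
      · simp [h]
    simp only [f, u, Pi.add_apply, Pi.smul_apply, smul_eq_mul, hi, if_true]
    linarith
  · have h : i ≠ p := fun h => hi (h ▸ hp)
    simp [f, u, hi, h]

theorem isClosed_roundClosedFace {δ : Bool} : IsClosed (roundClosedFace α P δ) := by
  have h1 : IsClosed {C : Fin n → ℝ | ∀ i, 0 ≤ C i} := by
    simp only [ofPred_forall]
    exact isClosed_iInter fun i => isClosed_le continuous_const (continuous_apply i)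
  exact h1.inter (isClosed_closedFace.preimage continuous_sqVec)

theorem closure_roundOpenFace {δ : Bool} (hne : (openFace α P δ).Nonempty) :
    closure (roundOpenFace α P δ) = roundClosedFace α P δ := by
  refine (closure_minimal roundOpenFace_subset_roundClosedFace isClosed_roundClosedFace).antisymm ?_
  rw [← sqrtVec_image_openFace, ← sqrtVec_image_closedFace, ← closure_openFace hne]
  exact image_closure_subset_closure_image continuous_sqrtVec

theorem isCompact_roundRegion : IsCompact (roundRegion α P) := by
  rw [roundRegion_eq, ← sqrtVec_image_closedFace]
  exact isCompact_closedFace.image continuous_sqrtVec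

theorem isConnected_roundRegion (hne : (openFace α P false).Nonempty) :
    IsConnected (roundRegion α P) := by
  rw [roundRegion_eq, ← sqrtVec_image_closedFace, ← closure_openFace hne]
  exact (((convex_openFace (α := α)).closure).isConnected hne.closure).image _
    continuous_sqrtVec.continuousOn

theorem toralSet_eq_image (hRp : ∀ C ∈ roundRegion α P, 0 < R C) :
    toralSet R (roundRegion α P) =
      (fun p : (Fin n → ℝ) × (Fin n → Circle) => torusPoint R p.1 p.2) ''
        (roundRegion α P ×ˢ univ) := by
  ext z
  constructor
  · intro hz
    exact ⟨(dirVec z, fun i => phase (z i)), ⟨(dirVec_mem hRp hz).1, trivial⟩,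
      torusPoint_dirVec hRp hz fun i _ => rfl⟩
  · rintro ⟨⟨C, θ⟩, ⟨hC, -⟩, rfl⟩
    exact torusPoint_mem hRp hC θ

theorem isCompact_toralSet (hRc : ContinuousOn R (roundRegion α P))
    (hRp : ∀ C ∈ roundRegion α P, 0 < R C) : IsCompact (toralSet R (roundRegion α P)) := by
  rw [toralSet_eq_image hRp]
  exact (isCompact_roundRegion.prod isCompact_univ).image_of_continuousOn
    (continuousOn_torusPoint hRc)

theorem isConnected_toralSet (hRc : ContinuousOn R (roundRegion α P))
    (hRp : ∀ C ∈ roundRegion α P, 0 < R C) (hne : (openFace α P false).Nonempty) :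
    IsConnected (toralSet R (roundRegion α P)) := by
  rw [toralSet_eq_image hRp]
  exact ((isConnected_roundRegion hne).prod isConnected_univ).image _
    (continuousOn_torusPoint hRc)

end Shuffles


/-! ### Ordinary differential equations -/

section ODE

/-- The solution of a linear differential equation with scalar coefficient, which is continuous only
on the given set of times. -/
theorem linear_ode_eq {F : Type*} [NormedAddCommGroup F] [NormedSpace ℝ F] {J : Set ℝ}
    (hJ : J.OrdConnected) (h0 : (0 : ℝ) ∈ J) {c : ℝ → ℝ} {f : ℝ → F} (hc : ContinuousOn c J)
    (hf : ∀ t ∈ J, HasDerivWithinAt f (c t • f t) J t) {t : ℝ} (ht : t ∈ J) :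
    f t = Real.exp (∫ s in (0 : ℝ)..t, c s) • f 0 := by
  have hI : uIcc 0 t ⊆ J := hJ.uIcc_subset h0 ht
  -- a continuous extension of the coefficient, so that its primitive is differentiable
  let d : ℝ → ℝ := IccExtend (min_le_max : min 0 t ≤ max 0 t) ((uIcc 0 t).domRestrict c)
  have hd : Continuous d := (continuousOn_iff_continuous_domRestrict.1 (hc.mono hI)).Icc_extend'
  have hdc : ∀ s ∈ uIcc 0 t, d s = c s := fun s hs => IccExtend_of_mem _ _ hs
  let H : ℝ → ℝ := fun s => ∫ x in (0 : ℝ)..s, d x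
  have hH : ∀ s, HasDerivAt H (d s) s := fun s =>
    intervalIntegral.integral_hasDerivAt_right (hd.intervalIntegrable _ _)
      (hd.stronglyMeasurableAtFilter _ _) hd.continuousAt
  have hG : ∀ s ∈ uIcc 0 t,
      HasDerivWithinAt (fun s => Real.exp (-H s) • f s) 0 (uIcc 0 t) s := by
    intro s hs
    have h1 := ((hH s).neg.exp).hasDerivWithinAt (s := uIcc 0 t)
    have h2 := h1.smul ((hf s (hI hs)).mono hI)
    rw [hdc s hs, smul_smul, ← add_smul, mul_neg, add_neg_cancel, zero_smul] at h2
    exact h2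
  have h1 := (convex_uIcc 0 t).norm_image_sub_le_of_norm_hasDerivWithin_le (C := 0) hG (by simp)
    left_mem_uIcc right_mem_uIcc
  rw [zero_mul, norm_le_zero_iff, sub_eq_zero] at h1
  have h2 : H t = ∫ s in (0 : ℝ)..t, c s := intervalIntegral.integral_congr hdc
  have h3 : H 0 = 0 := intervalIntegral.integral_same
  rw [h3, neg_zero, Real.exp_zero, one_smul] at h1
  rw [← h2, ← h1, smul_smul, ← Real.exp_add, add_neg_cancel, Real.exp_zero, one_smul]

/-- A bounded Lipschitz vector field on the line has global solutions. -/
theorem exists_global_solution {G : ℝ → ℝ} {L : NNReal} (hG : LipschitzWith L G) {B : ℝ}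
    (hB : ∀ x, |G x| ≤ B) (x₀ : ℝ) : ∃ u : ℝ → ℝ, u 0 = x₀ ∧ ∀ t, HasDerivAt u (G (u t)) t := by
  have hB0 : 0 ≤ B := (abs_nonneg _).trans (hB 0)
  have h1 : ∀ N : ℕ, ∃ u : ℝ → ℝ, u 0 = x₀ ∧
      ∀ t ∈ Ioo (-(N + 1 : ℝ)) (N + 1), HasDerivAt u (G (u t)) t := by
    intro N
    have hN : (0 : ℝ) ≤ N + 1 := by positivity
    have h := IsPicardLindelof.of_time_independent (f := G) (tmin := -(N + 1 : ℝ)) (tmax := N + 1)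
      (t₀ := ⟨0, by constructor <;> linarith⟩) (x₀ := x₀) (a := B.toNNReal * (N + 1)) (r := 0)
      (L := B.toNNReal) (K := L) (fun x _ => by rw [Real.coe_toNNReal _ hB0]; exact hB x)
      hG.lipschitzOnWith (by simp)
    obtain ⟨u, hu0, hu⟩ := h.exists_eq_forall_mem_Icc_hasDerivWithinAt₀
    exact ⟨u, hu0, fun t ht => (hu t (Ioo_subset_Icc_self ht)).hasDerivAt
      (Icc_mem_nhds ht.1 ht.2)⟩
  choose U hU0 hU using h1
  have huniq : ∀ N M : ℕ, ∀ t ∈ Ioo (-(N + 1 : ℝ)) (N + 1), N ≤ M → U N t = U M t := by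
    intro N M t ht hNM
    have hNM' : (N : ℝ) ≤ M := by exact_mod_cast hNM
    exact ODE_solution_unique_of_mem_Ioo (v := fun _ => G) (s := fun _ => univ) (t₀ := 0)
      (fun _ _ => hG.lipschitzOnWith) (by constructor <;> linarith [Nat.cast_nonneg (α := ℝ) N])
      (fun t ht => ⟨hU N t ht, trivial⟩)
      (fun t ht => ⟨hU M t (Ioo_subset_Ioo (by linarith) (by linarith) ht), trivial⟩)
      ((hU0 N).trans (hU0 M).symm) ht
  let u : ℝ → ℝ := fun t => U ⌈|t|⌉₊ t
  have hu : ∀ N : ℕ, ∀ t ∈ Ioo (-(N + 1 : ℝ)) (N + 1), u t = U N t := by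
    intro N t ht
    have hmem : t ∈ Ioo (-(⌈|t|⌉₊ + 1 : ℝ)) (⌈|t|⌉₊ + 1) := by
      have := Nat.le_ceil |t|
      rw [mem_Ioo, ← abs_lt]
      linarith
    rcases le_total ⌈|t|⌉₊ N with h | h
    · exact huniq _ _ t hmem h
    · exact (huniq _ _ t ht h).symm
  refine ⟨u, (hu 0 0 (by simp)).trans (hU0 0), fun t => ?_⟩
  have hmem : t ∈ Ioo (-(⌈|t|⌉₊ + 1 : ℝ)) (⌈|t|⌉₊ + 1) := by
    have := Nat.le_ceil |t|
    rw [mem_Ioo, ← abs_lt]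
    linarith
  have h2 := hU _ t hmem
  rw [← hu _ t hmem] at h2
  refine h2.congr_of_eventuallyEq ?_
  filter_upwards [Ioo_mem_nhds hmem.1 hmem.2] with s hs using hu _ s hs

/-- The case of `exists_scalar_solution_tendsto` in which the solution decreases to the
equilibrium. -/
theorem exists_scalar_solution_tendsto_of_lt {G : ℝ → ℝ} (hG : ContDiff ℝ 1 G) {e e₀ : ℝ}
    (he : e < e₀) (hGe : G e = 0) (hneg : ∀ x ∈ Ioc e e₀, G x < 0) :
    ∃ u : ℝ → ℝ, u 0 = e₀ ∧ (∀ t, 0 ≤ t → HasDerivAt u (G (u t)) t ∧ u t ∈ Ioc e e₀) ∧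
      Tendsto u atTop (𝓝 e) := by
  -- cut the field off outside of the interval between the equilibrium and the initial value
  let p : ℝ → ℝ := fun x => projIcc e e₀ he.le x
  have hp : ∀ x, p x ∈ Icc e e₀ := fun x => (projIcc e e₀ he.le x).2
  obtain ⟨L, hL⟩ := (hG.locallyLipschitz.locallyLipschitzOn
    (s := Icc e e₀)).exists_lipschitzOnWith_of_compact isCompact_Icc
  have hGp : LipschitzWith L (fun x => G (p x)) := by
    have h1 : LipschitzWith 1 p := LipschitzWith.projIcc he.le
    have := hL.comp h1.lipschitzOnWith (fun x (_ : x ∈ univ) => hp x)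
    rw [lipschitzOnWith_univ, mul_one] at this
    exact this
  obtain ⟨B, hB⟩ := isCompact_Icc.exists_bound_of_continuousOn
    (hG.continuous.continuousOn (s := Icc e e₀))
  obtain ⟨u, hu0, hu⟩ := exists_global_solution hGp (fun x => hB _ (hp x)) e₀
  have hcont : Continuous u := continuous_iff_continuousAt.2 fun t => (hu t).continuousAt
  have hnonpos : ∀ x ∈ Icc e e₀, G x ≤ 0 := fun x hx => by
    rcases hx.1.eq_or_lt with rfl | h
    · exact hGe.le
    · exact (hneg x ⟨h, hx.2⟩).le
  have hanti : Antitone u := antitone_of_deriv_nonpos (fun t => (hu t).differentiableAt)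
    fun t => by rw [(hu t).deriv]; exact hnonpos _ (hp _)
  -- by uniqueness the solution does not meet the equilibrium
  have hne : ∀ t, u t ≠ e := by
    intro t ht
    have : u = fun _ => e := ODE_solution_unique_univ (v := fun _ x => G (p x))
      (s := fun _ => univ) (t₀ := t) (fun _ => hGp.lipschitzOnWith) (fun s => ⟨hu s, trivial⟩)
      (fun s => ⟨by
        have : p e = e := by simp [p]
        simp only [this, hGe]
        exact hasDerivAt_const s e, trivial⟩) ht
    rw [this] at hu0
    exact he.ne hu0
  have hgt : ∀ t, e < u t := by
    intro t
    by_contra h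
    have h1 : e ∈ uIcc (u t) (u 0) := by
      rw [hu0, mem_uIcc]; exact Or.inl ⟨not_lt.1 h, he.le⟩
    obtain ⟨s, -, hs⟩ := intermediate_value_uIcc hcont.continuousOn h1
    exact hne s hs
  have hmem : ∀ t, 0 ≤ t → u t ∈ Icc e e₀ := fun t ht => ⟨(hgt t).le, hu0 ▸ hanti ht⟩
  have hpu : ∀ t, 0 ≤ t → p (u t) = u t := fun t ht => by
    simp [p, projIcc_of_mem he.le (hmem t ht)]
  refine ⟨u, hu0, fun t ht => ⟨by simpa [hpu t ht] using hu t, hgt t, (hmem t ht).2⟩, ?_⟩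
  have hbdd : BddBelow (range u) := ⟨e, by rintro _ ⟨t, rfl⟩; exact (hgt t).le⟩
  have hlim := tendsto_atTop_ciInf hanti hbdd
  set l := ⨅ t, u t with hl
  have hle : e ≤ l := le_ciInf fun t => (hgt t).le
  rcases hle.eq_or_lt with h | h
  · rwa [← h] at hlim
  · -- otherwise the velocity would be bounded away from zero
    exfalso
    have hlu : ∀ t, l ≤ u t := fun t => ciInf_le hbdd t
    have hl0 : l ≤ e₀ := hu0 ▸ hlu 0
    obtain ⟨x, hx, hmax⟩ := isCompact_Icc.exists_isMaxOn (nonempty_Icc.2 hl0)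
      (hG.continuous.continuousOn (s := Icc l e₀))
    have hGx : G x < 0 := hneg x ⟨h.trans_le hx.1, hx.2⟩
    have hdec : ∀ t, 0 ≤ t → u t - u 0 ≤ G x * (t - 0) := by
      intro t ht
      refine (convex_Ici (0 : ℝ)).image_sub_le_mul_sub_of_deriv_le hcont.continuousOn
        (fun s _ => (hu s).differentiableAt.differentiableWithinAt) ?_ 0 self_mem_Ici t ht ht
      intro s hs
      rw [interior_Ici, mem_Ioi] at hs
      rw [(hu s).deriv, hpu s hs.le]
      exact hmax ⟨hlu s, (hmem s hs.le).2⟩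
    have h2 := hdec ((e₀ - l + 1) / (-G x)) (div_nonneg (by linarith) (by linarith))
    have h3 : G x * ((e₀ - l + 1) / (-G x) - 0) = -(e₀ - l + 1) := by
      rw [sub_zero, div_neg, mul_neg, mul_div_cancel₀ _ hGx.ne]
    rw [h3, hu0] at h2
    linarith [hlu ((e₀ - l + 1) / (-G x))]

/-- If an equilibrium `e` of a field on the line attracts all points up to `e₀`, then the solution
that starts at `e₀` exists for all positive times and tends to `e`. -/
theorem exists_scalar_solution_tendsto {G : ℝ → ℝ} (hG : ContDiff ℝ 1 G) {e e₀ : ℝ}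
    (hGe : G e = 0) (hneg : ∀ x ∈ uIcc e e₀, x ≠ e → (x - e) * G x < 0) :
    ∃ u : ℝ → ℝ, u 0 = e₀ ∧
      (∀ t, 0 ≤ t → HasDerivAt u (G (u t)) t ∧ u t ∈ uIcc e e₀ ∧ (e ≠ e₀ → u t ≠ e)) ∧
      Tendsto u atTop (𝓝 e) := by
  rcases lt_trichotomy e e₀ with h | rfl | h
  · rw [uIcc_of_le h.le] at hneg ⊢
    obtain ⟨u, hu0, hu, hlim⟩ := exists_scalar_solution_tendsto_of_lt hG h hGe fun x hx =>
      neg_of_mul_neg_right (hneg x (Ioc_subset_Icc_self hx) hx.1.ne') (sub_pos.2 hx.1).le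
    exact ⟨u, hu0, fun t ht => ⟨(hu t ht).1, Ioc_subset_Icc_self (hu t ht).2,
      fun _ => (hu t ht).2.1.ne'⟩, hlim⟩
  · refine ⟨fun _ => e, rfl, fun t _ => ⟨?_, left_mem_uIcc, fun h => absurd rfl h⟩,
      tendsto_const_nhds⟩
    simp only [hGe]
    exact hasDerivAt_const t e
  · rw [uIcc_of_ge h.le] at hneg ⊢
    obtain ⟨u, hu0, hu, hlim⟩ := exists_scalar_solution_tendsto_of_lt (G := fun x => -G (-x))
      (hG.comp contDiff_neg).neg (neg_lt_neg h) (by simp [hGe]) (fun x hx => by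
        have h1 := hneg (-x) ⟨by linarith [hx.2], by linarith [hx.1]⟩ (by linarith [hx.1])
        have h2 := pos_of_mul_neg_right h1 (by linarith [hx.1])
        linarith)
    refine ⟨fun t => -u t, by simp [hu0], fun t ht => ⟨?_, ?_, fun _ => ?_⟩, by simpa using hlim.neg⟩
    · have h1 := (hu t ht).1.neg
      rw [neg_neg] at h1
      exact h1
    · have := (hu t ht).2
      exact ⟨by linarith [this.2], by linarith [this.1]⟩
    · have := (hu t ht).2.1
      exact fun h => by linarith

end ODE


/-! ### Solutions of the vector field on the leaves -/

section Solutions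

variable {n : ℕ} {ω a₁ : Fin n → ℝ} {a₂ : Sym2 (Fin n) → ℝ} {ν : ℝ}

/-- The squares of the radii. -/
def normSqVec (z : Fin n → ℂ) : Fin n → ℝ := fun i => ‖z i‖ ^ 2

/-- The quartic part of the radial rate, as a function of the squares of the radii. -/
def quartForm (a₂ : Sym2 (Fin n) → ℝ) (X : Fin n → ℝ) : ℝ :=
  ∑ j, ∑ l ∈ Finset.Ici j, a₂ s(j, l) * (X j * X l)

theorem quartForm_smul (y : ℝ) (X : Fin n → ℝ) : quartForm a₂ (y • X) = quartForm a₂ X * y ^ 2 := by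
  simp only [quartForm, Finset.sum_mul, Pi.smul_apply, smul_eq_mul]
  exact Finset.sum_congr rfl fun j _ => Finset.sum_congr rfl fun l _ => by ring

theorem continuous_quartForm : Continuous (quartForm a₂) := by
  unfold quartForm; fun_prop

theorem continuous_normSqVec : Continuous (normSqVec (n := n)) := by
  unfold normSqVec; fun_prop

theorem radialRate_eq (z : Fin n → ℂ) :
    radialRate a₁ a₂ ν z = ν + linForm a₁ (normSqVec z) + quartForm a₂ (normSqVec z) := by
  rw [linForm_apply]; rfl

theorem radialRate_of_normSqVec {z w : Fin n → ℂ} {y : ℝ} (h : normSqVec w = y • normSqVec z) :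
    radialRate a₁ a₂ ν w =
      ν + linForm a₁ (normSqVec z) * y + quartForm a₂ (normSqVec z) * y ^ 2 := by
  rw [radialRate_eq, h, quartForm_smul, map_smul, smul_eq_mul, mul_comm y]

theorem continuous_radialRate : Continuous (radialRate a₁ a₂ ν) := by
  unfold radialRate; fun_prop

/-- The point of the trajectory through `z` at time `t` whose radii have been multiplied by `E`. -/
def rotScale (ω : Fin n → ℝ) (z : Fin n → ℂ) (E t : ℝ) : Fin n → ℂ :=
  fun i => (E : ℂ) * (Complex.exp ((ω i * t : ℝ) * Complex.I) * z i)

theorem norm_rotScale {z : Fin n → ℂ} {E t : ℝ} (hE : 0 ≤ E) (i : Fin n) :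
    ‖rotScale ω z E t i‖ = E * ‖z i‖ := by
  rw [rotScale, norm_mul, norm_mul, Complex.norm_exp_ofReal_mul_I, one_mul, Complex.norm_real,
    Real.norm_of_nonneg hE]

theorem normSqVec_rotScale {z : Fin n → ℂ} {E t : ℝ} (hE : 0 ≤ E) :
    normSqVec (rotScale ω z E t) = E ^ 2 • normSqVec z := by
  funext i
  simp [normSqVec, norm_rotScale hE, mul_pow]

/-- The equation of the growth factor `E` of the radii along a solution that starts at `z`. -/
def IsGrowth (a₁ : Fin n → ℝ) (a₂ : Sym2 (Fin n) → ℝ) (ν : ℝ) (z : Fin n → ℂ) (E : ℝ → ℝ)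
    (J : Set ℝ) : Prop :=
  E 0 = 1 ∧ ∀ t ∈ J, 0 < E t ∧ HasDerivWithinAt E
    (E t * (ν + linForm a₁ (normSqVec z) * E t ^ 2 + quartForm a₂ (normSqVec z) * (E t ^ 2) ^ 2)) J t

theorem IsGrowth.isSol {z : Fin n → ℂ} {E : ℝ → ℝ} {J : Set ℝ} (h : IsGrowth a₁ a₂ ν z E J) :
    IsSol (vectorField ω a₁ a₂ ν) (fun t => rotScale ω z (E t) t) J := by
  intro t ht
  rw [hasDerivWithinAt_pi]
  intro i
  obtain ⟨hpos, hE⟩ := h.2 t ht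
  rw [← radialRate_of_normSqVec (normSqVec_rotScale (ω := ω) (t := t) hpos.le)] at hE
  have h1 : HasDerivAt (fun t : ℝ => Complex.exp ((ω i * t : ℝ) * Complex.I))
      (Complex.exp ((ω i * t : ℝ) * Complex.I) * ((ω i : ℂ) * Complex.I)) t := by
    have h2 : HasDerivAt (fun t : ℝ => ((ω i * t : ℝ) : ℂ) * Complex.I) ((ω i : ℂ) * Complex.I) t := by
      have h3 : HasDerivAt (fun t : ℝ => ω i * t) (ω i) t := by
        simpa using (hasDerivAt_id t).const_mul (ω i)
      exact h3.ofReal_comp.mul_const _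
    exact h2.cexp
  have h4 := hE.ofReal_comp.mul ((h1.mul_const (z i)).hasDerivWithinAt (s := J))
  refine h4.congr_deriv ?_
  simp only [vectorField, rotScale]
  push_cast
  ring

theorem rotScale_zero {z : Fin n → ℂ} : rotScale ω z 1 0 = z := by
  funext i; simp [rotScale]

/-- Along a solution all radii are multiplied by the same factor, and the arguments rotate
uniformly. -/
theorem IsSol.exists_growth {u : ℝ → Fin n → ℂ} {J : Set ℝ} (hJ : J.OrdConnected)
    (h0 : (0 : ℝ) ∈ J) (hu : IsSol (vectorField ω a₁ a₂ ν) u J) :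
    ∃ E : ℝ → ℝ, IsGrowth a₁ a₂ ν (u 0) E J ∧ ∀ t ∈ J, u t = rotScale ω (u 0) (E t) t := by
  have hcont : ContinuousOn u J := fun t ht => (hu t ht).continuousWithinAt
  have hrate : ContinuousOn (fun t => radialRate a₁ a₂ ν (u t)) J :=
    continuous_radialRate.comp_continuousOn hcont
  let f : Fin n → ℝ → ℂ := fun i t => Complex.exp (-((ω i * t : ℝ) * Complex.I)) * u t i
  have hf : ∀ i, ∀ t ∈ J, HasDerivWithinAt (f i) (radialRate a₁ a₂ ν (u t) • f i t) J t := by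
    intro i t ht
    have h2 : HasDerivAt (fun t : ℝ => ((ω i * t : ℝ) : ℂ) * Complex.I) ((ω i : ℂ) * Complex.I) t := by
      have h3 : HasDerivAt (fun t : ℝ => ω i * t) (ω i) t := by
        simpa using (hasDerivAt_id t).const_mul (ω i)
      exact h3.ofReal_comp.mul_const _
    have h4 := (h2.neg.cexp.hasDerivWithinAt (s := J)).mul (hasDerivWithinAt_pi.1 (hu t ht) i)
    refine h4.congr_deriv ?_
    simp only [vectorField, f, Complex.real_smul, Pi.neg_apply]
    ring
  let g : ℝ → ℝ := fun t => Real.exp (∫ s in (0 : ℝ)..t, radialRate a₁ a₂ ν (u s))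
  have hfg : ∀ i, ∀ t ∈ J, f i t = g t • u 0 i := by
    intro i t ht
    have := linear_ode_eq hJ h0 hrate (hf i) ht
    rw [this]
    simp [f, g]
  have hug : ∀ t ∈ J, u t = rotScale ω (u 0) (g t) t := by
    intro t ht
    funext i
    have := hfg i t ht
    rw [rotScale]
    have h1 : u t i = Complex.exp ((ω i * t : ℝ) * Complex.I) * f i t := by
      simp only [f]
      rw [← mul_assoc, ← Complex.exp_add, add_neg_cancel, Complex.exp_zero, one_mul]
    rw [h1, this, Complex.real_smul]
    ring
  by_cases hz : u 0 = 0
  · -- the factor is not determined by the trivial solution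
    refine ⟨fun t => Real.exp (ν * t), ⟨by simp, fun t ht => ⟨Real.exp_pos _, ?_⟩⟩, fun t ht => ?_⟩
    · have h1 : HasDerivAt (fun t : ℝ => Real.exp (ν * t)) (Real.exp (ν * t) * ν) t := by
        have h3 : HasDerivAt (fun t : ℝ => ν * t) ν t := by
          simpa using (hasDerivAt_id t).const_mul ν
        exact h3.exp
      refine (h1.hasDerivWithinAt (s := J)).congr_deriv ?_
      have h2 : normSqVec (u 0) = (0 : ℝ) • normSqVec (u 0) := by
        funext i; simp [normSqVec, hz]
      have h3 : linForm a₁ (normSqVec (u 0)) = 0 := by rw [h2, map_smul, zero_smul]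
      have h4 : quartForm a₂ (normSqVec (u 0)) = 0 := by rw [h2, quartForm_smul]; simp
      rw [h3, h4]
      ring
    · rw [hug t ht, hz]
      funext i
      simp [rotScale]
  · obtain ⟨i, hi⟩ := Function.ne_iff.1 hz
    rw [Pi.zero_apply] at hi
    refine ⟨g, ⟨by simp [g], fun t ht => ⟨Real.exp_pos _, ?_⟩⟩, hug⟩
    rw [← radialRate_of_normSqVec (normSqVec_rotScale (ω := ω) (t := t) (Real.exp_pos _).le),
      ← hug t ht]
    have h1 : ∀ s ∈ J, g s = Complex.reCLM (f i s / u 0 i) := by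
      intro s hs
      rw [hfg i s hs, Complex.real_smul, mul_div_cancel_right₀ _ hi]
      simp
    have h2 : HasDerivWithinAt (fun s => Complex.reCLM (f i s / u 0 i))
        (Complex.reCLM (radialRate a₁ a₂ ν (u t) • f i t / u 0 i)) J t :=
      Complex.reCLM.hasFDerivAt.comp_hasDerivWithinAt t ((hf i t ht).div_const _)
    refine (h2.congr h1 (h1 t ht)).congr_deriv ?_
    rw [smul_div_assoc, map_smul, ← h1 t ht, smul_eq_mul, mul_comm]

theorem IsGrowth.continuousOn {z : Fin n → ℂ} {E : ℝ → ℝ} {J : Set ℝ}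
    (h : IsGrowth a₁ a₂ ν z E J) : ContinuousOn E J :=
  fun t ht => (h.2 t ht).2.continuousWithinAt

/-- The difference of the growth factor from an equilibrium value solves a linear equation. -/
theorem IsGrowth.sub_eq {z : Fin n → ℂ} {E : ℝ → ℝ} {J : Set ℝ} (h : IsGrowth a₁ a₂ ν z E J)
    (hJ : J.OrdConnected) (h0 : (0 : ℝ) ∈ J) {e : ℝ}
    (he : ν + linForm a₁ (normSqVec z) * e ^ 2 + quartForm a₂ (normSqVec z) * (e ^ 2) ^ 2 = 0)
    {t : ℝ} (ht : t ∈ J) :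
    E t - e = Real.exp (∫ s in (0 : ℝ)..t, E s * (E s + e) * (linForm a₁ (normSqVec z) +
      quartForm a₂ (normSqVec z) * (E s ^ 2 + e ^ 2))) * (1 - e) := by
  have hE := h.continuousOn
  have := linear_ode_eq (f := fun t => E t - e) hJ h0 (c := fun s => E s * (E s + e) *
    (linForm a₁ (normSqVec z) + quartForm a₂ (normSqVec z) * (E s ^ 2 + e ^ 2)))
    (by fun_prop) (fun t ht => by
      refine ((h.2 t ht).2.sub_const e).congr_deriv ?_
      rw [smul_eq_mul]
      linear_combination E t * he) ht
  rw [this, smul_eq_mul, h.1]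

/-- Points at which the radial rate vanishes move on Clifford tori. -/
theorem IsSol.norm_eq {u : ℝ → Fin n → ℂ} {J : Set ℝ} (hJ : J.OrdConnected)
    (h0 : (0 : ℝ) ∈ J) (hu : IsSol (vectorField ω a₁ a₂ ν) u J)
    (hrate : radialRate a₁ a₂ ν (u 0) = 0) {t : ℝ} (ht : t ∈ J) (i : Fin n) :
    ‖u t i‖ = ‖u 0 i‖ := by
  obtain ⟨E, hE, hEu⟩ := hu.exists_growth hJ h0
  rw [radialRate_eq] at hrate
  have := hE.sub_eq hJ h0 (e := 1) (by simpa using hrate) ht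
  rw [sub_self, mul_zero, sub_eq_zero] at this
  rw [hEu t ht, this, norm_rotScale zero_le_one, one_mul]

/-- At a point of an invariant set at which the radii are extremal the radial rate vanishes. -/
theorem radialRate_eq_zero_of_flowInvariant {H : Set (Fin n → ℂ)}
    (hH : FlowInvariant (vectorField ω a₁ a₂ ν) H) {z : Fin n → ℂ} (hz : z ∈ H) (hz0 : z ≠ 0)
    (hmax : ∀ w ∈ H, ∑ i, ‖w i‖ ^ 2 ≤ ∑ i, ‖z i‖ ^ 2) : radialRate a₁ a₂ ν z = 0 := by
  set q := linForm a₁ (normSqVec z) with hq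
  set Q := quartForm a₂ (normSqVec z) with hQ
  have hG : ContDiff ℝ 1 fun x : ℝ => x * (ν + q * x ^ 2 + Q * (x ^ 2) ^ 2) := by fun_prop
  obtain ⟨E, hE0, ε, hε, hE⟩ :=
    (hG.contDiffAt (x := 1)).exists_forall_mem_closedBall_exists_eq_forall_mem_Ioo_hasDerivAt₀ 0
  have h00 : (0 : ℝ) ∈ Ioo (0 - ε) (0 + ε) := ⟨by linarith, by linarith⟩
  have hEc : ContinuousAt E 0 := (hE 0 h00).continuousAt
  have hpos : ∀ᶠ t in 𝓝 (0 : ℝ), 0 < E t := hEc.eventually (lt_mem_nhds (by simp [hE0]))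
  obtain ⟨η, hη, hEη⟩ := Metric.eventually_nhds_iff_ball.1
    (hpos.and (Ioo_mem_nhds h00.1 h00.2))
  have hgrowth : IsGrowth a₁ a₂ ν z E (Metric.ball 0 η) :=
    ⟨hE0, fun t ht => ⟨(hEη t ht).1, (hE t (hEη t ht).2).hasDerivWithinAt⟩⟩
  have hN : 0 < ∑ i, ‖z i‖ ^ 2 := by
    obtain ⟨i, hi⟩ := Function.ne_iff.1 hz0
    exact Finset.sum_pos' (fun _ _ => sq_nonneg _)
      ⟨i, Finset.mem_univ i, pow_pos (norm_pos_iff.2 hi) 2⟩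
  -- the sum of the squares of the radii is maximal at time `0`, and so is the growth factor
  have hle : ∀ t ∈ Metric.ball (0 : ℝ) η, E t ≤ 1 := by
    intro t ht
    have hmem : rotScale ω z (E t) t ∈ H :=
      hH (Metric.ball 0 η) (fun t => rotScale ω z (E t) t)
        (by rw [Real.ball_eq_Ioo]; exact ordConnected_Ioo) (Metric.mem_ball_self hη) hgrowth.isSol
        (by simpa [hE0, rotScale_zero] using hz) t ht
    have h1 := hmax _ hmem
    simp only [norm_rotScale (hEη t ht).1.le, mul_pow, ← Finset.mul_sum] at h1
    have h2 : E t ^ 2 ≤ 1 := by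
      by_contra h
      nlinarith [mul_pos (sub_pos.2 (not_le.1 h)) hN]
    nlinarith [(hEη t ht).1]
  have hloc : IsLocalMax E 0 := by
    filter_upwards [Metric.ball_mem_nhds (0 : ℝ) hη] with t ht
    rw [hE0]; exact hle t ht
  have := hloc.hasDerivAt_eq_zero (hE 0 h00)
  rw [hE0] at this
  rw [radialRate_eq, ← hq, ← hQ]
  linarith

/-- While the radial rate is negative at the initial point the radii do not grow. -/
theorem IsSol.norm_le {u : ℝ → Fin n → ℂ} {b : ℝ} (hb : 0 ≤ b)
    (hu : IsSol (vectorField ω a₁ a₂ ν) u (Icc 0 b)) (hrate : radialRate a₁ a₂ ν (u 0) < 0)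
    {t : ℝ} (ht : t ∈ Icc 0 b) (i : Fin n) : ‖u t i‖ ≤ ‖u 0 i‖ := by
  obtain ⟨E, hE, hEu⟩ := hu.exists_growth ordConnected_Icc ⟨le_rfl, hb⟩
  have h1 : E t ≤ 1 := by
    refine image_le_of_deriv_right_lt_deriv_boundary (B := fun _ => 1) (B' := fun _ => 0)
      (f' := fun s => E s * (ν + linForm a₁ (normSqVec (u 0)) * E s ^ 2 +
        quartForm a₂ (normSqVec (u 0)) * (E s ^ 2) ^ 2))
      hE.continuousOn (fun s hs => ?_) hE.1.le (fun s => hasDerivAt_const s 1) ?_ ht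
    · exact (hE.2 s (Ico_subset_Icc_self hs)).2.mono_of_mem_nhdsWithin (Icc_mem_nhdsGE_of_mem hs)
    · intro s _ hs
      rw [hs, one_mul]
      rw [radialRate_eq] at hrate
      linarith
  rw [hEu t ht, norm_rotScale (hE.2 t ht).1.le]
  exact mul_le_of_le_one_left (norm_nonneg _) h1

end Solutions

/-! ### The equilibrium on a leaf -/

section Scale

/-- The positive root `y` of `ν + q y + Q y² = 0`, for `ν Q < 0`. In this form of the quadratic
formula the denominator is positive for both signs of `ν`. -/
def eqScale (ν q Q : ℝ) : ℝ := 2 * ν ^ 2 / (|ν| * √(q ^ 2 - 4 * ν * Q) - ν * q)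

variable {ν q Q : ℝ}

theorem eqScale_den_pos (h : ν * Q < 0) : 0 < |ν| * √(q ^ 2 - 4 * ν * Q) - ν * q := by
  have hν : 0 < |ν| := abs_pos.2 fun h0 => by simp [h0] at h
  have h1 : |q| < √(q ^ 2 - 4 * ν * Q) := by
    rw [← Real.sqrt_sq_eq_abs]
    exact Real.sqrt_lt_sqrt (sq_nonneg _) (by linarith)
  have h2 : ν * q ≤ |ν| * |q| := by rw [← abs_mul]; exact le_abs_self _
  nlinarith

theorem eqScale_pos (h : ν * Q < 0) : 0 < eqScale ν q Q := by
  have hν : ν ≠ 0 := fun h0 => by simp [h0] at h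
  exact div_pos (by positivity) (eqScale_den_pos h)

theorem eqScale_root (h : ν * Q < 0) :
    ν + q * eqScale ν q Q + Q * eqScale ν q Q ^ 2 = 0 := by
  have hD := eqScale_den_pos (q := q) h
  have hS : √(q ^ 2 - 4 * ν * Q) ^ 2 = q ^ 2 - 4 * ν * Q :=
    Real.sq_sqrt (by nlinarith [sq_nonneg q])
  have ha : |ν| ^ 2 = ν ^ 2 := sq_abs ν
  rw [eqScale]
  set S := √(q ^ 2 - 4 * ν * Q)
  set a := |ν|
  have hD' := hD.ne'
  field_simp
  linear_combination (ν * S ^ 2) * ha + ν ^ 3 * hS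

theorem eqScale_add (h : ν * Q < 0) :
    q + Q * eqScale ν q Q = -(ν / eqScale ν q Q) := by
  have h1 := eqScale_root (q := q) h
  have h2 := (eqScale_pos (q := q) h).ne'
  field_simp
  linarith

theorem eqScale_unique (h : ν * Q < 0) {y : ℝ} (hy : 0 < y) (hroot : ν + q * y + Q * y ^ 2 = 0) :
    y = eqScale ν q Q := by
  have h1 := eqScale_root (q := q) h
  have h2 := eqScale_pos (q := q) h
  set T := eqScale ν q Q
  have h3 : (y - T) * (Q * (y * T) - ν) = 0 := by linear_combination T * hroot - y * h1
  have h4 : Q * (y * T) - ν ≠ 0 := by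
    intro h0
    have : ν * Q * (y * T) - ν ^ 2 = 0 := by linear_combination ν * h0
    nlinarith [mul_neg_of_neg_of_pos h (mul_pos hy h2), sq_nonneg ν]
  linarith [(mul_eq_zero.1 h3).resolve_right h4]

end Scale


/-! ### The invariant hypertori -/

section Hypertori

variable {n : ℕ} {ω a₁ : Fin n → ℝ} {a₂ : Sym2 (Fin n) → ℝ} {ν b : ℝ} {P : Finset (Fin n)}
  {z w : Fin n → ℂ} {C : Fin n → ℝ}

/-- The points whose coordinates outside of `P` vanish. -/
def supportedIn (P : Finset (Fin n)) : Set (Fin n → ℂ) := {z | ∀ i ∉ P, z i = 0}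

/-- The factor by which the radii of `z` have to be multiplied to reach the equilibrium in the leaf
of `z`. -/
def eqGrowth (a₁ : Fin n → ℝ) (a₂ : Sym2 (Fin n) → ℝ) (ν : ℝ) (z : Fin n → ℂ) : ℝ :=
  √(eqScale ν (linForm a₁ (normSqVec z)) (quartForm a₂ (normSqVec z)))

/-- The Euclidean norm of the radius vector of the equilibrium in the leaf with parameter `C`. -/
def torusScale (a₁ : Fin n → ℝ) (a₂ : Sym2 (Fin n) → ℝ) (ν : ℝ) (C : Fin n → ℝ) : ℝ :=
  √(eqScale ν (linForm a₁ (sqVec C)) (quartForm a₂ (sqVec C)))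

theorem linForm_mul (b : ℝ) (a₁ X : Fin n → ℝ) :
    linForm (fun i => b * a₁ i) X = b * linForm a₁ X := by
  simp only [linForm_apply, Finset.mul_sum, mul_assoc]

theorem mul_quartForm_pos (hP : ∀ i ∈ P, ∀ j ∈ P, 0 < b * a₂ s(i, j)) {X : Fin n → ℝ}
    (h0 : ∀ i, 0 ≤ X i) (hs : ∀ i ∉ P, X i = 0) (hne : ∃ i, X i ≠ 0) :
    0 < b * quartForm a₂ X := by
  obtain ⟨i, hi⟩ := hne
  have hterm : ∀ j l, 0 ≤ b * (a₂ s(j, l) * (X j * X l)) := by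
    intro j l
    by_cases hj : j ∈ P
    · by_cases hl : l ∈ P
      · rw [← mul_assoc]
        exact mul_nonneg (hP j hj l hl).le (mul_nonneg (h0 j) (h0 l))
      · simp [hs l hl]
    · simp [hs j hj]
  simp only [quartForm, Finset.mul_sum]
  have hiP : i ∈ P := by
    by_contra h
    exact hi (hs i h)
  refine Finset.sum_pos' (fun j _ => Finset.sum_nonneg fun l _ => hterm j l)
    ⟨i, Finset.mem_univ i, Finset.sum_pos' (fun l _ => hterm i l) ⟨i, by simp, ?_⟩⟩
  rw [← mul_assoc]
  have := (h0 i).lt_of_ne' hi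
  exact mul_pos (hP i hiP i hiP) (mul_pos this this)

theorem mul_neg_of_signs (hν : ν * b < 0) {Q : ℝ} (hQ : 0 < b * Q) : ν * Q < 0 := by
  have hb : b ≠ 0 := fun h => by simp [h] at hν
  have h1 : ν * b * (b * Q) < 0 := mul_neg_of_neg_of_pos hν hQ
  have h2 : 0 < b ^ 2 := by positivity
  by_contra h
  nlinarith [mul_nonneg h2.le (not_lt.1 h)]

theorem mul_quartForm_normSqVec_pos (hP : ∀ i ∈ P, ∀ j ∈ P, 0 < b * a₂ s(i, j))
    (hz : z ∈ supportedIn P) (hz0 : z ≠ 0) : 0 < b * quartForm a₂ (normSqVec z) := by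
  obtain ⟨i, hi⟩ := Function.ne_iff.1 hz0
  refine mul_quartForm_pos hP (fun i => sq_nonneg _) (fun i hi => by simp [normSqVec, hz i hi])
    ⟨i, ?_⟩
  have : 0 < ‖z i‖ ^ 2 := pow_pos (norm_pos_iff.2 hi) 2
  exact this.ne'

theorem exists_ne_zero_of_mem_roundRegion {α : Fin n → ℝ} (hC : C ∈ roundRegion α P) :
    ∃ i, C i ≠ 0 := by
  by_contra! h
  have := sum_sq_eq_one hC
  simp [h] at this

theorem mul_quartForm_sqVec_pos {α : Fin n → ℝ} (hP : ∀ i ∈ P, ∀ j ∈ P, 0 < b * a₂ s(i, j))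
    (hC : C ∈ roundRegion α P) : 0 < b * quartForm a₂ (sqVec C) := by
  obtain ⟨i, hi⟩ := exists_ne_zero_of_mem_roundRegion hC
  exact mul_quartForm_pos hP (fun i => sq_nonneg _) (fun i hi => by simp [sqVec, hC.2.2.1 i hi])
    ⟨i, by simpa [sqVec] using hi⟩

theorem normSqVec_of_norm_eq {r : ℝ} (h : ∀ i, ‖z i‖ = r * C i) :
    normSqVec z = r ^ 2 • sqVec C := by
  funext i
  simp [normSqVec, sqVec, h i, mul_pow]

theorem radialRate_of_norm_eq {r : ℝ} (h : ∀ i, ‖z i‖ = r * C i) :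
    radialRate a₁ a₂ ν z =
      ν + linForm a₁ (sqVec C) * r ^ 2 + quartForm a₂ (sqVec C) * (r ^ 2) ^ 2 := by
  rw [radialRate_eq, normSqVec_of_norm_eq h, quartForm_smul, map_smul, smul_eq_mul,
    mul_comm (r ^ 2)]

theorem torusScale_pos {α : Fin n → ℝ} (hP : ∀ i ∈ P, ∀ j ∈ P, 0 < b * a₂ s(i, j))
    (hν : ν * b < 0) (hC : C ∈ roundRegion α P) : 0 < torusScale a₁ a₂ ν C :=
  Real.sqrt_pos.2 (eqScale_pos (mul_neg_of_signs hν (mul_quartForm_sqVec_pos hP hC)))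

/-- The radial rate vanishes in the leaf of `C` exactly at the radius `torusScale a₁ a₂ ν C`. -/
theorem radialRate_eq_zero_iff {α : Fin n → ℝ} (hP : ∀ i ∈ P, ∀ j ∈ P, 0 < b * a₂ s(i, j))
    (hν : ν * b < 0) (hC : C ∈ roundRegion α P) {r : ℝ} (hr : 0 < r) (h : ∀ i, ‖z i‖ = r * C i) :
    radialRate a₁ a₂ ν z = 0 ↔ r = torusScale a₁ a₂ ν C := by
  have hνQ := mul_neg_of_signs hν (mul_quartForm_sqVec_pos hP hC)
  rw [radialRate_of_norm_eq h, torusScale]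
  constructor
  · intro h0
    rw [← eqScale_unique hνQ (pow_pos hr 2) h0, Real.sqrt_sq hr.le]
  · rintro rfl
    rw [Real.sq_sqrt (eqScale_pos hνQ).le]
    exact eqScale_root hνQ

theorem ne_zero_of_mem_leaf {α : Fin n → ℝ} (hC : C ∈ roundRegion α P) (hz : z ∈ leaf C) :
    z ≠ 0 := by
  rintro rfl
  obtain ⟨r, hr, h⟩ := hz
  obtain ⟨i, hi⟩ := exists_ne_zero_of_mem_roundRegion hC
  have := h i
  rw [Pi.zero_apply, norm_zero, eq_comm, mul_eq_zero] at this
  exact this.elim hr.ne' hi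

theorem supportedIn_of_mem_leaf {α : Fin n → ℝ} (hC : C ∈ roundRegion α P) (hz : z ∈ leaf C) :
    z ∈ supportedIn P := by
  obtain ⟨r, hr, h⟩ := hz
  intro i hi
  rw [← norm_eq_zero, h i, hC.2.2.1 i hi, mul_zero]

theorem mul_linForm_nonneg_of_mem_leaf (hC : C ∈ roundRegion (fun i => b * a₁ i) P)
    (hz : z ∈ leaf C) : 0 ≤ b * linForm a₁ (normSqVec z) := by
  obtain ⟨r, hr, h⟩ := hz
  have h1 := hC.2.2.2
  rw [linForm_mul] at h1
  rw [normSqVec_of_norm_eq h, map_smul, smul_eq_mul, mul_left_comm]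
  exact mul_nonneg (sq_nonneg r) h1

/-- On the leaves over the region the radial rate vanishes only if `ν * b < 0`. -/
theorem mul_neg_of_radialRate_eq_zero (hP : ∀ i ∈ P, ∀ j ∈ P, 0 < b * a₂ s(i, j))
    (hC : C ∈ roundRegion (fun i => b * a₁ i) P) (hz : z ∈ leaf C)
    (h : radialRate a₁ a₂ ν z = 0) : ν * b < 0 := by
  have h1 := mul_linForm_nonneg_of_mem_leaf hC hz
  have h2 := mul_quartForm_normSqVec_pos hP (supportedIn_of_mem_leaf hC hz)
    (ne_zero_of_mem_leaf hC hz)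
  rw [radialRate_eq] at h
  have : b * (ν + linForm a₁ (normSqVec z) + quartForm a₂ (normSqVec z)) = 0 := by
    rw [h, mul_zero]
  linarith

theorem flowInvariant_of_radialRate_eq_zero {T : Set (Fin n → ℂ)}
    (h0 : ∀ z ∈ T, radialRate a₁ a₂ ν z = 0)
    (hT : ∀ z ∈ T, ∀ w : Fin n → ℂ, (∀ i, ‖w i‖ = ‖z i‖) → w ∈ T) :
    FlowInvariant (vectorField ω a₁ a₂ ν) T :=
  fun _ _ hJ h0J hu hu0 _ ht => hT _ hu0 _ fun i => hu.norm_eq hJ h0J (h0 _ hu0) ht i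

/-- The only invariant hypertorus in the leaf of `C` is the torus on which the radial rate
vanishes. -/
theorem isInvariantHypertorus_iff (hP : ∀ i ∈ P, ∀ j ∈ P, 0 < b * a₂ s(i, j))
    (hC : C ∈ roundRegion (fun i => b * a₁ i) P) {H : Set (Fin n → ℂ)} :
    IsInvariantHypertorus (vectorField ω a₁ a₂ ν) C H ↔
      ν * b < 0 ∧ H = cliffordTorus fun i => torusScale a₁ a₂ ν C * C i := by
  constructor
  · rintro ⟨⟨R, rfl⟩, ⟨z, hz⟩, hleaf, hinv⟩
    have hzl := hleaf hz
    have hrate : radialRate a₁ a₂ ν z = 0 :=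
      radialRate_eq_zero_of_flowInvariant hinv hz (ne_zero_of_mem_leaf hC hzl) fun w hw => by
        refine (Finset.sum_congr rfl fun i _ => ?_).le
        rw [hw i, hz i]
    have hν := mul_neg_of_radialRate_eq_zero hP hC hzl hrate
    obtain ⟨r, hr, h⟩ := hzl
    refine ⟨hν, ?_⟩
    rw [← (radialRate_eq_zero_iff hP hν hC hr h).1 hrate]
    congr 1
    funext i
    rw [← hz i, h i]
  · rintro ⟨hν, rfl⟩
    have hpos : 0 < torusScale a₁ a₂ ν C := torusScale_pos hP hν hC
    refine ⟨⟨_, rfl⟩, ⟨fun i => ((torusScale a₁ a₂ ν C * C i : ℝ) : ℂ), fun i => ?_⟩,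
      fun z hz => ⟨_, hpos, hz⟩, flowInvariant_of_radialRate_eq_zero (fun z hz => ?_) ?_⟩
    · rw [Complex.norm_real, Real.norm_of_nonneg (mul_nonneg hpos.le (hC.1 i))]
    · exact (radialRate_eq_zero_iff hP hν hC hpos hz).2 rfl
    · intro z hz w hw i
      rw [hw i, hz i]

theorem toralUnion_eq (hP : ∀ i ∈ P, ∀ j ∈ P, 0 < b * a₂ s(i, j)) (hν : ν * b < 0) :
    toralUnion (vectorField ω a₁ a₂ ν) (roundRegion (fun i => b * a₁ i) P) =
      toralSet (torusScale a₁ a₂ ν) (roundRegion (fun i => b * a₁ i) P) := by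
  ext z
  constructor
  · rintro ⟨C, hC, H, hH, hz⟩
    rw [isInvariantHypertorus_iff hP hC] at hH
    rw [hH.2] at hz
    exact ⟨C, hC, hz⟩
  · rintro ⟨C, hC, hz⟩
    exact ⟨C, hC, _, (isInvariantHypertorus_iff hP hC).2 ⟨hν, rfl⟩, hz⟩

theorem mem_leaf_of_mem_toralSet {α : Fin n → ℝ} (hP : ∀ i ∈ P, ∀ j ∈ P, 0 < b * a₂ s(i, j))
    (hν : ν * b < 0) (hz : z ∈ toralSet (torusScale a₁ a₂ ν) (roundRegion α P)) :
    ∃ C ∈ roundRegion α P, z ∈ leaf C ∧ radialRate a₁ a₂ ν z = 0 := by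
  obtain ⟨C, hC, h⟩ := hz
  have hpos : 0 < torusScale a₁ a₂ ν C := torusScale_pos hP hν hC
  exact ⟨C, hC, ⟨_, hpos, h⟩, (radialRate_eq_zero_iff hP hν hC hpos h).2 rfl⟩

theorem flowInvariant_toralSet {α : Fin n → ℝ} (hP : ∀ i ∈ P, ∀ j ∈ P, 0 < b * a₂ s(i, j))
    (hν : ν * b < 0) : FlowInvariant (vectorField ω a₁ a₂ ν)
      (toralSet (torusScale a₁ a₂ ν) (roundRegion α P)) := by
  refine flowInvariant_of_radialRate_eq_zero (fun z hz => ?_) ?_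
  · obtain ⟨C, -, -, h⟩ := mem_leaf_of_mem_toralSet hP hν hz
    exact h
  · rintro z ⟨C, hC, hz⟩ w hw
    exact ⟨C, hC, fun i => by rw [hw i, hz i]⟩

/-- The invariant hypertori shrink to the origin: the quadratic part of the radial rate has the sign of
`b` on them, so the quartic part is bounded by `|ν|`. -/
theorem eventually_toralSet_subset (hP : ∀ i ∈ P, ∀ j ∈ P, 0 < b * a₂ s(i, j))
    {U : Set (Fin n → ℂ)} (hU : U ∈ 𝓝 0) :
    ∀ᶠ ν in 𝓝 (0 : ℝ), ν * b < 0 →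
      toralSet (torusScale a₁ a₂ ν) (roundRegion (fun i => b * a₁ i) P) ⊆ U := by
  obtain ⟨ε, hε, hball⟩ := Metric.mem_nhds_iff.1 hU
  have hev : ∀ i ∈ P, ∀ᶠ ν in 𝓝 (0 : ℝ), -(b * ν) < b * a₂ s(i, i) * ε ^ 4 := by
    intro i hi
    have hc : ContinuousAt (fun ν : ℝ => -(b * ν)) 0 := by fun_prop
    have hpos : -(b * 0) < b * a₂ s(i, i) * ε ^ 4 := by
      have := hP i hi i hi
      rw [mul_zero, neg_zero]
      positivity
    exact hc.eventually (gt_mem_nhds hpos)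
  filter_upwards [(Finset.eventually_all P).2 hev] with ν hν hνb z hz
  obtain ⟨C, hC, hzl, hrate⟩ := mem_leaf_of_mem_toralSet hP hνb hz
  have hs := supportedIn_of_mem_leaf hC hzl
  apply hball
  rw [mem_ball_zero_iff, pi_norm_lt_iff hε]
  intro i
  by_cases hi : i ∈ P
  · have h1 := mul_linForm_nonneg_of_mem_leaf hC hzl
    -- the diagonal term bounds the quartic part from below
    have h2 : b * a₂ s(i, i) * ‖z i‖ ^ 4 ≤ b * quartForm a₂ (normSqVec z) := by
      have hterm : ∀ j l, 0 ≤ b * (a₂ s(j, l) * (‖z j‖ ^ 2 * ‖z l‖ ^ 2)) := by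
        intro j l
        by_cases hj : j ∈ P
        · by_cases hl : l ∈ P
          · have := hP j hj l hl
            rw [← mul_assoc]
            positivity
          · simp [hs l hl]
        · simp [hs j hj]
      simp only [quartForm, Finset.mul_sum, normSqVec]
      calc b * a₂ s(i, i) * ‖z i‖ ^ 4 = b * (a₂ s(i, i) * (‖z i‖ ^ 2 * ‖z i‖ ^ 2)) := by ring
        _ ≤ ∑ l ∈ Finset.Ici i, b * (a₂ s(i, l) * (‖z i‖ ^ 2 * ‖z l‖ ^ 2)) :=
          Finset.single_le_sum (f := fun l => b * (a₂ s(i, l) * (‖z i‖ ^ 2 * ‖z l‖ ^ 2)))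
            (fun l _ => hterm i l) (by simp)
        _ ≤ _ := Finset.single_le_sum
            (f := fun j => ∑ l ∈ Finset.Ici j, b * (a₂ s(j, l) * (‖z j‖ ^ 2 * ‖z l‖ ^ 2)))
            (fun j _ => Finset.sum_nonneg fun l _ => hterm j l) (Finset.mem_univ i)
    have h3 : b * ν + b * linForm a₁ (normSqVec z) + b * quartForm a₂ (normSqVec z) = 0 := by
      rw [← mul_add, ← mul_add, ← radialRate_eq, hrate, mul_zero]
    have h4 := hν i hi
    have h5 : ‖z i‖ ^ 4 < ε ^ 4 := by
      refine lt_of_mul_lt_mul_left ?_ (hP i hi i hi).le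
      linarith
    exact lt_of_pow_lt_pow_left₀ 4 hε.le h5
  · rw [hs i hi, norm_zero]
    exact hε

/-- The invariant hypertori leave every ball as `|ν|` grows, because on a ball the nonconstant part of the
radial rate is bounded. -/
theorem exists_forall_lt_norm {α : Fin n → ℝ} (hP : ∀ i ∈ P, ∀ j ∈ P, 0 < b * a₂ s(i, j)) (ρ : ℝ) :
    ∃ N : ℝ, ∀ ν : ℝ, N < |ν| → ν * b < 0 →
      ∀ z ∈ toralSet (torusScale a₁ a₂ ν) (roundRegion α P), ρ < ‖z‖ := by
  obtain ⟨N, hN⟩ := (isCompact_closedBall (0 : Fin n → ℂ) ρ).exists_bound_of_continuousOn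
    (f := radialRate a₁ a₂ 0) continuous_radialRate.continuousOn
  refine ⟨N, fun ν hν hνb z hz => ?_⟩
  by_contra h
  obtain ⟨-, -, -, hrate⟩ := mem_leaf_of_mem_toralSet hP hνb hz
  have h1 := hN z (by rw [mem_closedBall_zero_iff]; exact not_lt.1 h)
  have h2 : radialRate a₁ a₂ 0 z = -ν := by
    rw [radialRate_eq] at hrate ⊢
    linarith
  rw [h2, norm_neg, Real.norm_eq_abs] at h1
  linarith

/-- There is no compact invariant set over the region if `ν * b ≥ 0`, since it would contain a point of
maximal norm, at which the radial rate would vanish. -/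
theorem not_flowInvariant_of_isCompact (hP : ∀ i ∈ P, ∀ j ∈ P, 0 < b * a₂ s(i, j))
    (hν : 0 ≤ ν * b) {H : Set (Fin n → ℂ)}
    (hH : H ⊆ leafRegion (roundRegion (fun i => b * a₁ i) P)) (hc : IsCompact H)
    (hne : H.Nonempty) : ¬ FlowInvariant (vectorField ω a₁ a₂ ν) H := by
  intro hinv
  obtain ⟨z, hz, hmax⟩ := hc.exists_isMaxOn hne
    (f := fun w : Fin n → ℂ => ∑ i, ‖w i‖ ^ 2) (by fun_prop)
  have hzl := hH hz
  simp only [leafRegion, mem_iUnion, exists_prop] at hzl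
  obtain ⟨C, hC, hzl⟩ := hzl
  have hrate := radialRate_eq_zero_of_flowInvariant hinv hz (ne_zero_of_mem_leaf hC hzl)
    fun w hw => hmax hw
  exact absurd (mul_neg_of_radialRate_eq_zero hP hC hzl hrate) (not_lt.2 hν)

theorem continuousAt_eqScale {X : Type*} [TopologicalSpace X] {q Q : X → ℝ} {x : X}
    (hq : ContinuousAt q x) (hQ : ContinuousAt Q x) (h : ν * Q x < 0) :
    ContinuousAt (fun x => eqScale ν (q x) (Q x)) x := by
  refine ContinuousAt.div continuousAt_const ?_ (eqScale_den_pos h).ne'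
  refine ContinuousAt.sub (continuousAt_const.mul (ContinuousAt.sqrt ?_)) (continuousAt_const.mul hq)
  exact (hq.pow 2).sub (continuousAt_const.mul hQ)

theorem continuousOn_torusScale {α : Fin n → ℝ} (hP : ∀ i ∈ P, ∀ j ∈ P, 0 < b * a₂ s(i, j))
    (hν : ν * b < 0) : ContinuousOn (torusScale a₁ a₂ ν) (roundRegion α P) := fun _ hC =>
  ((continuousAt_eqScale ((continuous_linForm a₁).comp continuous_sqVec).continuousAt
    (continuous_quartForm.comp continuous_sqVec).continuousAt
    (mul_neg_of_signs hν (mul_quartForm_sqVec_pos hP hC))).sqrt).continuousWithinAt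

theorem continuousAt_eqGrowth (hP : ∀ i ∈ P, ∀ j ∈ P, 0 < b * a₂ s(i, j)) (hν : ν * b < 0)
    (hz : z ∈ supportedIn P) (hz0 : z ≠ 0) : ContinuousAt (eqGrowth a₁ a₂ ν) z :=
  (continuousAt_eqScale ((continuous_linForm a₁).comp continuous_normSqVec).continuousAt
    (continuous_quartForm.comp continuous_normSqVec).continuousAt
    (mul_neg_of_signs hν (mul_quartForm_normSqVec_pos hP hz hz0))).sqrt

theorem eqGrowth_pos (hP : ∀ i ∈ P, ∀ j ∈ P, 0 < b * a₂ s(i, j)) (hν : ν * b < 0)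
    (hz : z ∈ supportedIn P) (hz0 : z ≠ 0) : 0 < eqGrowth a₁ a₂ ν z :=
  Real.sqrt_pos.2 (eqScale_pos (mul_neg_of_signs hν (mul_quartForm_normSqVec_pos hP hz hz0)))

theorem sq_eqGrowth (hP : ∀ i ∈ P, ∀ j ∈ P, 0 < b * a₂ s(i, j)) (hν : ν * b < 0)
    (hz : z ∈ supportedIn P) (hz0 : z ≠ 0) : eqGrowth a₁ a₂ ν z ^ 2 =
      eqScale ν (linForm a₁ (normSqVec z)) (quartForm a₂ (normSqVec z)) :=
  Real.sq_sqrt (eqScale_pos (mul_neg_of_signs hν (mul_quartForm_normSqVec_pos hP hz hz0))).le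

theorem eqGrowth_eq_one (hP : ∀ i ∈ P, ∀ j ∈ P, 0 < b * a₂ s(i, j)) (hν : ν * b < 0)
    (hz : z ∈ supportedIn P) (hz0 : z ≠ 0) (h : radialRate a₁ a₂ ν z = 0) :
    eqGrowth a₁ a₂ ν z = 1 := by
  rw [radialRate_eq] at h
  rw [eqGrowth, ← eqScale_unique (mul_neg_of_signs hν (mul_quartForm_normSqVec_pos hP hz hz0))
    one_pos (by linarith), Real.sqrt_one]

/-- Multiplication of the radii by the equilibrium factor leads to the invariant hypertorus of the
leaf. -/
theorem rotScale_eqGrowth_mem (hP : ∀ i ∈ P, ∀ j ∈ P, 0 < b * a₂ s(i, j)) (hν : ν * b < 0)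
    {α : Fin n → ℝ} (hC : C ∈ roundRegion α P) (hz : z ∈ leaf C) (t : ℝ) :
    rotScale ω z (eqGrowth a₁ a₂ ν z) t ∈ toralSet (torusScale a₁ a₂ ν) (roundRegion α P) := by
  have hs := supportedIn_of_mem_leaf hC hz
  have hz0 := ne_zero_of_mem_leaf hC hz
  have hpos : 0 < eqGrowth a₁ a₂ ν z := eqGrowth_pos hP hν hs hz0
  have hνQ := mul_neg_of_signs hν (mul_quartForm_normSqVec_pos hP hs hz0)
  obtain ⟨r, hr, h⟩ := hz
  have hw : ∀ i, ‖rotScale ω z (eqGrowth a₁ a₂ ν z) t i‖ = eqGrowth a₁ a₂ ν z * r * C i := by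
    intro i
    rw [norm_rotScale hpos.le, h i, mul_assoc]
  refine ⟨C, hC, fun i => ?_⟩
  rw [hw i, ← (radialRate_eq_zero_iff hP hν hC (mul_pos hpos hr) hw).1]
  rw [radialRate_of_normSqVec (normSqVec_rotScale hpos.le), sq_eqGrowth hP hν hs hz0]
  exact eqScale_root hνQ

end Hypertori


/-! ### Stability of the invariant hypertori -/

section Stability

variable {n : ℕ} {ω a₁ : Fin n → ℝ} {a₂ : Sym2 (Fin n) → ℝ} {ν b : ℝ} {P : Finset (Fin n)}
  {z w : Fin n → ℂ} {α : Fin n → ℝ}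

theorem dist_rotScale_le (x : Fin n → ℂ) (E E' t : ℝ) :
    dist (rotScale ω x E t) (rotScale ω x E' t) ≤ |E - E'| * ‖x‖ := by
  refine (dist_pi_le_iff (by positivity)).2 fun i => ?_
  rw [Complex.dist_eq, rotScale, rotScale, ← sub_mul, norm_mul, norm_mul,
    Complex.norm_exp_ofReal_mul_I, one_mul, ← Complex.ofReal_sub, Complex.norm_real,
    Real.norm_eq_abs]
  exact mul_le_mul_of_nonneg_left (norm_le_pi_norm x i) (abs_nonneg _)

theorem dist_rotScale_one (x y : Fin n → ℂ) (t : ℝ) :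
    dist (rotScale ω x 1 t) (rotScale ω y 1 t) ≤ dist x y := by
  refine (dist_pi_le_iff dist_nonneg).2 fun i => ?_
  rw [Complex.dist_eq, rotScale, rotScale, Complex.ofReal_one, one_mul, one_mul, ← mul_sub,
    norm_mul, Complex.norm_exp_ofReal_mul_I, one_mul, ← Complex.dist_eq]
  exact dist_le_pi_dist x y i

/-- For `ν > 0` and a negative quartic part the growth factor approaches its equilibrium value
monotonically and exponentially fast. -/
theorem IsGrowth.exists_abs_sub_le (hν : 0 < ν) (hQ : quartForm a₂ (normSqVec z) < 0) {E : ℝ → ℝ}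
    {J : Set ℝ} (h : IsGrowth a₁ a₂ ν z E J) (hJ : J.OrdConnected) (h0 : (0 : ℝ) ∈ J) :
    ∃ κ > 0, ∀ t ∈ J, 0 ≤ t → |E t - 1| ≤ |eqGrowth a₁ a₂ ν z - 1| ∧
      |E t - eqGrowth a₁ a₂ ν z| ≤ Real.exp (-(κ * t)) * |1 - eqGrowth a₁ a₂ ν z| := by
  have hνQ := mul_neg_of_pos_of_neg hν hQ
  have hT := eqScale_pos (q := linForm a₁ (normSqVec z)) hνQ
  have hroot := eqScale_root (q := linForm a₁ (normSqVec z)) hνQ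
  have hadd := eqScale_add (q := linForm a₁ (normSqVec z)) hνQ
  set e := eqGrowth a₁ a₂ ν z with he
  have he0 : 0 < e := Real.sqrt_pos.2 hT
  have he2 : e ^ 2 = eqScale ν (linForm a₁ (normSqVec z)) (quartForm a₂ (normSqVec z)) :=
    Real.sq_sqrt hT.le
  rw [← he2] at hroot hadd
  set q := linForm a₁ (normSqVec z)
  set Q := quartForm a₂ (normSqVec z)
  let c : ℝ → ℝ := fun s => E s * (E s + e) * (q + Q * (E s ^ 2 + e ^ 2))
  have hc : ∀ s ∈ J, c s ≤ -(ν / e) * E s := by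
    intro s hs
    have hE := (h.2 s hs).1
    have h1 : q + Q * (E s ^ 2 + e ^ 2) = Q * E s ^ 2 - ν / e ^ 2 := by linarith
    have h2 : ν / e = e * (ν / e ^ 2) := by field_simp
    have h3 : 0 < ν / e ^ 2 := by positivity
    have h4 : E s * (E s + e) * (Q * E s ^ 2) ≤ 0 :=
      mul_nonpos_of_nonneg_of_nonpos (by positivity)
        (mul_nonpos_of_nonpos_of_nonneg hQ.le (sq_nonneg _))
    have h5 : 0 ≤ E s * E s * (ν / e ^ 2) := by positivity
    simp only [c]
    rw [h1, h2]
    linarith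
  have hE := h.continuousOn
  have hcc : ContinuousOn c J := by fun_prop
  -- a linear bound for the exponent on an interval on which the factor is bounded from below
  have hint : ∀ d : ℝ, ∀ t ∈ J, 0 ≤ t → (∀ s ∈ Icc 0 t, d ≤ E s) →
      ∫ s in (0 : ℝ)..t, c s ≤ -(ν / e * d * t) := by
    intro d t ht ht0 hd
    have hI : Icc 0 t ⊆ J := hJ.out h0 ht
    have h1 : ∫ s in (0 : ℝ)..t, c s ≤ ∫ _ in (0 : ℝ)..t, -(ν / e * d) := by
      refine intervalIntegral.integral_mono_on ht0 ?_ (by simp) fun s hs => ?_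
      · exact (hcc.mono (by rwa [uIcc_of_le ht0])).intervalIntegrable
      · refine (hc s (hI hs)).trans ?_
        have := mul_le_mul_of_nonneg_left (hd s hs) (by positivity : 0 ≤ ν / e)
        linarith
    refine h1.trans_eq ?_
    rw [intervalIntegral.integral_const, smul_eq_mul]
    ring
  have hsub : ∀ t ∈ J, E t - e = Real.exp (∫ s in (0 : ℝ)..t, c s) * (1 - e) := fun t ht =>
    h.sub_eq hJ h0 hroot ht
  have hexp : ∀ t ∈ J, 0 ≤ t → Real.exp (∫ s in (0 : ℝ)..t, c s) ≤ 1 := by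
    intro t ht ht0
    rw [Real.exp_le_one_iff]
    simpa using hint 0 t ht ht0 fun s hs => (h.2 s (hJ.out h0 ht hs)).1.le
  have hmin : ∀ t ∈ J, 0 ≤ t → min 1 e ≤ E t := by
    intro t ht ht0
    have h1 := hsub t ht
    have h2 := hexp t ht ht0
    have h3 := Real.exp_pos (∫ s in (0 : ℝ)..t, c s)
    rcases le_total 1 e with h4 | h4
    · rw [min_eq_left h4]
      nlinarith
    · rw [min_eq_right h4]
      nlinarith
  have hκ : 0 < ν / e * min 1 e := mul_pos (div_pos hν he0) (lt_min one_pos he0)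
  refine ⟨_, hκ, fun t ht ht0 => ⟨?_, ?_⟩⟩
  · have h1 : E t - 1 = (1 - Real.exp (∫ s in (0 : ℝ)..t, c s)) * (e - 1) := by
      linarith [hsub t ht]
    rw [h1, abs_mul]
    refine mul_le_of_le_one_left (abs_nonneg _) ?_
    have h2 := hexp t ht ht0
    have h3 := Real.exp_pos (∫ s in (0 : ℝ)..t, c s)
    rw [abs_of_nonneg (by linarith)]
    linarith
  · rw [hsub t ht, abs_mul, Real.abs_exp]
    refine mul_le_mul_of_nonneg_right (Real.exp_le_exp.2 ?_) (abs_nonneg _)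
    exact hint _ t ht ht0 fun s hs => hmin s (hJ.out h0 ht hs) hs.1

/-- For `ν > 0` and a negative quartic part the solutions exist for all positive times. -/
theorem exists_growth_Ici (hν : 0 < ν) (hQ : quartForm a₂ (normSqVec z) < 0) :
    ∃ E : ℝ → ℝ, IsGrowth a₁ a₂ ν z E (Ici 0) ∧ Tendsto E atTop (𝓝 (eqGrowth a₁ a₂ ν z)) := by
  have hνQ := mul_neg_of_pos_of_neg hν hQ
  have hT := eqScale_pos (q := linForm a₁ (normSqVec z)) hνQ
  have hroot := eqScale_root (q := linForm a₁ (normSqVec z)) hνQ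
  have hadd := eqScale_add (q := linForm a₁ (normSqVec z)) hνQ
  have he0 : 0 < eqGrowth a₁ a₂ ν z := Real.sqrt_pos.2 hT
  have he2 : eqGrowth a₁ a₂ ν z ^ 2 =
    eqScale ν (linForm a₁ (normSqVec z)) (quartForm a₂ (normSqVec z)) := Real.sq_sqrt hT.le
  rw [← he2] at hroot hadd
  set e := eqGrowth a₁ a₂ ν z
  set q := linForm a₁ (normSqVec z) with hq
  set Q := quartForm a₂ (normSqVec z) with hQ'
  have hposI : ∀ x ∈ uIcc e 1, 0 < x := fun x hx =>
    (lt_min he0 one_pos).trans_le (by rw [uIcc, mem_Icc] at hx; exact hx.1)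
  obtain ⟨E, hE0, hE, hlim⟩ := exists_scalar_solution_tendsto
    (G := fun x => x * (ν + q * x ^ 2 + Q * (x ^ 2) ^ 2)) (e := e) (e₀ := 1) (by fun_prop)
    (by rw [hroot, mul_zero]) (fun x hx hxe => by
      have hx0 := hposI x hx
      have h1 : ν + q * x ^ 2 + Q * (x ^ 2) ^ 2 =
          (x - e) * (x + e) * (Q * x ^ 2 - ν / e ^ 2) := by
        linear_combination hroot + (x ^ 2 - e ^ 2) * hadd
      have h2 : Q * x ^ 2 - ν / e ^ 2 < 0 := by
        have : 0 < ν / e ^ 2 := by positivity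
        nlinarith [mul_neg_of_neg_of_pos hQ (pow_pos hx0 2)]
      have h3 : 0 < (x - e) ^ 2 := by
        have := sub_ne_zero.2 hxe
        positivity
      have h4 : (x - e) * (x * (ν + q * x ^ 2 + Q * (x ^ 2) ^ 2)) =
          (x - e) ^ 2 * (x * (x + e)) * (Q * x ^ 2 - ν / e ^ 2) := by rw [h1]; ring
      rw [h4]
      exact mul_neg_of_pos_of_neg (by positivity) h2)
  exact ⟨E, ⟨hE0, fun t ht => ⟨hposI _ (hE t ht).2.1, (hE t ht).1.hasDerivWithinAt⟩⟩, hlim⟩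

/-- Reversal of time. -/
theorem IsGrowth.comp_neg {E : ℝ → ℝ} {J : Set ℝ}
    (h : IsGrowth (-a₁) (-a₂) (-ν) z E J) : IsGrowth a₁ a₂ ν z (fun t => E (-t)) (-J) := by
  refine ⟨by simpa using h.1, fun t ht => ⟨(h.2 _ ht).1, ?_⟩⟩
  have h1 := (h.2 _ ht).2.scomp t (h := fun t => -t) (h' := -1) (s := -J)
    ((hasDerivAt_neg t).hasDerivWithinAt) (fun s hs => hs)
  refine h1.congr_deriv ?_
  have h2 : linForm (-a₁) (normSqVec z) = -linForm a₁ (normSqVec z) := by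
    simp [linForm_apply]
  have h3 : quartForm (-a₂) (normSqVec z) = -quartForm a₂ (normSqVec z) := by
    simp [quartForm]
  rw [h2, h3, smul_eq_mul]
  ring

theorem eqGrowth_neg : eqGrowth (-a₁) (-a₂) (-ν) z = eqGrowth a₁ a₂ ν z := by
  have h2 : linForm (-a₁) (normSqVec z) = -linForm a₁ (normSqVec z) := by
    simp [linForm_apply]
  have h3 : quartForm (-a₂) (normSqVec z) = -quartForm a₂ (normSqVec z) := by
    simp [quartForm]
  rw [eqGrowth, eqGrowth, h2, h3, eqScale, eqScale, abs_neg]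
  simp only [neg_sq, mul_neg, neg_mul, neg_neg]

/-- For `ν < 0` and a positive quartic part the solutions exist for all negative times. -/
theorem exists_growth_Iic (hν : ν < 0) (hQ : 0 < quartForm a₂ (normSqVec z)) :
    ∃ E : ℝ → ℝ, IsGrowth a₁ a₂ ν z E (Iic 0) ∧ Tendsto E atBot (𝓝 (eqGrowth a₁ a₂ ν z)) := by
  obtain ⟨E, hE, hlim⟩ := exists_growth_Ici (a₁ := -a₁) (a₂ := -a₂) (z := z) (neg_pos.2 hν)
    (by simpa [quartForm] using hQ)
  rw [eqGrowth_neg] at hlim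
  have h1 := hE.comp_neg
  rw [neg_Ici, neg_zero] at h1
  exact ⟨_, h1, hlim.comp tendsto_neg_atBot_atTop⟩

theorem rotScale_one_mem_toralSet {R : (Fin n → ℝ) → ℝ} {K : Set (Fin n → ℝ)}
    (hz : z ∈ toralSet R K) (t : ℝ) : rotScale ω z 1 t ∈ toralSet R K := by
  obtain ⟨C, hC, h⟩ := hz
  exact ⟨C, hC, fun i => by rw [norm_rotScale zero_le_one, one_mul, h i]⟩

theorem pos_of_mul_neg_of_neg (hν : ν * b < 0) (hb : b < 0) : 0 < ν :=
  pos_of_mul_neg_left hν hb.le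

/-- For `b < 0` a solution that starts near the hypertori stays near them: its distance from the rotated
initial point is controlled by the distance of the equilibrium growth factor from `1`. -/
theorem lyapunovStableOn_toralSet (hP : ∀ i ∈ P, ∀ j ∈ P, 0 < b * a₂ s(i, j)) (hν : ν * b < 0)
    (hb : b < 0) : LyapunovStableOn (vectorField ω a₁ a₂ ν) (supportedIn P)
      (toralSet (torusScale a₁ a₂ ν) (roundRegion α P)) := by
  intro U hU hTU
  obtain ⟨δ, hδ, hδU⟩ := (isCompact_toralSet (continuousOn_torusScale (α := α) hP hν)
    fun C hC => torusScale_pos hP hν hC).exists_thickening_subset_open hU hTU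
  set T := toralSet (torusScale a₁ a₂ ν) (roundRegion α P) with hT
  refine ⟨interior {x | (∃ p ∈ T, dist x p < δ / 2) ∧ |eqGrowth a₁ a₂ ν x - 1| * ‖x‖ < δ / 2},
    isOpen_interior, fun p hp => ?_, fun b' u hu hu0 t ht => ?_⟩
  · obtain ⟨C, hC, hl, hr⟩ := mem_leaf_of_mem_toralSet hP hν hp
    have hs := supportedIn_of_mem_leaf hC hl
    have hp0 := ne_zero_of_mem_leaf hC hl
    have h1 := eqGrowth_eq_one hP hν hs hp0 hr
    have hc : ContinuousAt (fun x => |eqGrowth a₁ a₂ ν x - 1| * ‖x‖) p :=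
      ((continuousAt_eqGrowth hP hν hs hp0).sub continuousAt_const).abs.mul continuous_norm.continuousAt
    rw [mem_interior_iff_mem_nhds]
    filter_upwards [Metric.ball_mem_nhds p (half_pos hδ),
      hc.eventually (gt_mem_nhds (show |eqGrowth a₁ a₂ ν p - 1| * ‖p‖ < δ / 2 by
        rw [h1]; simpa using hδ))] with x hx hx'
    exact ⟨⟨p, hp, hx⟩, hx'⟩
  · obtain ⟨⟨p, hp, hdist⟩, hsmall⟩ := interior_subset hu0.1
    have h0 : (0 : ℝ) ∈ Icc 0 b' := ⟨le_rfl, ht.1.trans ht.2⟩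
    obtain ⟨E, hE, hEu⟩ := hu.exists_growth ordConnected_Icc h0
    apply hδU
    rw [Metric.mem_thickening_iff]
    refine ⟨_, rotScale_one_mem_toralSet (ω := ω) hp t, ?_⟩
    have h1 : |E t - 1| * ‖u 0‖ < δ / 2 := by
      by_cases hz : u 0 = 0
      · rw [hz, norm_zero, mul_zero]
        exact half_pos hδ
      · have hQ := mul_quartForm_normSqVec_pos hP hu0.2 hz
        obtain ⟨κ, -, h2⟩ := hE.exists_abs_sub_le (pos_of_mul_neg_of_neg hν hb)
          (neg_of_mul_pos_right hQ hb.le) ordConnected_Icc h0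
        exact (mul_le_mul_of_nonneg_right (h2 t ht ht.1).1 (norm_nonneg _)).trans_lt hsmall
    rw [hEu t ht]
    calc dist (rotScale ω (u 0) (E t) t) (rotScale ω p 1 t)
        ≤ dist (rotScale ω (u 0) (E t) t) (rotScale ω (u 0) 1 t) +
          dist (rotScale ω (u 0) 1 t) (rotScale ω p 1 t) := dist_triangle _ _ _
      _ ≤ |E t - 1| * ‖u 0‖ + dist (u 0) p :=
          add_le_add (dist_rotScale_le _ _ _ _) (dist_rotScale_one _ _ _)
      _ < δ := by linarith

theorem LyapunovStableOn.mono {F : Type*} [NormedAddCommGroup F] [NormedSpace ℝ F] {v : F → F}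
    {Ω Ω' T : Set F} (h : LyapunovStableOn v Ω T) (hΩ : Ω' ⊆ Ω) : LyapunovStableOn v Ω' T := by
  intro U hU hTU
  obtain ⟨V, hV, hTV, h1⟩ := h U hU hTU
  exact ⟨V, hV, hTV, fun b u hu hu0 => h1 b u hu ⟨hu0.1, hΩ hu0.2⟩⟩

theorem leafRegion_subset_supportedIn : leafRegion (roundRegion α P) ⊆ supportedIn P := by
  intro z hz
  simp only [leafRegion, mem_iUnion, exists_prop] at hz
  obtain ⟨C, hC, hz⟩ := hz
  exact supportedIn_of_mem_leaf hC hz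

/-- For `b < 0` the hypertorus of every leaf attracts the whole leaf. -/
theorem asymptoticallyStableOn_toralSet (hP : ∀ i ∈ P, ∀ j ∈ P, 0 < b * a₂ s(i, j))
    (hν : ν * b < 0) (hb : b < 0) :
    AsymptoticallyStableOn (vectorField ω a₁ a₂ ν) (leafRegion (roundRegion α P))
      (toralSet (torusScale a₁ a₂ ν) (roundRegion α P)) := by
  refine ⟨(lyapunovStableOn_toralSet hP hν hb).mono leafRegion_subset_supportedIn, univ,
    isOpen_univ, subset_univ _, fun x hx => ?_⟩
  have hx' := hx.2
  simp only [leafRegion, mem_iUnion, exists_prop] at hx'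
  obtain ⟨C, hC, hl⟩ := hx'
  have hν0 := pos_of_mul_neg_of_neg hν hb
  have hQ := neg_of_mul_pos_right (mul_quartForm_normSqVec_pos hP (supportedIn_of_mem_leaf hC hl)
    (ne_zero_of_mem_leaf hC hl)) hb.le
  refine ⟨?_, fun u hu hux => ?_⟩
  · obtain ⟨E, hE, -⟩ := exists_growth_Ici (a₁ := a₁) hν0 hQ
    exact ⟨_, hE.isSol, by simp only [hE.1, rotScale_zero]⟩
  · obtain ⟨E, hE, hEu⟩ := hu.exists_growth ordConnected_Ici self_mem_Ici
    rw [hux] at hE hEu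
    obtain ⟨κ, hκ, h1⟩ := hE.exists_abs_sub_le hν0 hQ ordConnected_Ici self_mem_Ici
    have hlim : Tendsto (fun t => Real.exp (-(κ * t)) * |1 - eqGrowth a₁ a₂ ν x| * ‖x‖) atTop
        (𝓝 0) := by
      have h2 : Tendsto (fun t => Real.exp (-(κ * t))) atTop (𝓝 0) :=
        Real.tendsto_exp_neg_atTop_nhds_zero.comp (tendsto_id.const_mul_atTop hκ)
      simpa [mul_assoc] using h2.mul_const (|1 - eqGrowth a₁ a₂ ν x| * ‖x‖)
    refine squeeze_zero' (Eventually.of_forall fun _ => Metric.infDist_nonneg) ?_ hlim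
    filter_upwards [eventually_ge_atTop 0] with t ht
    rw [hEu t ht]
    calc Metric.infDist (rotScale ω x (E t) t) _
        ≤ dist (rotScale ω x (E t) t) (rotScale ω x (eqGrowth a₁ a₂ ν x) t) :=
          Metric.infDist_le_dist_of_mem (rotScale_eqGrowth_mem hP hν hC hl t)
      _ ≤ |E t - eqGrowth a₁ a₂ ν x| * ‖x‖ := dist_rotScale_le _ _ _ _
      _ ≤ _ := mul_le_mul_of_nonneg_right (h1 t ht ht).2 (norm_nonneg _)

theorem IsSol.comp_add_const {F : Type*} [NormedAddCommGroup F] [NormedSpace ℝ F] {v : F → F}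
    {u : ℝ → F} {J J' : Set ℝ} (hu : IsSol v u J) (s : ℝ) (hJ : ∀ t ∈ J', t + s ∈ J) :
    IsSol v (fun t => u (t + s)) J' := by
  intro t ht
  have h1 := (hu _ (hJ t ht)).scomp t (h := fun t => t + s) (h' := 1) (s := J')
    (((hasDerivAt_id t).add_const s).hasDerivWithinAt) hJ
  rw [one_smul] at h1
  exact h1

theorem rotScale_mem_leaf {C : Fin n → ℝ} (hz : z ∈ leaf C) {E : ℝ} (hE : 0 < E) (t : ℝ) :
    rotScale ω z E t ∈ leaf C := by
  obtain ⟨r, hr, h⟩ := hz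
  exact ⟨E * r, mul_pos hE hr, fun i => by rw [norm_rotScale hE.le, h i, mul_assoc]⟩

/-- For `b > 0` the backward trajectories in the leaves tend to the invariant hypertori, which are
therefore unstable. -/
theorem not_lyapunovStableOn_toralSet (hP : ∀ i ∈ P, ∀ j ∈ P, 0 < b * a₂ s(i, j))
    (hν : ν * b < 0) (hb : 0 < b)
    (hne : (toralSet (torusScale a₁ a₂ ν) (roundRegion α P)).Nonempty) :
    ¬ LyapunovStableOn (vectorField ω a₁ a₂ ν) (leafRegion (roundRegion α P))
      (toralSet (torusScale a₁ a₂ ν) (roundRegion α P)) := by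
  intro hstab
  obtain ⟨z₀, C, hC, hz₀⟩ := hne
  have hR : 0 < torusScale a₁ a₂ ν C := torusScale_pos hP hν hC
  -- a point of the leaf outside of the torus
  have hz : ∀ i, ‖((2 : ℝ) • z₀) i‖ = 2 * torusScale a₁ a₂ ν C * C i := by
    intro i
    rw [Pi.smul_apply, norm_smul, hz₀ i, Real.norm_of_nonneg zero_le_two, mul_assoc]
  set z := (2 : ℝ) • z₀ with hz'
  have hl : z ∈ leaf C := ⟨_, mul_pos two_pos hR, hz⟩
  have hzT : z ∉ toralSet (torusScale a₁ a₂ ν) (roundRegion α P) := by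
    intro h
    obtain ⟨C', hC', -, hr⟩ := mem_leaf_of_mem_toralSet hP hν h
    have := (radialRate_eq_zero_iff hP hν hC (mul_pos two_pos hR) hz).1 hr
    linarith
  obtain ⟨V, hV, hTV, h1⟩ := hstab {z}ᶜ isOpen_compl_singleton fun w hw hwz => hzT (hwz ▸ hw)
  obtain ⟨δ, hδ, hδV⟩ := (isCompact_toralSet (continuousOn_torusScale (α := α) hP hν)
    fun C hC => torusScale_pos hP hν hC).exists_thickening_subset_open hV hTV
  obtain ⟨E, hE, hlim⟩ := exists_growth_Iic (a₁ := a₁) (neg_of_mul_neg_left hν hb.le)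
    (pos_of_mul_pos_right (mul_quartForm_normSqVec_pos hP (supportedIn_of_mem_leaf hC hl)
    (ne_zero_of_mem_leaf hC hl)) hb.le)
  have h2 : Tendsto (fun t => |E t - eqGrowth a₁ a₂ ν z| * ‖z‖) atBot (𝓝 0) := by
    simpa using ((hlim.sub_const (eqGrowth a₁ a₂ ν z)).abs).mul_const ‖z‖
  obtain ⟨t, ht, ht0⟩ := ((h2.eventually (gt_mem_nhds hδ)).and (eventually_le_atBot 0)).exists
  have h3 := h1 (-t) (fun s => rotScale ω z (E (s + t)) (s + t))
    ((hE.isSol (ω := ω)).comp_add_const (J' := Icc 0 (-t)) t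
      fun s hs => mem_Iic.2 (by linarith [hs.2]))
  refine h3 ⟨hδV ?_, ?_⟩ (-t) ⟨by linarith, le_rfl⟩ ?_
  · rw [Metric.mem_thickening_iff]
    refine ⟨_, rotScale_eqGrowth_mem (ω := ω) hP hν hC hl t, ?_⟩
    rw [zero_add]
    exact (dist_rotScale_le _ _ _ _).trans_lt ht
  · rw [zero_add, leafRegion]
    exact mem_biUnion hC (rotScale_mem_leaf hl (hE.2 t ht0).1 t)
  · simp only [neg_add_cancel, hE.1, rotScale_zero, mem_singleton_iff]

end Stability


/-! ### The bifurcation at the origin -/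

section Bifurcation

variable {n : ℕ} {ω a₁ : Fin n → ℝ} {a₂ : Sym2 (Fin n) → ℝ} {ν : ℝ} {P : Finset (Fin n)}

theorem eq_zero_of_vectorField_eq_zero (hω : ∀ i, ω i ≠ 0) {z : Fin n → ℂ}
    (h : vectorField ω a₁ a₂ ν z = 0) : z = 0 := by
  funext i
  have h1 := congrFun h i
  rw [vectorField, ← mul_assoc, ← add_mul, Pi.zero_apply, mul_eq_zero] at h1
  refine h1.resolve_left fun h2 => hω i ?_
  simpa using congrArg Complex.im h2

theorem vectorField_zero : vectorField ω a₁ a₂ ν 0 = 0 := by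
  funext i; simp [vectorField]

/-- A monotone change of time that maps one interval of times onto the other preserves the initial
time. -/
theorem changeOfTime_zero {τ : ℝ → ℝ} {b b' : ℝ} (hb : 0 ≤ b) (hb' : 0 ≤ b')
    (hτ : StrictMonoOn τ (Icc 0 b)) (himg : τ '' Icc 0 b = Icc 0 b') : τ 0 = 0 := by
  have h0 : (0 : ℝ) ∈ Icc 0 b := ⟨le_rfl, hb⟩
  have h1 : τ 0 ∈ Icc 0 b' := himg ▸ mem_image_of_mem τ h0
  have h2 : (0 : ℝ) ∈ τ '' Icc 0 b := himg ▸ ⟨le_rfl, hb'⟩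
  obtain ⟨s, hs, hs0⟩ := h2
  exact le_antisymm (hs0 ▸ hτ.monotoneOn h0 hs hs.1) h1.1

/-- A map that carries trajectories carries the origin to the only equilibrium. -/
theorem CarriesTrajectories.map_zero (hω : ∀ i, ω i ≠ 0) {ν' : ℝ} {A B : Set (Fin n → ℂ)}
    {h : A → B} (hh : CarriesTrajectories (vectorField ω a₁ a₂ ν) (vectorField ω a₁ a₂ ν') h)
    (h0 : (0 : Fin n → ℂ) ∈ A) : (h ⟨0, h0⟩ : Fin n → ℂ) = 0 := by
  obtain ⟨b', u', τ, hb', hu', hτ, himg, heq⟩ := hh 1 (fun _ => 0) (fun _ _ => h0) zero_le_one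
    (fun t _ => by simp only [vectorField_zero]; exact hasDerivWithinAt_const t _ 0)
  have h0τ := changeOfTime_zero zero_le_one hb' hτ himg
  have h1 : τ 0 < τ 1 := hτ ⟨le_rfl, zero_le_one⟩ ⟨zero_le_one, le_rfl⟩ one_pos
  have h2 : τ 1 ∈ Icc 0 b' := himg ▸ mem_image_of_mem τ ⟨zero_le_one, le_rfl⟩
  have hbpos : 0 < b' := (h0τ ▸ h1).trans_le h2.2
  -- the image of the constant solution is constant
  have hconst : ∀ t ∈ Icc 0 b', u' t = h ⟨0, h0⟩ := by
    intro t ht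
    rw [← himg] at ht
    obtain ⟨s, hs, rfl⟩ := ht
    exact heq s hs
  have hmem : (0 : ℝ) ∈ Icc 0 b' := ⟨le_rfl, hb'⟩
  have hd := (hu' 0 hmem).congr (f₁ := fun _ => (h ⟨0, h0⟩ : Fin n → ℂ))
    (fun t ht => (hconst t ht).symm) (hconst 0 hmem).symm
  have h3 := (uniqueDiffOn_Icc hbpos 0 hmem).eq_deriv _ hd (hasDerivWithinAt_const _ _ _)
  rw [hconst 0 hmem] at h3
  exact eq_zero_of_vectorField_eq_zero hω h3

/-- A global equivalence is in particular a local one, since it fixes the origin. -/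
theorem TopEquivOn.atOrigin (hω : ∀ i, ω i ≠ 0) {ν' : ℝ} {Ω : Set (Fin n → ℂ)}
    (h : TopEquivOn (vectorField ω a₁ a₂ ν) (vectorField ω a₁ a₂ ν') Ω) :
    TopEquivAtOriginOn (vectorField ω a₁ a₂ ν) (vectorField ω a₁ a₂ ν') Ω := by
  refine ⟨univ, univ, isOpen_univ, isOpen_univ, trivial, trivial, ?_⟩
  rw [univ_inter]
  obtain ⟨h, h1, h2⟩ := h
  refine ⟨h, fun x hx => ?_, h1, h2⟩
  obtain ⟨x, hxΩ⟩ := x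
  subst hx
  exact h1.map_zero hω hxΩ

/-- For the parameter `0` there is a trajectory that leaves the origin along an axis on which the
quadratic part of the radial rate is positive. -/
theorem exists_growth_tendsto_zero {p : Fin n} (hp : p ∈ P) (hα : 0 < a₁ p) {V : Set (Fin n → ℂ)}
    (hV : V ∈ 𝓝 0) : ∃ z ∈ supportedIn P, z ≠ 0 ∧ ∃ E : ℝ → ℝ, IsGrowth a₁ a₂ 0 z E (Iic 0) ∧
      (∀ t ≤ 0, rotScale ω z (E t) t ∈ V) ∧ Tendsto E atBot (𝓝 0) := by
  obtain ⟨r, hr, hball⟩ := Metric.mem_nhds_iff.1 hV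
  let y : Fin n → ℂ := Pi.single p 1
  have hq : 0 < linForm a₁ (normSqVec y) := by
    have : normSqVec y = Pi.single p 1 := by
      funext i
      by_cases h : i = p
      · subst h; simp [normSqVec, y]
      · simp [normSqVec, y, h]
    rw [this, linForm_single]
    simpa using hα
  have hy : ‖y‖ = 1 := by rw [Pi.norm_single, norm_one]
  -- close to the origin the quadratic part dominates
  have hev : ∀ᶠ δ : ℝ in 𝓝[>] 0,
      δ ^ 2 * |quartForm a₂ (normSqVec y)| < linForm a₁ (normSqVec y) := by
    have hc : Continuous fun δ : ℝ => δ ^ 2 * |quartForm a₂ (normSqVec y)| := by fun_prop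
    exact nhdsWithin_le_nhds ((hc.tendsto 0).eventually (gt_mem_nhds (by simpa using hq)))
  obtain ⟨δ, hδ, hδ0, hδr⟩ := (hev.and (Ioo_mem_nhdsGT hr)).exists
  set z : Fin n → ℂ := δ • y with hz
  have hz2 : normSqVec z = δ ^ 2 • normSqVec y := by
    funext i
    simp only [hz, normSqVec, Pi.smul_apply, norm_smul, smul_eq_mul, mul_pow, Real.norm_eq_abs,
      sq_abs]
  have hznorm : ‖z‖ = δ := by rw [hz, norm_smul, hy, mul_one, Real.norm_of_nonneg hδ0.le]
  have hQ : |quartForm a₂ (normSqVec z)| < linForm a₁ (normSqVec z) := by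
    rw [hz2, quartForm_smul, map_smul, smul_eq_mul, abs_mul, abs_of_nonneg (sq_nonneg (δ ^ 2))]
    have : 0 < δ ^ 2 := by positivity
    nlinarith
  have hlin : linForm (-a₁) (normSqVec z) = -linForm a₁ (normSqVec z) := by
    simp [linForm_apply]
  have hquart : quartForm (-a₂) (normSqVec z) = -quartForm a₂ (normSqVec z) := by
    simp [quartForm]
  obtain ⟨E, hE0, hE, hlim⟩ := exists_scalar_solution_tendsto
    (G := fun x => x * (-0 + linForm (-a₁) (normSqVec z) * x ^ 2 +
      quartForm (-a₂) (normSqVec z) * (x ^ 2) ^ 2)) (e := 0) (e₀ := 1) (by fun_prop) (by simp)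
    (fun x hx hx0 => by
      rw [uIcc_of_le zero_le_one] at hx
      rw [hlin, hquart]
      have hx2 : 0 < x ^ 2 := by positivity
      have hx1 : x ^ 2 ≤ 1 := pow_le_one₀ hx.1 hx.2
      have h1 : -|quartForm a₂ (normSqVec z)| ≤ quartForm a₂ (normSqVec z) * x ^ 2 := by
        have h2 := neg_abs_le (quartForm a₂ (normSqVec z))
        have h3 := abs_nonneg (quartForm a₂ (normSqVec z))
        nlinarith
      have h4 : 0 < linForm a₁ (normSqVec z) + quartForm a₂ (normSqVec z) * x ^ 2 := by linarith
      have h5 := mul_pos (pow_pos hx2 2) h4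
      linarith)
  have hE' := fun t ht => uIcc_of_le (zero_le_one' ℝ) ▸ (hE t ht).2.1
  have hgrowth : IsGrowth (-a₁) (-a₂) (-0) z E (Ici 0) :=
    ⟨hE0, fun t ht => ⟨(hE' t ht).1.lt_of_ne' ((hE t ht).2.2 zero_ne_one),
      (hE t ht).1.hasDerivWithinAt⟩⟩
  have hgrowth' := hgrowth.comp_neg
  rw [neg_Ici, neg_zero] at hgrowth'
  refine ⟨z, fun i hi => ?_, ?_, _, hgrowth', fun t ht => hball ?_,
    hlim.comp tendsto_neg_atBot_atTop⟩
  · have : i ≠ p := fun h => hi (h ▸ hp)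
    simp [hz, y, this]
  · rw [← norm_pos_iff, hznorm]
    exact hδ0
  · have h1 := hE' (-t) (neg_nonneg.2 ht)
    rw [mem_ball_zero_iff, pi_norm_lt_iff hr]
    intro i
    rw [norm_rotScale h1.1]
    calc E (-t) * ‖z i‖ ≤ 1 * ‖z‖ :=
          mul_le_mul h1.2 (norm_le_pi_norm z i) (norm_nonneg _) zero_le_one
      _ < r := by rw [one_mul, hznorm]; exact hδr

/-- For `ν < 0` the origin attracts its neighbourhood, whereas for the parameter `0` some
trajectories leave it. -/
theorem not_topEquivAtOriginOn {p : Fin n} (hp : p ∈ P) (hα : 0 < a₁ p) (hν : ν < 0) :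
    ¬ TopEquivAtOriginOn (vectorField ω a₁ a₂ ν) (vectorField ω a₁ a₂ 0) (supportedIn P) := by
  rintro ⟨U, V, hU, hV, h0U, h0V, h, h0, -, hsymm⟩
  have h0P : (0 : Fin n → ℂ) ∈ supportedIn P := fun _ _ => rfl
  obtain ⟨z, hzP, hz0, E, hE, hEV, hlim⟩ :=
    exists_growth_tendsto_zero (ω := ω) (a₂ := a₂) hp hα (hV.mem_nhds h0V)
  have hmem : ∀ t ≤ 0, rotScale ω z (E t) t ∈ V ∩ supportedIn P := fun t ht =>
    ⟨hEV t ht, fun i hi => by simp [rotScale, hzP i hi]⟩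
  have hzmem : z ∈ V ∩ supportedIn P := by
    have := hmem 0 le_rfl
    rwa [hE.1, rotScale_zero] at this
  set y : Fin n → ℂ := ↑(h.symm ⟨z, hzmem⟩) with hy
  have hy0 : 0 < ‖y‖ := by
    rw [norm_pos_iff]
    intro h1
    have := h0 _ h1
    rw [h.apply_symm_apply] at this
    exact hz0 this
  have hsymm0 : h.symm ⟨0, h0V, h0P⟩ = ⟨0, h0U, h0P⟩ := by
    rw [h.symm_apply_eq]
    exact Subtype.ext (h0 ⟨0, h0U, h0P⟩ rfl).symm
  -- the set of points closer to the origin than `y` from which the radii decrease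
  have hW : ∀ᶠ x : Fin n → ℂ in 𝓝 0, radialRate a₁ a₂ ν x < 0 ∧ ‖x‖ < ‖y‖ := by
    refine (continuous_radialRate.tendsto 0 |>.eventually (gt_mem_nhds ?_)).and
      (continuous_norm.tendsto 0 |>.eventually (gt_mem_nhds (by rwa [norm_zero])))
    simpa [radialRate] using hν
  have hc : Tendsto (fun x : ↥(V ∩ supportedIn P) => (h.symm x : Fin n → ℂ))
      (𝓝 ⟨0, h0V, h0P⟩) (𝓝 0) := by
    have := (continuous_subtype_val.comp h.symm.continuous).tendsto ⟨0, h0V, h0P⟩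
    rw [Function.comp_apply, hsymm0] at this
    exact this
  have hW' := hc.eventually hW
  rw [show 𝓝 (⟨0, h0V, h0P⟩ : ↥(V ∩ supportedIn P)) = comap Subtype.val (𝓝 0) from
    nhds_subtype_eq_comap, eventually_comap] at hW'
  have hlim' : Tendsto (fun t => rotScale ω z (E t) t) atBot (𝓝 0) := by
    rw [tendsto_zero_iff_norm_tendsto_zero]
    refine squeeze_zero' (Eventually.of_forall fun _ => norm_nonneg _) ?_
      (by simpa using hlim.mul_const ‖z‖)
    filter_upwards [eventually_le_atBot 0] with t ht
    have hpos := (hE.2 t ht).1.le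
    refine (pi_norm_le_iff_of_nonneg (by positivity)).2 fun i => ?_
    rw [norm_rotScale hpos]
    exact mul_le_mul_of_nonneg_left (norm_le_pi_norm z i) hpos
  obtain ⟨t, ht, ht0⟩ := ((hlim'.eventually hW').and (eventually_le_atBot 0)).exists
  -- the arc of the trajectory from a point close to the origin to `z`
  have harc : ∀ s ∈ Icc 0 (-t), s + t ≤ 0 := fun s hs => by linarith [hs.2]
  have hb : 0 ≤ -t := by linarith
  obtain ⟨b', u', τ, hb', hu', hτ, himg, heq⟩ := hsymm (-t)
    (fun s => rotScale ω z (E (s + t)) (s + t)) (fun s hs => hmem _ (harc s hs)) hb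
    (hE.isSol.comp_add_const t harc)
  have hu0 : u' 0 = h.symm ⟨_, hmem t ht0⟩ := by
    have h1 := heq 0 ⟨le_rfl, hb⟩
    rw [changeOfTime_zero hb hb' hτ himg] at h1
    simpa only [zero_add] using h1
  have hu1 : u' (τ (-t)) = y := by
    rw [heq (-t) ⟨hb, le_rfl⟩, hy]
    simp only [neg_add_cancel, hE.1, rotScale_zero]
  have hrate := ht ⟨_, hmem t ht0⟩ rfl
  rw [← hu0] at hrate
  have h2 : ‖y‖ ≤ ‖u' 0‖ := by
    rw [← hu1]
    refine (pi_norm_le_iff_of_nonneg (norm_nonneg _)).2 fun i => ?_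
    exact (hu'.norm_le hb' hrate.1 (himg ▸ mem_image_of_mem τ ⟨hb, le_rfl⟩) i).trans
      (norm_le_pi_norm _ i)
  exact absurd hrate.2 (not_lt.2 h2)

theorem isPrimaryBifurcationValueOn_zero (hω : ∀ i, ω i ≠ 0) {p : Fin n} (hp : p ∈ P)
    (hα : 0 < a₁ p) :
    IsPrimaryBifurcationValueOn (vectorField ω a₁ a₂) (supportedIn P) 0 := by
  have hex : ∀ N ∈ 𝓝 (0 : ℝ), ∃ ν ∈ N, ν < 0 := fun N hN => by
    obtain ⟨ν, h1, h2⟩ := ((eventually_mem_nhdsWithin (s := Iio (0 : ℝ))).and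
      (nhdsWithin_le_nhds hN)).exists
    exact ⟨ν, h2, h1⟩
  refine ⟨fun N hN => ?_, fun N hN => ?_⟩
  · obtain ⟨ν, hν, hν0⟩ := hex N hN
    exact ⟨ν, hν, fun h => not_topEquivAtOriginOn hp hα hν0 (h.atOrigin hω)⟩
  · obtain ⟨ν, hν, hν0⟩ := hex N hN
    exact ⟨ν, hν, not_topEquivAtOriginOn hp hα hν0⟩

end Bifurcation


/-! ### Closed cells and signs -/

section Signs

variable {n : ℕ}

theorem closure_openCellM {k : ℕ} {σ : Equiv.Perm (Fin n)} :
    closure (openCellM k σ) = supportedIn (firstValues k σ) := by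
  have h1 : openCellM k σ = univ.pi fun i : Fin n =>
      if i ∈ firstValues k σ then ({0}ᶜ : Set ℂ) else {0} := by
    ext z
    simp only [openCellM, mem_ofPred_eq, mem_univ_pi]
    rw [σ.forall_congr_left]
    refine forall_congr' fun i => ?_
    rw [σ.apply_symm_apply, ← mem_firstValues]
    by_cases h : i ∈ firstValues k σ <;> simp [h]
  have h2 : supportedIn (firstValues k σ) = univ.pi fun i : Fin n =>
      if i ∈ firstValues k σ then (univ : Set ℂ) else {0} := by
    ext z
    simp only [supportedIn, mem_ofPred_eq, mem_univ_pi]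
    refine forall_congr' fun i => ?_
    by_cases h : i ∈ firstValues k σ <;> simp [h]
  rw [h1, h2, closure_pi_set]
  congr 1
  funext i
  by_cases h : i ∈ firstValues k σ
  · simp only [h, if_true]
    exact dense_compl_singleton (0 : ℂ) |>.closure_eq
  · simp only [h, if_false, closure_singleton]

theorem closure_GammaPlus {k : ℕ} {σ : Equiv.Perm (Fin n)} {a₁ : Fin n → ℝ} {b : ℝ} {p : Fin n}
    (hp : p ∈ firstValues k σ) (hα : 0 < b * a₁ p) :
    closure (GammaPlus a₁ b k σ k σ) = roundRegion (fun i => b * a₁ i) (firstValues k σ) := by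
  rw [GammaPlus_eq Finset.Subset.rfl, closure_roundOpenFace
    (openFace_false_nonempty (α := fun i => b * a₁ i) hp hα), roundRegion_eq]

theorem mul_neg_iff_of_mul_pos {x y : ℝ} (h : 0 < x * y) (c : ℝ) : c * y < 0 ↔ c * x < 0 := by
  rcases pos_and_pos_or_neg_and_neg_of_mul_pos h with ⟨hx, hy⟩ | ⟨hx, hy⟩
  · simp [mul_neg_iff, hx, hy, hx.not_gt, hy.not_gt]
  · simp [mul_neg_iff, hx, hy, hx.not_gt, hy.not_gt]

theorem exists_pos_of_sign_mul {P : Finset (Fin n)} {i j : Fin n} (hi : i ∈ P) (hj : j ∈ P)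
    {f : Fin n → ℝ} (h : f j * f i < 0) : ∃ p ∈ P, 0 < f p := by
  rcases mul_neg_iff.1 h with h | h
  · exact ⟨j, hj, h.1⟩
  · exact ⟨i, hi, h.2⟩

end Signs

end ToralBif

end

theorem mainTheorem10
    (n k : ℕ) (hk : 2 ≤ k) (hkn : k ≤ n)
    (σ : Equiv.Perm (Fin n)) (hσ : σ ∈ ToralBif.shuffles n k)
    (first last : Fin n) (hfirst : (first : ℕ) = 0) (hlast : (last : ℕ) + 1 = k)
    (ω a₁ : Fin n → ℝ) (a₂ : Sym2 (Fin n) → ℝ)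
    (hω : ∀ i, ω i ≠ 0) (hωω : ∀ i j, i < j → Irrational (ω i / ω j))
    (ha₁ : ∃ i j : Fin n, i < j ∧ (j : ℕ) < k ∧ SignType.sign (a₁ (σ j) * a₁ (σ i)) = -1)
    (ha₂ : ∀ i₁ i₂ j₁ j₂ : Fin n, i₁ ≤ i₂ → (i₂ : ℕ) < k → j₁ ≤ j₂ → (j₂ : ℕ) < k →
      SignType.sign (a₂ s(σ i₁, σ i₂)) * SignType.sign (a₂ s(σ j₁, σ j₂)) = 1)
    (v : ℝ → (Fin n → ℂ) → Fin n → ℂ) (hv : v = ToralBif.vectorField ω a₁ a₂)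
    (M : Set (Fin n → ℂ)) (hM : M = closure (ToralBif.openCellM k σ))
    (K : Set (Fin n → ℝ))
    (hK : K = closure (ToralBif.GammaPlus a₁ (a₂ s(σ first, σ first)) k σ k σ))
    (𝒯 : ℝ → Set (Fin n → ℂ)) (h𝒯 : ∀ ν, 𝒯 ν = ToralBif.toralUnion (v ν) K)
    (b : ℝ) (hb : b = a₂ s(σ last, σ last)) :
    -- the origin undergoes a primary bifurcation of the closed cell system
    ToralBif.IsPrimaryBifurcationValueOn v M 0 ∧
    -- invariant hypertori exist on the leaves over `K` exactly on one side
    (∀ ν : ℝ, ∀ C ∈ K, (∃ H, ToralBif.IsInvariantHypertorus (v ν) C H) ↔ ν * b < 0) ∧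
    -- they form a toral CW complex over `K`
    (∃ (l : ℕ) (γp γm : Equiv.Perm (Fin n)), l < k ∧
      γp ∈ ToralBif.subShuffles k σ l ∧ γm ∈ ToralBif.subShuffles k σ (k - l) ∧
      (∀ i ∈ ToralBif.firstValues l γp, 0 ≤ a₁ i * b) ∧
      (∀ i ∈ ToralBif.firstValues (k - l) γm, a₁ i * b < 0) ∧
      ∃ _ : Topology.CWComplex K,
        (∀ (m : ℕ) (c : Set (Fin n → ℝ)),
          (∃ e : Topology.CWComplex.cell K m, Topology.CWComplex.openCell (C := K) m e = c) ↔
            c.Nonempty ∧ ∃ L, ToralBif.IsGammaCell a₁ (a₂ s(σ first, σ first)) k σ l γp γm m L c) ∧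
        ∀ ν : ℝ, ν * b < 0 →
          ToralBif.FlowInvariant (v ν) (𝒯 ν) ∧ IsCompact (𝒯 ν) ∧ IsConnected (𝒯 ν) ∧
          𝒯 ν ⊆ M ∧
          (∀ C ∈ K, ∃! H, ToralBif.IsInvariantHypertorus (v ν) C H) ∧
          ∃ τ : ToralBif.ToralCWComplex (𝒯 ν) (Fin n) K,
            (∀ (m : ℕ) (e : Topology.CWComplex.cell K m) (L : Finset (Fin n)),
              ToralBif.IsGammaCell a₁ (a₂ s(σ first, σ first)) k σ l γp γm m L
                (Topology.CWComplex.openCell (C := K) m e) → τ.label m e = L) ∧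
            ∀ (m : ℕ) (e : Topology.CWComplex.cell K m) (x : τ.toralCell m e),
              ((x : 𝒯 ν) : Fin n → ℂ) ∈ ToralBif.leaf ((τ.g m e x).2 : Fin n → ℝ)) ∧
    -- it is born from the origin and its radii diverge
    (∀ U ∈ 𝓝 (0 : Fin n → ℂ), ∀ᶠ ν in 𝓝 (0 : ℝ), ν * b < 0 → 𝒯 ν ⊆ U) ∧
    (∀ ρ : ℝ, ∃ N : ℝ, ∀ ν : ℝ, N < |ν| → ν * b < 0 → ∀ z ∈ 𝒯 ν, ρ < ‖z‖) ∧
    -- stability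
    (∀ ν : ℝ, ν * b < 0 →
      (b < 0 → ToralBif.AsymptoticallyStableOn (v ν) (ToralBif.leafRegion K) (𝒯 ν) ∧
        ToralBif.LyapunovStableOn (v ν) M (𝒯 ν)) ∧
      (0 < b → ¬ ToralBif.LyapunovStableOn (v ν) (ToralBif.leafRegion K) (𝒯 ν))) ∧
    -- on the other side there is no invariant torus at all over `K`
    (∀ ν : ℝ, 0 ≤ ν * b → ∀ (m : ℕ) (H : Set (Fin n → ℂ)), 1 ≤ m →
      H ⊆ ToralBif.leafRegion K → Nonempty (H ≃ₜ (Fin m → Circle)) →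
        ¬ ToralBif.FlowInvariant (v ν) H) := by
  subst hv hM hb
  set b₀ := a₂ s(σ first, σ first) with hb₀
  set b := a₂ s(σ last, σ last)
  set P := ToralBif.firstValues k σ with hPdef
  have hfk : (first : ℕ) < k := by omega
  have hlk : (last : ℕ) < k := by omega
  -- all coefficients of the quartic part have the sign of `b₀`
  have hsgn : ∀ i j : Fin n, i ≤ j → (j : ℕ) < k → 0 < b₀ * a₂ s(σ i, σ j) := fun i j hij hj => by
    rw [← sign_eq_one_iff, sign_mul]
    exact ha₂ first first i j le_rfl hfk hij hj
  have hP : ∀ i ∈ P, ∀ j ∈ P, 0 < b₀ * a₂ s(i, j) := by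
    intro i hi j hj
    rw [hPdef, ToralBif.mem_firstValues] at hi hj
    rcases le_total (σ.symm i) (σ.symm j) with h | h
    · simpa using hsgn _ _ h hj
    · rw [Sym2.eq_swap]
      simpa using hsgn _ _ h hi
  have hb₀b : 0 < b₀ * b := hsgn last last le_rfl hlk
  have hb₀0 : b₀ ≠ 0 := (mul_ne_zero_iff.1 hb₀b.ne').1
  have hiff : ∀ c : ℝ, c * b < 0 ↔ c * b₀ < 0 := ToralBif.mul_neg_iff_of_mul_pos hb₀b
  have hbneg : b < 0 ↔ b₀ < 0 := by simpa using hiff 1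
  have hbpos : 0 < b ↔ 0 < b₀ := by simpa using hiff (-1)
  -- the quadratic part takes both signs
  obtain ⟨i, j, hij, hj, hsign⟩ := ha₁
  rw [sign_eq_neg_one_iff] at hsign
  have hiP : σ i ∈ P := ToralBif.apply_mem_firstValues.2 ((Fin.lt_def.1 hij).trans hj)
  have hjP : σ j ∈ P := ToralBif.apply_mem_firstValues.2 hj
  obtain ⟨p, hp, hpα⟩ := ToralBif.exists_pos_of_sign_mul hiP hjP hsign
  have hsign' : b₀ ^ 2 * (a₁ (σ j) * a₁ (σ i)) < 0 :=
    mul_neg_of_pos_of_neg (by positivity) hsign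
  obtain ⟨p', hp', hpα'⟩ := ToralBif.exists_pos_of_sign_mul (f := fun i => b₀ * a₁ i) hiP hjP
    (by linarith)
  obtain ⟨q, hq, hqα⟩ := ToralBif.exists_pos_of_sign_mul (f := fun i => -(b₀ * a₁ i)) hiP hjP
    (by linarith)
  rw [ToralBif.closure_GammaPlus hp' hpα'] at hK
  rw [ToralBif.closure_openCellM]
  subst hK
  have h𝒯' : ∀ ν, ν * b₀ < 0 → 𝒯 ν = ToralBif.toralSet (ToralBif.torusScale a₁ a₂ ν)
      (ToralBif.roundRegion (fun i => b₀ * a₁ i) P) := fun ν hν => by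
    rw [h𝒯, ToralBif.toralUnion_eq hP hν]
  have hne := ToralBif.openFace_false_nonempty (α := fun i => b₀ * a₁ i) hp' hpα'
  have hRc := fun {ν : ℝ} (hν : ν * b₀ < 0) =>
    ToralBif.continuousOn_torusScale (a₁ := a₁) (α := fun i => b₀ * a₁ i) hP hν
  have hRp := fun {ν : ℝ} (hν : ν * b₀ < 0) => fun C hC =>
    ToralBif.torusScale_pos (a₁ := a₁) (α := fun i => b₀ * a₁ i) (C := C) hP hν hC
  refine ⟨ToralBif.isPrimaryBifurcationValueOn_zero hω hp hpα, fun ν C hC => ?_, ?_, fun U hU => ?_,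
    fun ρ => ?_, fun ν hν => ?_, fun ν hν m H hm hH hhom => ?_⟩
  · simp only [ToralBif.isInvariantHypertorus_iff hP hC, hiff, exists_and_left, exists_eq, and_true]
  · have hcard : (P.filter (0 ≤ b₀ * a₁ ·)).card + (P.filter (b₀ * a₁ · < 0)).card = k := by
      rw [← ToralBif.card_firstValues σ hkn, ← hPdef,
        ← Finset.card_filter_add_card_filter_not (s := P) (0 ≤ b₀ * a₁ ·)]
      simp only [not_le]
    have hpos : 0 < (P.filter (b₀ * a₁ · < 0)).card :=
      Finset.card_pos.2 ⟨q, Finset.mem_filter.2 ⟨hq, neg_pos.1 hqα⟩⟩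
    obtain ⟨γp, hγp, hγpv⟩ := ToralBif.exists_shuffle (P.filter (0 ≤ b₀ * a₁ ·))
    obtain ⟨γm, hγm, hγmv⟩ := ToralBif.exists_shuffle (P.filter (b₀ * a₁ · < 0))
    have hkl : (P.filter (b₀ * a₁ · < 0)).card = k - (P.filter (0 ≤ b₀ * a₁ ·)).card := by omega
    rw [hkl] at hγm hγmv
    have hl : (P.filter (0 ≤ b₀ * a₁ ·)).card ≤ k := by omega
    have hsigns : ∀ i, a₁ i * b < 0 ↔ b₀ * a₁ i < 0 := fun i => by rw [hiff, mul_comm]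
    refine ⟨_, γp, γm, by omega,
      ToralBif.mem_subShuffles.2 ⟨hγp, hγpv.le.trans <| Finset.filter_subset _ _⟩,
      ToralBif.mem_subShuffles.2 ⟨hγm, hγmv.le.trans <| Finset.filter_subset _ _⟩, fun i hi => ?_,
      fun i hi => ?_, ToralBif.roundCW _ _, fun m c => ?_, fun ν hν => ?_⟩
    · rw [hγpv, Finset.mem_filter] at hi
      rw [← not_lt, hsigns, not_lt]
      exact hi.2
    · rw [hγmv, Finset.mem_filter] at hi
      exact (hsigns i).2 hi.2
    · rw [← ToralBif.exists_faceIndex_iff hb₀0 hkn hl hγpv hγmv]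
      exact exists_congr fun e => by rw [ToralBif.roundCW_openCell e]
    · rw [hiff] at hν
      rw [h𝒯' ν hν]
      refine ⟨ToralBif.flowInvariant_toralSet hP hν, ToralBif.isCompact_toralSet (hRc hν) (hRp hν),
        ToralBif.isConnected_toralSet (hRc hν) (hRp hν) hne, fun z hz => ?_, fun C hC => ?_,
        ToralBif.toralCW (hRc hν) (hRp hν), fun m e L h => ?_, fun m e x =>
          ToralBif.toralCW_mem_leaf (hRc hν) (hRp hν) e x⟩
      · obtain ⟨C, hC, hl, -⟩ := ToralBif.mem_leaf_of_mem_toralSet hP hν hz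
        exact ToralBif.supportedIn_of_mem_leaf hC hl
      · simp only [ToralBif.isInvariantHypertorus_iff hP hC, hν, true_and]
        exact existsUnique_eq
      · rw [ToralBif.roundCW_openCell e] at h
        exact ToralBif.label_eq_of_isGammaCell e h
  · filter_upwards [ToralBif.eventually_toralSet_subset (a₁ := a₁) hP hU] with ν h hν
    rw [hiff] at hν
    rw [h𝒯' ν hν]
    exact h hν
  · obtain ⟨N, hN⟩ :=
      ToralBif.exists_forall_lt_norm (a₁ := a₁) (α := fun i => b₀ * a₁ i) hP ρ
    refine ⟨N, fun ν hNν hν => ?_⟩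
    rw [hiff] at hν
    rw [h𝒯' ν hν]
    exact hN ν hNν hν
  · rw [hiff] at hν
    rw [h𝒯' ν hν, hbneg, hbpos]
    exact ⟨fun h => ⟨ToralBif.asymptoticallyStableOn_toralSet hP hν h,
      ToralBif.lyapunovStableOn_toralSet hP hν h⟩, fun h =>
      ToralBif.not_lyapunovStableOn_toralSet hP hν h
        (ToralBif.isConnected_toralSet (hRc hν) (hRp hν) hne).nonempty⟩
  · rw [← not_lt, hiff, not_lt] at hν
    obtain ⟨φ⟩ := hhom
    have : CompactSpace H := φ.symm.compactSpace
    exact ToralBif.not_flowInvariant_of_isCompact hP hν hH (isCompact_iff_compactSpace.2 this)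
      (nonempty_subtype.1 ⟨φ.symm fun _ => 1⟩)
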